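/- Let $n\ge 1$, $r\ge 2$. Let $\mathcal N$ be the $n\times n$ nilpotent Jordan block (ones on the superdiagonal), $G=\mathrm{diag}(0,1,\dots,n-1)$, and let $\mathcal H(x)$ be the $n\times n$ matrix with ones on the subdiagonal, $x$ in the upper right corner and zeros elsewhere (so $\mathcal H(x)=(x)$ if $n=1$). Consider polynomial connections $\partial_x-A(x)$, $A(x)=\sum_{j=1}^{r}A_jx^{j-1}$, $A_j\in\mathrm{Mat}_n(\mathbb C)$, in the gauge-fixed form: there are numbers $t_{rn},t_{rn-1},\dots,t_{rn-n+1}$ (and $t_{rn-1}$ also when $n=1$) such that $$A_r=\frac1n\sum_{j=0}^{n-1}t_{rn-j}\,\mathcal N^j,\qquad (A_{r-1})_{n1}=\frac{t_{rn-1}}n\neq0,$$ and such that some eigenvalue of $A(x)$ has the Puiseux expansion $y=\frac1n x^{r-1}\big(\sum_{j=0}^{n-1}t_{rn-j}x^{-j/n}+O(x^{-1})\big)$ at $x=\infty$. Then: 1. There are unique $t_0,t_1,\dots,t_{rn}\in\mathbb C$ and a unique formal series $Y(x)=\mathbf 1+U+O(x^{-1})$ in $x^{-1}$, with $U$ strictly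 upper triangular and independent of $x$, such that $$\Psi=Y(x)\,\exp\Big[\sum_{J=1}^{rn}\frac{t_J}{J}\mathcal H(x)^J\Big]\,x^{\,t_0-G/n}$$ is a formal solution of $\Psi'=A\Psi$. The numbers $t_{rn-j}$, $0\le j<n$, so obtained are those in the gauge-fixed form, and $t_{rn-1}\ne 0$. 2. $U$ commutes with $\mathcal N$. Its entries are polynomials in the entries of the $A_j$ divided by a power of $t_{rn-1}$; the polynomials and the power depend only on $n$ and $r$. 3. Put $\mathcal T_J(x)=\frac1J\big(Y\mathcal H^J Y^{-1}\big)_+$, $J=1,\dots,rn$, where $(\cdot)_+$ is the projection onto nonnegative powers of $x$. Call *deformation* a holomorphic family $A(x;t)$ of gauge-fixed connections, $t=(t_1,\dots,t_{rn})$ in an open set $W\subset\mathbb C^{rn}$, such that the times of $A(\cdot;t)$ given by part 1 are the coordinates of $t$ and $[\partial_{t_J}-\mathcal T_J,\partial_x-A]=0$ for all $J$. Every gauge-fixed connection with times $t^{*}$ is the value at $t^{*}$ of a deformation defined on an open neighbourhood of $t^{*}$. 4. For every deformation, the matrices $\mathcal T_J$ are holomorphic in $t$, and the operators $\partial_x-A$,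 $\partial_{t_J}-\mathcal T_J$ ($J=1,\dots,rn$) satisfy pairwise the zero-curvature conditions. The Pfaffian system $\partial_x\Psi=A\Psi$, $\partial_{t_J}\Psi=\mathcal T_J\Psi$ is Frobenius integrable: for every $(x_1,t_1)\in\mathbb C\times W$ and every matrix $C$ there is a holomorphic solution near $(x_1,t_1)$ with $\Psi(x_1,t_1)=C$. The matrix $U$ is a constant of all the flows, $\partial_{t_J}U=0$ for all $J$; and conjugation by $\mathbf 1+U$, that is $A\mapsto(\mathbf 1+U)^{-1}A(\mathbf 1+U)$, $Y\mapsto(\mathbf 1+U)^{-1}Y$, gives a deformation with the same times and with $U=0$. -/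

import Mathlib

open Polynomial

namespace JordanConnection

/-! Polynomial connections `∂ₓ - A(x)` on `ℂⁿ`. A vector of times `t : Fin (r * n) → ℂ` stores
`t_{i+1}` at the index `i`, so the times are `t_1, …, t_{rn}`. Formal series at `x = ∞` are power
series, or Laurent series, in the local parameter `z = 1/x`. -/

/-- The time `t_J`, for `1 ≤ J ≤ r n`. -/
noncomputable def time {n r : ℕ} (t : Fin (r * n) → ℂ) (J : ℕ) : ℂ :=
  if h : 1 ≤ J ∧ J ≤ r * n then t ⟨J - 1, by omega⟩ else 0

/-- The nilpotent Jordan block `𝒩`, with ones just above the diagonal. -/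
def jordanN (n : ℕ) : Matrix (Fin n) (Fin n) ℂ :=
  Matrix.of fun i j => if j.val = i.val + 1 then 1 else 0

/-- The matrix `ℋ(x)`: ones just below the diagonal and `x` in the upper right corner. -/
noncomputable def matH (n : ℕ) : Matrix (Fin n) (Fin n) ℂ[X] :=
  Matrix.of fun i j =>
    if i.val = j.val + 1 then 1 else if i.val = 0 ∧ j.val + 1 = n then X else 0

/-- Value at the point `x` of a polynomial matrix. -/
noncomputable def evalAt {n : ℕ} (F : Matrix (Fin n) (Fin n) ℂ[X]) (x : ℂ) :
    Matrix (Fin n) (Fin n) ℂ :=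
  F.map (Polynomial.eval x)

/-- The substitution `x = s⁻ᵐ`, from polynomials in `x` to Laurent series in `s`. For `m = 1` it is
the expansion at `x = ∞` in `z = 1/x`. -/
noncomputable def substInvPow (m : ℕ) : ℂ[X] →ₐ[ℂ] LaurentSeries ℂ :=
  Polynomial.aeval (HahnSeries.single (-(m : ℤ)) (1 : ℂ))

/-- Expansion at `x = ∞` of a polynomial matrix. -/
noncomputable def polyAtInfty {n : ℕ} (F : Matrix (Fin n) (Fin n) ℂ[X]) :
    Matrix (Fin n) (Fin n) (LaurentSeries ℂ) :=
  F.map (substInvPow 1)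

/-- A matrix of power series in `z = 1/x`, seen as a matrix of Laurent series. -/
noncomputable def seriesAtInfty {n : ℕ} (Y : Matrix (Fin n) (Fin n) (PowerSeries ℂ)) :
    Matrix (Fin n) (Fin n) (LaurentSeries ℂ) :=
  Y.map (HahnSeries.ofPowerSeries ℤ ℂ)

/-- The derivative `d/dx = - z² d/dz` of a matrix of power series in `z = 1/x`. -/
noncomputable def dxSeries {n : ℕ} (Y : Matrix (Fin n) (Fin n) (PowerSeries ℂ)) :
    Matrix (Fin n) (Fin n) (PowerSeries ℂ) :=
  Y.map fun f => -(PowerSeries.X ^ 2 * PowerSeries.derivative ℂ f)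

/-- The constant term `Y(∞) = 1 + U` of a matrix of power series in `z = 1/x`. -/
noncomputable def valueAtInfty {n : ℕ} (Y : Matrix (Fin n) (Fin n) (PowerSeries ℂ)) :
    Matrix (Fin n) (Fin n) ℂ :=
  Y.map PowerSeries.constantCoeff

/-- The matrix `U` of the formal gauge `Y = 1 + U + O(1/x)`. -/
noncomputable def casimirU {n : ℕ} (Y : Matrix (Fin n) (Fin n) (PowerSeries ℂ)) :
    Matrix (Fin n) (Fin n) ℂ :=
  valueAtInfty Y - 1

/-- `A(x)` is a polynomial connection `∑_{k < r} A_{k+1} x^k` whose leading coefficient is a single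
Jordan block in the gauge-fixed form: with `τ_j` in the role of `t_{rn-j}`,
* `A_r = (1/n) ∑_{j<n} τ_j 𝒩^j`,
* the lower left entry of the subleading coefficient `A_{r-1}` is `τ_1 / n ≠ 0`,
* `τ_0, …, τ_{n-1}` are the first `n` coefficients of the Puiseux expansion at `x = ∞` of an
  eigenvalue: `y = (1/n) x^{r-1} (τ_0 + τ_1 x^{-1/n} + ⋯ + τ_{n-1} x^{-(n-1)/n} + O(x⁻¹))`.
The Puiseux series is a Laurent series in `s = x^{-1/n}`. -/
structure IsGaugeFixed (n r : ℕ) (τ : ℕ → ℂ) (A : Matrix (Fin n) (Fin n) ℂ[X]) : Prop where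
  degree_lt : ∀ i j, (A i j).degree < r
  leading : A.map (fun p => p.coeff (r - 1)) =
    (1 / n : ℂ) • ∑ j ∈ Finset.range n, τ j • jordanN n ^ j
  corner : ∀ i j : Fin n, i.val + 1 = n → j.val = 0 → (A i j).coeff (r - 2) = τ 1 / n
  lidskii_ne_zero : τ 1 ≠ 0
  eigenvalue : ∃ y : LaurentSeries ℂ,
    (A.map (substInvPow n)).charpoly.IsRoot y ∧
    (∀ k : ℤ, k < -((n : ℤ) * (r - 1)) → y.coeff k = 0) ∧
    ∀ j : ℕ, j < n → y.coeff (j - (n : ℤ) * (r - 1)) = τ j / n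

/-- The function `exp (∑_{J=1}^{rn} (t_J / J) ℋ(x)^J) x^{t_0 - G/n}`, `G = diag (0, 1, …, n-1)`,
with the principal branch of the powers of `x`. -/
noncomputable def bareSolution (n r : ℕ) (t0 : ℂ) (t : Fin (r * n) → ℂ) (x : ℂ) :
    Matrix (Fin n) (Fin n) ℂ :=
  NormedSpace.exp (∑ J ∈ Finset.Icc 1 (r * n), (time t J / J) • evalAt (matH n) x ^ J) *
    Matrix.diagonal fun k : Fin n => x ^ (t0 - (k.val : ℂ) / n)

/-- The matrix function `E` satisfies `E'(x) = x⁻¹ P(x) E(x)` off the cut `(-∞, 0]`. -/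
def HasLogDeriv {n : ℕ} (E : ℂ → Matrix (Fin n) (Fin n) ℂ)
    (P : Matrix (Fin n) (Fin n) ℂ[X]) : Prop :=
  ∀ x ∈ Complex.slitPlane, ∀ i j,
    HasDerivAt (fun w => E w i j) ((x⁻¹ • (evalAt P x * E x)) i j) x

/-- `Ψ = Y(x) exp (∑ (t_J / J) ℋ(x)^J) x^{t_0 - G/n}`, with `Y = 1 + U + O(1/x)` a formal series and
`U` strictly upper triangular, is a formal solution of `Ψ' = A Ψ`. Since the second factor `E` is an
invertible function with `E' = x⁻¹ P(x) E`, where `P` is a polynomial matrix, this means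
`Y' + x⁻¹ Y P = A Y` as formal series. -/
structure IsFormalSolution (n r : ℕ) (A : Matrix (Fin n) (Fin n) ℂ[X]) (t0 : ℂ)
    (t : Fin (r * n) → ℂ) (Y : Matrix (Fin n) (Fin n) (PowerSeries ℂ)) : Prop where
  strictUpper : ∀ i j : Fin n, j ≤ i → casimirU Y i j = 0
  equation : ∃ P : Matrix (Fin n) (Fin n) ℂ[X], HasLogDeriv (bareSolution n r t0 t) P ∧
    seriesAtInfty (dxSeries Y) +
      (HahnSeries.single (1 : ℤ) (1 : ℂ) : LaurentSeries ℂ) • (seriesAtInfty Y * polyAtInfty P) =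
      polyAtInfty A * seriesAtInfty Y

/-- The projection `( )₊` of a Laurent series in `z = 1/x` onto nonnegative powers of `x`. -/
noncomputable def posPart (f : LaurentSeries ℂ) : ℂ[X] :=
  ∑ k ∈ Finset.range ((-f.order).toNat + 1), Polynomial.monomial k (f.coeff (-(k : ℤ)))

theorem coeff_posPart (f : LaurentSeries ℂ) (k : ℕ) :
    (posPart f).coeff k = f.coeff (-(k : ℤ)) := by
  simp only [posPart, Polynomial.finsetSum_coeff, Polynomial.coeff_monomial,
    Finset.sum_ite_eq', Finset.mem_range]
  split_ifs with h
  · rfl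
  · exact (HahnSeries.coeff_eq_zero_of_lt_order (by omega)).symm

/-- The deformation matrix `𝒯_J = (1/J) (Y ℋ^J Y⁻¹)₊`. -/
noncomputable def defMatrix {n : ℕ} (Y : Matrix (Fin n) (Fin n) (PowerSeries ℂ)) (J : ℕ) :
    Matrix (Fin n) (Fin n) ℂ[X] :=
  (1 / J : ℂ) • (seriesAtInfty Y * polyAtInfty (matH n) ^ J * (seriesAtInfty Y)⁻¹).map posPart

/-- The derivative `d/dx` of a polynomial matrix. -/
noncomputable def dxPoly {n : ℕ} (F : Matrix (Fin n) (Fin n) ℂ[X]) :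
    Matrix (Fin n) (Fin n) ℂ[X] :=
  F.map Polynomial.derivative

/-- `F(x; t)` is holomorphic in the times `t` on the set `W`. -/
def HolomorphicOn {n m : ℕ} (W : Set (Fin m → ℂ))
    (F : (Fin m → ℂ) → Matrix (Fin n) (Fin n) ℂ[X]) : Prop :=
  ∀ x i j, DifferentiableOn ℂ (fun t => evalAt (F t) x i j) W

/-- The partial derivative of `F(x; t)` with respect to the coordinate of `t` of index `J`. -/
noncomputable def dTime {n m : ℕ} (J : Fin m)
    (F : (Fin m → ℂ) → Matrix (Fin n) (Fin n) ℂ[X]) (t : Fin m → ℂ) (x : ℂ) :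
    Matrix (Fin n) (Fin n) ℂ :=
  Matrix.of fun i j => deriv (fun s => evalAt (F (Function.update t J s)) x i j) (t J)

/-- `[∂_J - T, ∂ₓ - A] = 0` on `W`, where `∂_J` is the derivative in the coordinate `J`. -/
def ZeroCurvatureX {n m : ℕ} (W : Set (Fin m → ℂ)) (J : Fin m)
    (T A : (Fin m → ℂ) → Matrix (Fin n) (Fin n) ℂ[X]) : Prop :=
  ∀ t ∈ W, ∀ x, dTime J A t x - evalAt (dxPoly (T t)) x +
    (evalAt (A t) x * evalAt (T t) x - evalAt (T t) x * evalAt (A t) x) = 0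

/-- `[∂_J - T, ∂_K - S] = 0` on `W`. -/
def ZeroCurvatureT {n m : ℕ} (W : Set (Fin m → ℂ)) (J K : Fin m)
    (T S : (Fin m → ℂ) → Matrix (Fin n) (Fin n) ℂ[X]) : Prop :=
  ∀ t ∈ W, ∀ x, dTime J S t x - dTime K T t x +
    (evalAt (S t) x * evalAt (T t) x - evalAt (T t) x * evalAt (S t) x) = 0

/-- A holomorphic family `A(x; t)`, `t ∈ W`, of gauge-fixed connections whose times are the
coordinates `t_1, …, t_{rn}`, with formal gauges `Y(x; t)`, which moves along the flows
`∂_{t_J} A = ∂ₓ 𝒯_J + [𝒯_J, A]`. The index `J` of a coordinate stands for the time `t_{J+1}`. -/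
structure IsDeformation (n r : ℕ) (W : Set (Fin (r * n) → ℂ))
    (A : (Fin (r * n) → ℂ) → Matrix (Fin n) (Fin n) ℂ[X])
    (Y : (Fin (r * n) → ℂ) → Matrix (Fin n) (Fin n) (PowerSeries ℂ)) : Prop where
  isOpen : IsOpen W
  gaugeFixed : ∀ t ∈ W, IsGaugeFixed n r (fun j => time t (r * n - j)) (A t)
  formalSolution : ∀ t ∈ W, ∃ t0, IsFormalSolution n r (A t) t0 t (Y t)
  holomorphic : HolomorphicOn W A
  flow : ∀ J : Fin (r * n), ZeroCurvatureX W J (fun t => defMatrix (Y t) (J.val + 1)) A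

/-- The Pfaffian system `∂ₓ Ψ = A Ψ`, `∂_J Ψ = T_J Ψ` on `ℂ × W` is completely integrable: through
every point and for every initial value there is a local holomorphic solution. -/
def PfaffianIntegrable {n m : ℕ} (W : Set (Fin m → ℂ))
    (A : (Fin m → ℂ) → Matrix (Fin n) (Fin n) ℂ[X])
    (T : Fin m → (Fin m → ℂ) → Matrix (Fin n) (Fin n) ℂ[X]) : Prop :=
  ∀ (x₁ : ℂ), ∀ t₁ ∈ W, ∀ C : Matrix (Fin n) (Fin n) ℂ,
    ∃ (O : Set (ℂ × (Fin m → ℂ))) (Ψ : ℂ × (Fin m → ℂ) → Matrix (Fin n) (Fin n) ℂ),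
      IsOpen O ∧ (x₁, t₁) ∈ O ∧ O ⊆ Set.univ ×ˢ W ∧ Ψ (x₁, t₁) = C ∧
      (∀ i j, DifferentiableOn ℂ (fun p => Ψ p i j) O) ∧
      ∀ x t, (x, t) ∈ O →
        (∀ i j, HasDerivAt (fun w => Ψ (w, t) i j) ((evalAt (A t) x * Ψ (x, t)) i j) x) ∧
        ∀ J i j, HasDerivAt (fun s => Ψ (x, Function.update t J s) i j)
          ((evalAt (T J t) x * Ψ (x, t)) i j) (t J)

end JordanConnection

/-! Put `z = 1/x`, `z = sⁿ`, `W = ℋ⁻¹`. Multiplied by `n z^{r-1}`, the equation `Ψ' = A Ψ` becomes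
`Â Y + z^r (n z dY/dz + Y G) = Y p(W)`, where `Â = n z^{r-1} A` and `p = n t₀ s^{rn} + ∑ t_J
s^{rn-J}` (`isFormalSolution_iff`). Read a row of `Y` as the single series `∑_j Y_{ij}(sⁿ) s^j`:
right multiplication by `W` is then multiplication by `s`, and the bracket is `s d/ds`. So the
matrix problem is a vector problem over power series in `s` with a scalar right hand side `p`. After
division of the row `i` by `s^i` its coefficient matrix is `β₀ + β₁ S s + O(s²)`, with `S` the
cyclic shift and `β₁ = t_{rn-1} ≠ 0`.

The operator `S - 1` is invertible on vectors of sum zero, and the remaining direction is taken up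
by the scalar. This gives a recursion that divides only by `β₁` and by nonzero integers
(`exists_normalized`); a scalar factor in `s` then cuts `p` off beyond the order `rn`. The same
recursion, read as a rigidity statement (`eq_zero_of_truncated`), yields the uniqueness, the
uniqueness for the linearized equation, and the agreement of `p` with a Puiseux eigenvalue below the
order `rn`. Over the polynomial ring localized at the corner coefficient it produces a generic gauge
(`exists_generic`), whence the rationality of `U` and the holomorphic dependence of everything on
the coefficients of `A`. The constant term of the equation makes `1 + U` commute with a polynomial
in `𝒩` whose linear coefficient is not zero, hence with `𝒩`.

For the flows put `Θ_J = z^r Y ℋ^J Y⁻¹ / J = T_J + z^r Ξ_J`, where `T_J` has order at most `r` and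
`Ξ_J = O(z)`. A Lax equation for `Θ_J` gives two expressions for `∂ₓ𝒯_J + [𝒯_J, A]`: the one in
`T_J` is a polynomial in `x`, and the one in `Ξ_J` bounds its degree and preserves the shape of the
leading terms. So the flows are vector fields on a finite dimensional space of connections.
Linearized uniqueness gives `∂_J Y = -Ξ_J Y` and `∂_J p = s^{rn-J}` (`deriv_gauge_of_flow`): the
times move like coordinates, and `U` does not move because `Ξ_J = O(z)`. It follows that `∂_J Θ_K =
[Θ_K, Ξ_J]`, and truncation of `[Θ_J, Θ_K] = 0` is the zero curvature of the flows, so that the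
vector fields commute.

The Frobenius theorem (`exists_local_solution_of_symm`), applied to the commuting fields, gives the
deformations; applied to the linear system, it gives the solutions of the Pfaffian system.
Conversely, every deformation moves along the generic fields (`IsDeformation.hasDerivAt_params`), so
the formulas hold for all of them. -/

namespace JordanConnection

/-! ### The Frobenius theorem for total differential equations -/

section Frobenius

open Metric Set Topology

/-- Besides the solution, the Picard iteration provides the bound on its range, which the comparison
of neighbouring rays needs. The fixed point is extended to the real line through the projection onto
`[0, 1]`, so the bound holds for every `t`. -/
theorem exists_solution_mem_closedBall {E : Type*} [NormedAddCommGroup E] [NormedSpace ℝ E]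
    [CompleteSpace E] {f : ℝ → E → E} {x₀ : E} {a L K : NNReal}
    (hf : IsPicardLindelof f (⟨0, by simp⟩ : Icc (0 : ℝ) 1) x₀ a 0 L K) :
    ∃ α : ℝ → E, α 0 = x₀ ∧ (∀ t, α t ∈ closedBall x₀ a) ∧
      ∀ t ∈ Icc (0 : ℝ) 1, HasDerivWithinAt α (f t (α t)) (Icc 0 1) t := by
  have hx : x₀ ∈ closedBall x₀ ((0 : NNReal) : ℝ) := by simp
  obtain ⟨α, hα⟩ := ODE.FunSpace.exists_isFixedPt_next hf hx
  have key : ∀ t ∈ Icc (0 : ℝ) 1, α.compProj t = ODE.picard f 0 x₀ α.compProj t := by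
    intro t ht
    conv_lhs => rw [← hα]
    rw [ODE.FunSpace.compProj_apply, ODE.FunSpace.next_apply, projIcc_of_mem _ ht]
  refine ⟨α.compProj, ?_, fun t => α.compProj_mem_closedBall hf.mul_max_le, fun t ht => ?_⟩
  · rw [key 0 (by simp)]; simp
  · have hc : ContinuousOn (Function.uncurry f) (Icc (0 : ℝ) 1 ×ˢ closedBall x₀ a) :=
      continuousOn_prod_of_continuousOn_lipschitzOnWith' _ K hf.lipschitzOnWith hf.continuousOn
    exact (ODE.hasDerivWithinAt_picard_Icc (by simp) hc α.continuous_compProj.continuousOn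
      (fun t _ => α.compProj_mem_closedBall hf.mul_max_le) x₀ ht).congr key (key t ht)

/-- Without initial error the bound is linear in the defect `ε`; a defect of order `‖h‖²` thus costs
only `O(‖h‖²)` at time one. -/
theorem gronwallBound_zero_eq_mul (K ε x : ℝ) :
    gronwallBound 0 K ε x = ε * gronwallBound 0 K 1 x := by
  unfold gronwallBound
  split_ifs <;> ring

/-- Taylor's estimate: on the part of `s` within distance `‖q' - q‖` of `q` the derivative varies by
at most `K ‖q' - q‖`, and the mean value inequality applies on this convex set. -/
theorem norm_sub_sub_fderiv_le {Z G : Type*} [NormedAddCommGroup Z] [NormedSpace ℂ Z]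
    [NormedAddCommGroup G] [NormedSpace ℂ G] {F : Z → G} {s : Set Z} (hs : Convex ℝ s) {K : ℝ}
    (hK : 0 ≤ K)
    (hd : ∀ q ∈ s, DifferentiableAt ℂ F q)
    (hL : ∀ q ∈ s, ∀ q' ∈ s, ‖fderiv ℂ F q' - fderiv ℂ F q‖ ≤ K * ‖q' - q‖) {q q' : Z}
    (hq : q ∈ s) (hq' : q' ∈ s) :
    ‖F q' - F q - fderiv ℂ F q (q' - q)‖ ≤ K * ‖q' - q‖ ^ 2 := by
  have h := Convex.norm_image_sub_le_of_norm_fderiv_le' (𝕜 := ℂ) (f := F)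
    (s := s ∩ closedBall q ‖q' - q‖) (C := K * ‖q' - q‖) (φ := fderiv ℂ F q) (x := q) (y := q')
    (fun x hx => hd x hx.1) (fun x hx => (hL q hq x hx.1).trans (by
      have := mem_closedBall_iff_norm.1 hx.2
      gcongr)) (hs.inter (convex_closedBall _ _)) ⟨hq, by simp⟩ ⟨hq', by simp [dist_eq_norm]⟩
  linarith [h, sq ‖q' - q‖, mul_assoc K ‖q' - q‖ ‖q' - q‖]

variable {P E : Type*} [NormedAddCommGroup P] [NormedSpace ℂ P] [NormedAddCommGroup E]
  [NormedSpace ℂ E]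

/-- Bounds for a `C²` field of linear maps near a point. -/
structure FieldBounds (F : P × E → (P →L[ℂ] E)) (q₀ : P × E) (R M K : ℝ) : Prop where
  R_pos : 0 < R
  M_pos : 0 ≤ M
  K_pos : 0 ≤ K
  diff : ∀ q ∈ ball q₀ R, DifferentiableAt ℂ F q
  bound : ∀ q ∈ ball q₀ R, ‖F q‖ ≤ M
  bound_deriv : ∀ q ∈ ball q₀ R, ‖fderiv ℂ F q‖ ≤ M
  lip_deriv : ∀ q ∈ ball q₀ R, ∀ q' ∈ ball q₀ R, ‖fderiv ℂ F q' - fderiv ℂ F q‖ ≤ K * ‖q' - q‖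
  symm : ∀ q ∈ ball q₀ R, ∀ h k, fderiv ℂ F q (h, F q h) k = fderiv ℂ F q (k, F q k) h

theorem exists_fieldBounds {F : P × E → (P →L[ℂ] E)} {q₀ : P × E} (hF : ContDiffAt ℂ 2 F q₀)
    (hsymm : ∀ᶠ q in 𝓝 q₀, ∀ h k, fderiv ℂ F q (h, F q h) k = fderiv ℂ F q (k, F q k) h) :
    ∃ R M K, FieldBounds F q₀ R M K := by
  have h1 : ContDiffAt ℂ 1 (fderiv ℂ F) q₀ := hF.fderiv_right (by norm_num)
  obtain ⟨K, t, ht, hK⟩ := h1.exists_lipschitzOnWith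
  have e1 : ∀ᶠ q in 𝓝 q₀, DifferentiableAt ℂ F q :=
    (hF.eventually (by simp)).mono fun q hq => hq.differentiableAt (by norm_num)
  have e2 : ∀ᶠ q in 𝓝 q₀, ‖F q‖ < ‖F q₀‖ + 1 :=
    hF.continuousAt.norm.eventually_lt continuousAt_const (lt_add_one _)
  have e3 : ∀ᶠ q in 𝓝 q₀, ‖fderiv ℂ F q‖ < ‖fderiv ℂ F q₀‖ + 1 := by
    filter_upwards [h1.continuousAt.eventually (Metric.ball_mem_nhds _ one_pos)] with q hq
    have h2 := norm_sub_norm_le (fderiv ℂ F q) (fderiv ℂ F q₀)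
    have h3 := mem_ball_iff_norm.1 hq
    linarith
  obtain ⟨R, hR, hball⟩ := Metric.eventually_nhds_iff_ball.1
    (e1.and (e2.and (e3.and (hsymm.and (Filter.eventually_mem_set.2 ht)))))
  refine ⟨R, max (‖F q₀‖ + 1) (‖fderiv ℂ F q₀‖ + 1), K, hR, by positivity, K.2,
    fun q hq => (hball q hq).1, fun q hq => ((hball q hq).2.1.le).trans (le_max_left _ _),
    fun q hq => ((hball q hq).2.2.1.le).trans (le_max_right _ _), fun q hq q' hq' => ?_,
    fun q hq => (hball q hq).2.2.2.1⟩
  have := hK.dist_le_mul q' (hball q' hq').2.2.2.2 q (hball q hq).2.2.2.2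
  rwa [dist_eq_norm, dist_eq_norm] at this

theorem FieldBounds.lip {F : P × E → (P →L[ℂ] E)} {q₀ : P × E} {R M K : ℝ}
    (H : FieldBounds F q₀ R M K) {q q' : P × E} (hq : q ∈ ball q₀ R) (hq' : q' ∈ ball q₀ R) :
    ‖F q' - F q‖ ≤ M * ‖q' - q‖ :=
  Convex.norm_image_sub_le_of_norm_fderiv_le (𝕜 := ℂ) H.diff H.bound_deriv (convex_ball _ _) hq hq'

/-- On a ray from `p₀` the total differential equation becomes an ordinary one. The condition `M ‖τ‖
≤ R / 2` keeps its solution inside the ball up to time one. -/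
theorem FieldBounds.exists_ray [CompleteSpace E] {F : P × E → (P →L[ℂ] E)} {p₀ : P} {u₀ : E} {R M K : ℝ}
    (H : FieldBounds F (p₀, u₀) R M K) {τ : P} (hτ : ‖τ‖ < R) (hτ' : M * ‖τ‖ ≤ R / 2) :
    ∃ α : ℝ → E, α 0 = u₀ ∧ (∀ t, α t ∈ closedBall u₀ (R / 2)) ∧
      ∀ t ∈ Icc (0 : ℝ) 1, HasDerivWithinAt α (F (p₀ + t • τ, α t) τ) (Icc 0 1) t := by
  have hR := H.R_pos
  have mem : ∀ t ∈ Icc (0 : ℝ) 1, ∀ u ∈ closedBall u₀ (R / 2),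
      (p₀ + t • τ, u) ∈ ball (p₀, u₀) R := by
    intro t ht u hu
    rw [mem_ball, Prod.dist_eq, max_lt_iff]
    refine ⟨?_, lt_of_le_of_lt hu (by linarith)⟩
    simp only [dist_eq_norm, add_sub_cancel_left, norm_smul, Real.norm_eq_abs, abs_of_nonneg ht.1]
    exact lt_of_le_of_lt (mul_le_of_le_one_left (norm_nonneg _) ht.2) hτ
  have := exists_solution_mem_closedBall (f := fun t u => F (p₀ + t • τ, u) τ) (x₀ := u₀)
    (a := ⟨R / 2, by linarith⟩) (L := ⟨M * ‖τ‖, mul_nonneg H.M_pos (norm_nonneg _)⟩)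
    (K := ⟨M * ‖τ‖, mul_nonneg H.M_pos (norm_nonneg _)⟩)
    { lipschitzOnWith := fun t ht => LipschitzOnWith.of_dist_le_mul fun u hu u' hu' => by
        rw [dist_eq_norm, dist_eq_norm, ← sub_apply]
        refine (ContinuousLinearMap.le_opNorm _ _).trans ?_
        have := H.lip (mem t ht u' hu') (mem t ht u hu)
        have e : ‖((p₀ + t • τ, u) : P × E) - (p₀ + t • τ, u')‖ = ‖u - u'‖ := by simp [Prod.norm_def]
        rw [e] at this
        calc _ ≤ (M * ‖u - u'‖) * ‖τ‖ := by gcongr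
          _ = M * ‖τ‖ * ‖u - u'‖ := by ring
      continuousOn := fun u hu t ht => by
        have := (H.diff _ (mem t ht u hu)).continuousAt
        have h2 : ContinuousAt (fun t : ℝ => ((p₀ + t • τ, u) : P × E)) t := by fun_prop
        exact ((ContinuousAt.comp (f := fun t : ℝ => ((p₀ + t • τ, u) : P × E)) this
          h2).clm_apply continuousAt_const).continuousWithinAt
      norm_le := fun t ht u hu => (ContinuousLinearMap.le_opNorm _ _).trans
        (mul_le_mul_of_nonneg_right (H.bound _ (mem t ht u hu)) (norm_nonneg _))
      mul_max_le := by
        change M * ‖τ‖ * max (1 - 0) (0 - 0) ≤ R / 2 - 0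
        simpa using hτ' }
  exact this

/-- The solution on the ray to `τ`, corrected by `s F h`, satisfies the equation of the ray to `τ +
h` up to `O(‖h‖²)`, because the symmetry cancels the terms linear in `h`. Grönwall's inequality
compares it with the true solution, and the value at time one exhibits `F` as the derivative. -/
theorem FieldBounds.hasFDerivAt_ray {F : P × E → (P →L[ℂ] E)} {p₀ : P} {u₀ : E} {R M K : ℝ}
    (H : FieldBounds F (p₀, u₀) R M K) {δ : ℝ} (hδR : δ ≤ R / 2) {α : P → ℝ → E}
    (h0 : ∀ τ, ‖τ‖ < δ → α τ 0 = u₀)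
    (hmem : ∀ τ, ‖τ‖ < δ → ∀ t, α τ t ∈ closedBall u₀ (R / 2))
    (hα : ∀ τ, ‖τ‖ < δ → ∀ t ∈ Icc (0 : ℝ) 1,
      HasDerivWithinAt (α τ) (F (p₀ + t • τ, α τ t) τ) (Icc 0 1) t)
    {τ : P} (hτ : ‖τ‖ < δ) :
    HasFDerivAt (fun σ => α σ 1) (F (p₀ + τ, α τ 1)) τ := by
  have hR := H.R_pos
  have hM := H.M_pos
  have hK := H.K_pos
  have hδ : 0 ≤ δ := (norm_nonneg τ).trans hτ.le
  have mem : ∀ σ : P, ‖σ‖ < δ → ∀ t ∈ Icc (0 : ℝ) 1, ∀ u ∈ ball u₀ R,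
      (p₀ + t • σ, u) ∈ ball (p₀, u₀) R := by
    intro σ hσ t ht u hu
    rw [mem_ball, Prod.dist_eq, max_lt_iff]
    refine ⟨?_, hu⟩
    simp only [dist_eq_norm, add_sub_cancel_left, norm_smul, Real.norm_eq_abs, abs_of_nonneg ht.1]
    exact lt_of_le_of_lt (mul_le_of_le_one_left (norm_nonneg _) ht.2) (by linarith)
  have hmem' : ∀ σ, ‖σ‖ < δ → ∀ t, α σ t ∈ ball u₀ R := fun σ hσ t =>
    closedBall_subset_ball (by linarith) (hmem σ hσ t)
  set C : ℝ := (M * max 1 M + K * (max 1 M) ^ 2 * δ) * gronwallBound 0 (M * δ) 1 1 with hC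
  have main : ∀ h : P, ‖τ + h‖ < δ → M * ‖h‖ < R / 2 →
      ‖α (τ + h) 1 - α τ 1 - F (p₀ + τ, α τ 1) h‖ ≤ C * ‖h‖ ^ 2 := by
    intro h hh hMh
    -- The approximate solution on the ray to `τ + h`; at `s = 1` it is the linear approximation to
    -- be proved.
    set v : ℝ → E := fun s => α τ s + s • F (p₀ + s • τ, α τ s) h with hv
    have hq : ∀ s ∈ Icc (0 : ℝ) 1, (p₀ + s • τ, α τ s) ∈ ball (p₀, u₀) R := fun s hs =>
      mem τ hτ s hs _ (hmem' τ hτ s)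
    have hvmem : ∀ s ∈ Icc (0 : ℝ) 1, v s ∈ ball u₀ R := by
      intro s hs
      have h1 := mem_closedBall_iff_norm.1 (hmem τ hτ s)
      have h2 : ‖s • F (p₀ + s • τ, α τ s) h‖ ≤ M * ‖h‖ := by
        rw [norm_smul, Real.norm_eq_abs, abs_of_nonneg hs.1]
        refine (mul_le_of_le_one_left (norm_nonneg _) hs.2).trans ?_
        exact (ContinuousLinearMap.le_opNorm _ _).trans
          (mul_le_mul_of_nonneg_right (H.bound _ (hq s hs)) (norm_nonneg _))
      rw [mem_ball_iff_norm]
      have : v s - u₀ = (α τ s - u₀) + s • F (p₀ + s • τ, α τ s) h := by simp only [hv]; abel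
      rw [this]
      exact (norm_add_le _ _).trans_lt (by linarith)
    have hvd : ∀ s ∈ Icc (0 : ℝ) 1, HasDerivWithinAt v
        (F (p₀ + s • τ, α τ s) τ + (F (p₀ + s • τ, α τ s) h +
          s • fderiv ℂ F (p₀ + s • τ, α τ s) (τ, F (p₀ + s • τ, α τ s) τ) h)) (Icc 0 1) s := by
      intro s hs
      have a1 := hα τ hτ s hs
      have a2 : HasDerivWithinAt (fun s : ℝ => p₀ + s • τ) τ (Icc 0 1) s := by
        simpa using (((hasDerivAt_id s).smul_const τ).const_add p₀).hasDerivWithinAt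
      have a3 := ((H.diff _ (hq s hs)).hasFDerivAt.restrictScalars ℝ).comp_hasDerivWithinAt s
        (a2.prodMk a1)
      have a4 : HasDerivWithinAt (fun s : ℝ => F (p₀ + s • τ, α τ s) h)
          (fderiv ℂ F (p₀ + s • τ, α τ s) (τ, F (p₀ + s • τ, α τ s) τ) h) (Icc 0 1) s :=
        ((((ContinuousLinearMap.apply ℂ E h).restrictScalars ℝ).hasFDerivAt).comp_hasDerivWithinAt s
          a3)
      have a5 := (hasDerivAt_id s).hasDerivWithinAt.fun_smul a4
      refine (a1.add a5).congr_deriv ?_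
      simp only [id, one_smul]
      abel
    have toIci : ∀ {f : ℝ → E} {f' : E} {s : ℝ}, s ∈ Ico (0 : ℝ) 1 →
        HasDerivWithinAt f f' (Icc 0 1) s → HasDerivWithinAt f f' (Ici s) s := by
      intro f f' s hs hf
      exact hf.mono_of_mem_nhdsWithin
        (Filter.mem_of_superset (Icc_mem_nhdsGE hs.2) (Icc_subset_Icc_left hs.1))
    have hG := dist_le_of_approx_trajectories_ODE_of_mem (a := (0 : ℝ)) (b := 1)
      (v := fun t u => F (p₀ + t • (τ + h), u) (τ + h)) (s := fun _ => ball u₀ R)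
      (K := ⟨M * δ, mul_nonneg hM hδ⟩)
      (f := α (τ + h)) (f' := fun t => F (p₀ + t • (τ + h), α (τ + h) t) (τ + h)) (εf := 0)
      (g := v) (εg := (M * max 1 M + K * (max 1 M) ^ 2 * δ) * ‖h‖ ^ 2) (δ := 0)
      (g' := fun s => F (p₀ + s • τ, α τ s) τ + (F (p₀ + s • τ, α τ s) h +
          s • fderiv ℂ F (p₀ + s • τ, α τ s) (τ, F (p₀ + s • τ, α τ s) τ) h))
      (fun t ht => LipschitzOnWith.of_dist_le_mul fun u hu u' hu' => by
        have ht' := Ico_subset_Icc_self ht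
        rw [dist_eq_norm, dist_eq_norm, ← sub_apply]
        refine (ContinuousLinearMap.le_opNorm _ _).trans ?_
        have := H.lip (mem _ hh t ht' u' hu') (mem _ hh t ht' u hu)
        have e : ‖((p₀ + t • (τ + h), u) : P × E) - (p₀ + t • (τ + h), u')‖ = ‖u - u'‖ := by
          simp [Prod.norm_def]
        rw [e] at this
        calc _ ≤ (M * ‖u - u'‖) * δ := by gcongr
          _ = M * δ * ‖u - u'‖ := by ring)
      (fun t ht => (hα _ hh t ht).continuousWithinAt)
      (fun t ht => toIci ht (hα _ hh t (Ico_subset_Icc_self ht)))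
      (fun t ht => by simp)
      (fun t ht => hmem' _ hh t)
      (fun t ht => (hvd t ht).continuousWithinAt)
      (fun t ht => toIci ht (hvd t (Ico_subset_Icc_self ht)))
      (fun t ht => by
        have ht' := Ico_subset_Icc_self ht
        set q : P × E := (p₀ + t • τ, α τ t) with hqdef
        have hqm := hq t ht'
        have hqm' : q + t • (h, F q h) ∈ ball (p₀, u₀) R := by
          have := mem _ hh t ht' _ (hvmem t ht')
          convert this using 1
          simp only [hqdef, hv, Prod.smul_mk, Prod.mk_add_mk, smul_add, add_assoc]
        have tay := norm_sub_sub_fderiv_le (convex_ball (p₀, u₀) R) hK H.diff H.lip_deriv hqm hqm'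
        have e0 : ((p₀ + t • (τ + h), v t) : P × E) = q + t • (h, F q h) := by
          simp only [hqdef, hv, Prod.smul_mk, Prod.mk_add_mk, smul_add, add_assoc]
        have n1 : ‖((h, F q h) : P × E)‖ ≤ max 1 M * ‖h‖ := by
          rw [Prod.norm_def]
          refine max_le ?_ ?_
          · exact le_mul_of_one_le_left (norm_nonneg _) (le_max_left _ _)
          · exact (ContinuousLinearMap.le_opNorm _ _).trans (mul_le_mul_of_nonneg_right
              ((H.bound _ hqm).trans (le_max_right _ _)) (norm_nonneg _))
        have n2 : ‖t • ((h, F q h) : P × E)‖ ≤ max 1 M * ‖h‖ := by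
          rw [norm_smul, Real.norm_eq_abs, abs_of_nonneg ht.1]
          exact (mul_le_of_le_one_left (norm_nonneg _) ht.2.le).trans n1
        have lin : fderiv ℂ F q (t • (h, F q h)) = t • fderiv ℂ F q (h, F q h) := by
          exact ((fderiv ℂ F q).restrictScalars ℝ).map_smul t _
        rw [dist_comm, dist_eq_norm, e0]
        set Er := F (q + t • (h, F q h)) - F q - fderiv ℂ F q (q + t • (h, F q h) - q) with hEr
        have e1 : F (q + t • (h, F q h)) (τ + h) - (F q τ + (F q h +
            t • fderiv ℂ F q (τ, F q τ) h)) = t • fderiv ℂ F q (h, F q h) h + Er (τ + h) := by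
          have : F (q + t • (h, F q h)) = Er + F q + t • fderiv ℂ F q (h, F q h) := by
            rw [hEr, ← lin, add_sub_cancel_left]; abel
          rw [this, H.symm q hqm τ h]
          simp only [add_apply, smul_apply, map_add]
          abel
        rw [e1]
        have b1 : ‖t • fderiv ℂ F q (h, F q h) h‖ ≤ M * max 1 M * ‖h‖ ^ 2 := by
          rw [norm_smul, Real.norm_eq_abs, abs_of_nonneg ht.1]
          refine (mul_le_of_le_one_left (norm_nonneg _) ht.2.le).trans ?_
          calc _ ≤ ‖fderiv ℂ F q (h, F q h)‖ * ‖h‖ := ContinuousLinearMap.le_opNorm _ _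
            _ ≤ (‖fderiv ℂ F q‖ * ‖((h, F q h) : P × E)‖) * ‖h‖ := by
                gcongr; exact ContinuousLinearMap.le_opNorm _ _
            _ ≤ (M * (max 1 M * ‖h‖)) * ‖h‖ := by
                gcongr; exact H.bound_deriv _ hqm
            _ = _ := by ring
        have b2 : ‖Er (τ + h)‖ ≤ K * (max 1 M) ^ 2 * δ * ‖h‖ ^ 2 := by
          calc _ ≤ ‖Er‖ * ‖τ + h‖ := ContinuousLinearMap.le_opNorm _ _
            _ ≤ (K * (max 1 M * ‖h‖) ^ 2) * δ := by
                gcongr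
                refine tay.trans ?_
                rw [add_sub_cancel_left]
                gcongr
            _ = _ := by ring
        calc _ ≤ _ := norm_add_le _ _
          _ ≤ _ := add_le_add b1 b2
          _ = _ := by ring)
      (fun t ht => hvmem t (Ico_subset_Icc_self ht))
      (by simp [hv, h0 _ hh, h0 _ hτ]) 1 (by simp)
    rw [dist_eq_norm, gronwallBound_zero_eq_mul] at hG
    have e : α (τ + h) 1 - v 1 = α (τ + h) 1 - α τ 1 - F (p₀ + τ, α τ 1) h := by
      simp only [hv, one_smul]; abel
    rw [e] at hG
    refine hG.trans (le_of_eq ?_)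
    rw [hC]
    change _ * gronwallBound 0 (M * δ) 1 (1 - 0) = _
    rw [sub_zero, zero_add]
    ring
  rw [hasFDerivAt_iff_isLittleO_nhds_zero]
  have hO : (fun h => α (τ + h) 1 - α τ 1 - F (p₀ + τ, α τ 1) h) =O[𝓝 0] fun h : P => ‖h‖ ^ 2 := by
    refine Asymptotics.IsBigO.of_bound C ?_
    have e1 : ∀ᶠ h : P in 𝓝 0, ‖τ + h‖ < δ := by
      have : ContinuousAt (fun h : P => ‖τ + h‖) 0 := by fun_prop
      exact this.eventually_lt continuousAt_const (by simpa using hτ)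
    have e2 : ∀ᶠ h : P in 𝓝 0, M * ‖h‖ < R / 2 := by
      have : ContinuousAt (fun h : P => M * ‖h‖) 0 := by fun_prop
      exact this.eventually_lt continuousAt_const (by simpa using by linarith)
    filter_upwards [e1, e2] with h h1 h2
    refine (main h h1 h2).trans (le_of_eq ?_)
    rw [Real.norm_of_nonneg (by positivity)]
  refine hO.trans_isLittleO ?_
  simpa using (Asymptotics.isLittleO_norm_pow_id (E' := P) (one_lt_two))

/-- **Frobenius theorem**: a `C²` holomorphic total differential equation `Du = F(p, u)` with
symmetric second derivatives has a solution through every point. -/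
theorem exists_local_solution_of_symm [CompleteSpace E] {F : P × E → (P →L[ℂ] E)} {p₀ : P} {u₀ : E}
    (hF : ContDiffAt ℂ 2 F (p₀, u₀))
    (hsymm : ∀ᶠ q in 𝓝 (p₀, u₀), ∀ h k,
      fderiv ℂ F q (h, F q h) k = fderiv ℂ F q (k, F q k) h) :
    ∃ u : P → E, u p₀ = u₀ ∧ ∀ᶠ p in 𝓝 p₀, HasFDerivAt u (F (p, u p)) p := by
  obtain ⟨R, M, K, H⟩ := exists_fieldBounds hF hsymm
  have hR := H.R_pos
  have hM := H.M_pos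
  -- With `M + 1` in the denominator the quotient makes sense for `M = 0`, and `M δ ≤ R / 2` still
  -- holds.
  set δ : ℝ := min (R / 2) (R / 2 / (M + 1)) with hδ
  have hδ0 : 0 < δ := by positivity
  have ray : ∀ τ : P, ∃ α : ℝ → E, ‖τ‖ < δ → (α 0 = u₀ ∧
      (∀ t, α t ∈ closedBall u₀ (R / 2)) ∧
      ∀ t ∈ Icc (0 : ℝ) 1, HasDerivWithinAt α (F (p₀ + t • τ, α t) τ) (Icc 0 1) t) := by
    intro τ
    by_cases hτ : ‖τ‖ < δ
    · have h1 : ‖τ‖ < R := by linarith [min_le_left (R / 2) (R / 2 / (M + 1))]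
      have h2 : M * ‖τ‖ ≤ R / 2 := by
        have := hτ.le.trans (min_le_right (R / 2) (R / 2 / (M + 1)))
        rw [le_div_iff₀ (by linarith)] at this
        nlinarith [norm_nonneg τ]
      obtain ⟨α, h⟩ := H.exists_ray h1 h2
      exact ⟨α, fun _ => h⟩
    · exact ⟨fun _ => 0, fun h => absurd h hτ⟩
  choose α hα using ray
  refine ⟨fun p => α (p - p₀) 1, ?_, ?_⟩
  · have h := hα 0 (by simpa using hδ0)
    have : ∀ t ∈ Icc (0 : ℝ) 1, α 0 t = α 0 0 :=
      constant_of_has_deriv_right_zero (fun t ht => (h.2.2 t ht).continuousWithinAt) (fun t ht => by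
        have := h.2.2 t (Ico_subset_Icc_self ht)
        rw [map_zero] at this
        exact this.mono_of_mem_nhdsWithin
          (Filter.mem_of_superset (Icc_mem_nhdsGE ht.2) (Icc_subset_Icc_left ht.1)))
    simp only [sub_self]
    rw [this 1 (by simp), h.1]
  · have : ∀ᶠ p in 𝓝 p₀, ‖p - p₀‖ < δ := by
      have : ContinuousAt (fun p : P => ‖p - p₀‖) p₀ := by fun_prop
      exact this.eventually_lt continuousAt_const (by simpa using hδ0)
    filter_upwards [this] with p hp
    have := H.hasFDerivAt_ray (min_le_left _ _) (fun τ h => (hα τ h).1) (fun τ h => (hα τ h).2.1)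
      (fun τ h => (hα τ h).2.2) hp
    simp only [add_sub_cancel] at this
    exact HasFDerivAt.comp (g := fun σ => α σ 1) p this ((hasFDerivAt_id p).sub_const p₀)

end Frobenius

/-! ### The logarithmic derivative of the bare solution -/

section LogDeriv

/-- By commutation `exp (f w) = exp (f w - f x) exp (f x)`, so only the derivative of `exp` at zero
is needed. -/
theorem hasDerivAt_exp_of_commute {𝔸 : Type*} [NormedRing 𝔸] [NormedAlgebra ℂ 𝔸]
    [CompleteSpace 𝔸] {f : ℂ → 𝔸} {f' : 𝔸} {x : ℂ} (hf : HasDerivAt f f' x)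
    (hc : ∀ w, Commute (f w) (f x)) :
    HasDerivAt (fun w => NormedSpace.exp (f w)) (f' * NormedSpace.exp (f x)) x := by
  have h0 : HasFDerivAt (NormedSpace.exp : 𝔸 → 𝔸) (1 : 𝔸 →L[ℂ] 𝔸) (f x - f x) := by
    rw [sub_self]; exact hasFDerivAt_exp_zero
  have h1 : HasDerivAt (fun w => NormedSpace.exp (f w - f x)) f' x := by
    exact HasFDerivAt.comp_hasDerivAt (f := fun w => f w - f x) x h0 (hf.sub_const (f x))
  refine (h1.mul_const (NormedSpace.exp (f x))).congr_of_eventuallyEq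
    (Filter.Eventually.of_forall fun w => ?_)
  let := NormedAlgebra.restrictScalars ℚ ℂ 𝔸
  have : Commute (f w - f x) (f x) := (hc w).sub_left (Commute.refl _)
  simp only
  rw [← NormedSpace.exp_add_of_commute this, sub_add_cancel]

/-- The cyclic permutation matrix, the value of `ℋ` at `x = 1`. -/
def cyclicS (n : ℕ) : Matrix (Fin n) (Fin n) ℂ :=
  Matrix.of fun i j =>
    if i.val = j.val + 1 then 1 else if i.val = 0 ∧ j.val + 1 = n then 1 else 0

/-- The diagonal matrix `x^{-G/n}`. -/
noncomputable def shearing (n : ℕ) (x : ℂ) : Matrix (Fin n) (Fin n) ℂ :=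
  Matrix.diagonal fun k : Fin n => x ^ (-(k.val : ℂ) / n)

theorem isUnit_shearing (n : ℕ) {x : ℂ} (hx : x ≠ 0) : IsUnit (shearing n x) := by
  rw [Matrix.isUnit_iff_isUnit_det, shearing, Matrix.det_diagonal, isUnit_iff_ne_zero,
    Finset.prod_ne_zero_iff]
  intro k _
  simp [Complex.cpow_eq_zero_iff, hx]

/-- The values of `ℋ` at different points do not commute in general, but shearing turns each of them
into a scalar multiple of one constant matrix. The sheared exponent therefore runs in a commutative
algebra, where its exponential can be differentiated. -/
theorem evalAt_matH_mul_shearing (n : ℕ) {x : ℂ} (hx : x ≠ 0) :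
    evalAt (matH n) x * shearing n x = shearing n x * (x ^ (1 / n : ℂ) • cyclicS n) := by
  ext i j
  have hn : (n : ℂ) ≠ 0 := by
    have := i.pos
    exact_mod_cast this.ne'
  rw [shearing, Matrix.mul_diagonal, Matrix.diagonal_mul]
  simp only [evalAt, matH, cyclicS, Matrix.map_apply, Matrix.of_apply, Matrix.smul_apply,
    smul_eq_mul]
  split_ifs with h1 h2
  · rw [h1]
    simp only [eval_one, one_mul, mul_one, Nat.cast_add, Nat.cast_one]
    rw [← Complex.cpow_add _ _ hx]
    congr 1; field_simp; ring
  · simp only [eval_X, mul_one, h2.1, Nat.cast_zero, neg_zero, zero_div, Complex.cpow_zero, one_mul]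
    conv_lhs => rw [← Complex.cpow_one x]
    rw [Complex.cpow_one x, show x * x ^ (-(j.val : ℂ) / n) = x ^ (1 + -(j.val : ℂ) / n) by
      rw [Complex.cpow_add _ _ hx, Complex.cpow_one]]
    congr 1
    have : (j.val : ℂ) + 1 = n := by exact_mod_cast h2.2
    field_simp
    linear_combination -this
  · simp

theorem evalAt_matH_pow_mul_shearing (n : ℕ) {x : ℂ} (hx : x ≠ 0) (J : ℕ) :
    evalAt (matH n) x ^ J * shearing n x = shearing n x * (x ^ (1 / n : ℂ) • cyclicS n) ^ J := by
  induction J with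
  | zero => simp
  | succ J ih =>
    rw [pow_succ, mul_assoc, evalAt_matH_mul_shearing n hx, ← mul_assoc, ih, mul_assoc, ← pow_succ]

/-- The exponent of the bare solution after conjugation by the shearing matrix. -/
noncomputable def shearedExponent (n r : ℕ) (t : Fin (r * n) → ℂ) (x : ℂ) :
    Matrix (Fin n) (Fin n) ℂ :=
  ∑ J ∈ Finset.Icc 1 (r * n), (time t J / J) • (x ^ (1 / n : ℂ) • cyclicS n) ^ J

theorem bareSolution_eq (n r : ℕ) (t0 : ℂ) (t : Fin (r * n) → ℂ) {x : ℂ} (hx : x ≠ 0) :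
    bareSolution n r t0 t x = (Matrix.diagonal fun k : Fin n => x ^ (t0 - (k.val : ℂ) / n)) *
      NormedSpace.exp (shearedExponent n r t x) := by
  have hu := isUnit_shearing n hx
  have hdet : IsUnit (shearing n x).det := (Matrix.isUnit_iff_isUnit_det _).1 hu
  have h1 : (∑ J ∈ Finset.Icc 1 (r * n), (time t J / J) • evalAt (matH n) x ^ J) =
      shearing n x * shearedExponent n r t x * (shearing n x)⁻¹ := by
    rw [shearedExponent, Finset.mul_sum, Finset.sum_mul]
    refine Finset.sum_congr rfl fun J _ => ?_
    rw [mul_smul_comm, ← evalAt_matH_pow_mul_shearing n hx, smul_mul_assoc, mul_assoc,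
      Matrix.mul_nonsing_inv _ hdet, mul_one]
  have h2 : (Matrix.diagonal fun k : Fin n => x ^ (t0 - (k.val : ℂ) / n)) =
      x ^ t0 • shearing n x := by
    rw [shearing, ← Matrix.diagonal_smul]
    congr 1; ext k
    rw [Pi.smul_apply, smul_eq_mul, ← Complex.cpow_add _ _ hx]
    congr 1; ring
  rw [bareSolution, h1, Matrix.exp_conj _ _ hu, h2, mul_smul_comm, mul_assoc,
    Matrix.nonsing_inv_mul _ hdet, mul_one, smul_mul_assoc]

/-- The polynomial matrix `t₀ - G/n + (1/n) ∑ t_J ℋ^J`. -/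
noncomputable def logDerivMatrix (n r : ℕ) (t0 : ℂ) (t : Fin (r * n) → ℂ) :
    Matrix (Fin n) (Fin n) ℂ[X] :=
  (Matrix.diagonal fun k : Fin n => C (t0 - (k.val : ℂ) / n)) +
    (1 / n : ℂ) • ∑ J ∈ Finset.Icc 1 (r * n), time t J • matH n ^ J

theorem evalAt_logDerivMatrix (n r : ℕ) (t0 : ℂ) (t : Fin (r * n) → ℂ) (x : ℂ) :
    evalAt (logDerivMatrix n r t0 t) x =
      (Matrix.diagonal fun k : Fin n => t0 - (k.val : ℂ) / n) +
      (1 / n : ℂ) • ∑ J ∈ Finset.Icc 1 (r * n), time t J • evalAt (matH n) x ^ J := by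
  have hpow : ∀ J, evalAt (matH n) x ^ J = evalAt (matH n ^ J) x := fun J =>
    (map_pow (evalRingHom x).mapMatrix (matH n) J).symm
  simp only [hpow]
  ext i j
  simp only [logDerivMatrix, evalAt, Matrix.map_apply, Matrix.add_apply, Matrix.smul_apply,
    Matrix.sum_apply, eval_add, eval_smul, eval_finsetSum, Matrix.diagonal_apply]
  split_ifs <;> simp

/-- Each term `x^{J/n} S^J t_J / J` of the sheared exponent has the derivative `(n x)⁻¹ t_J x^{J/n}
S^J`. Undoing the shearing restores `ℋ^J`, and the diagonal factor contributes `t₀ - G/n`. -/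
theorem hasLogDeriv_bareSolution (n r : ℕ) (t0 : ℂ) (t : Fin (r * n) → ℂ) :
    HasLogDeriv (bareSolution n r t0 t) (logDerivMatrix n r t0 t) := by
  intro x hx i j
  have hx0 : x ≠ 0 := Complex.slitPlane_ne_zero hx
  have hn : (n : ℂ) ≠ 0 := by
    have := i.pos
    exact_mod_cast this.ne'
  set c : ℂ → ℂ := fun w => w ^ (1 / n : ℂ) with hc
  have hcd : HasDerivAt c ((n : ℂ)⁻¹ * x⁻¹ * c x) x := by
    have h := (hasDerivAt_id x).cpow_const (c := (1 / n : ℂ)) hx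
    refine h.congr_deriv ?_
    simp only [id, mul_one, hc, Complex.cpow_sub _ _ hx0, Complex.cpow_one]
    field_simp
  set K : ℂ → Matrix (Fin n) (Fin n) ℂ := shearedExponent n r t with hK
  set K' : Matrix (Fin n) (Fin n) ℂ :=
    ((n : ℂ)⁻¹ * x⁻¹) • ∑ J ∈ Finset.Icc 1 (r * n), time t J • (c x • cyclicS n) ^ J with hK'
  let := Matrix.linftyOpNormedRing (n := Fin n) (α := ℂ)
  let := Matrix.linftyOpNormedAlgebra (n := Fin n) (R := ℂ) (α := ℂ)
  have hKd : HasDerivAt K K' x := by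
    have hterm : ∀ J ∈ Finset.Icc 1 (r * n), HasDerivAt
        (fun w => (time t J / J) • (w ^ (1 / n : ℂ) • cyclicS n) ^ J)
        (((n : ℂ)⁻¹ * x⁻¹) • (time t J • (c x • cyclicS n) ^ J)) x := by
      intro J hJ
      have hJ1 : 1 ≤ J := (Finset.mem_Icc.1 hJ).1
      have hJ0 : (J : ℂ) ≠ 0 := by exact_mod_cast (by omega : J ≠ 0)
      have h1 : HasDerivAt (fun w => (time t J / J) • (c w ^ J • cyclicS n ^ J)) _ x :=
        ((hcd.fun_pow J).smul_const (cyclicS n ^ J)).const_smul (time t J / J)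
      have h2 : (fun w => (time t J / J) • (w ^ (1 / n : ℂ) • cyclicS n) ^ J) =
          fun w => (time t J / J) • (c w ^ J • cyclicS n ^ J) := by
        ext1 w; rw [_root_.smul_pow]
      rw [h2]
      refine h1.congr_deriv ?_
      rw [_root_.smul_pow, smul_smul, smul_smul, smul_smul]
      congr 1
      obtain ⟨J, rfl⟩ : ∃ k, J = k + 1 := ⟨J - 1, by omega⟩
      simp only [Nat.add_sub_cancel, pow_succ]
      field_simp
    have := HasDerivAt.fun_sum hterm
    rw [← Finset.smul_sum] at this
    exact this
  have hcomm : ∀ w, Commute (K w) (K x) := by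
    intro w
    refine Commute.sum_left _ _ _ fun J _ => Commute.sum_right _ _ _ fun J' _ => ?_
    simp only [_root_.smul_pow, smul_smul]
    exact (((Commute.refl (cyclicS n)).pow_pow J J').smul_left _).smul_right _
  have hexp := hasDerivAt_exp_of_commute hKd hcomm
  have hexpij : HasDerivAt (fun w => NormedSpace.exp (K w) i j)
      ((K' * NormedSpace.exp (K x)) i j) x := by
    have h2 := hasDerivAt_pi.1 (hasDerivAt_pi.1 hexp i) j
    exact h2
  have hpow : HasDerivAt (fun w : ℂ => w ^ (t0 - (i.val : ℂ) / n))
      ((t0 - (i.val : ℂ) / n) * x⁻¹ * x ^ (t0 - (i.val : ℂ) / n)) x := by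
    have h := (hasDerivAt_id x).cpow_const (c := t0 - (i.val : ℂ) / n) hx
    refine h.congr_deriv ?_
    simp only [id, mul_one, Complex.cpow_sub _ _ hx0, Complex.cpow_one]
    field_simp
  have hEij := hpow.mul hexpij
  have hev : (fun w => bareSolution n r t0 t w i j) =ᶠ[nhds x]
      fun w => w ^ (t0 - (i.val : ℂ) / n) * NormedSpace.exp (K w) i j := by
    filter_upwards [isOpen_ne.mem_nhds hx0] with w hw
    rw [bareSolution_eq n r t0 t hw, Matrix.diagonal_mul]
  refine (hEij.congr_of_eventuallyEq hev).congr_deriv ?_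
  have hbare := bareSolution_eq n r t0 t hx0
  have hD : (Matrix.diagonal fun k : Fin n => x ^ (t0 - (k.val : ℂ) / n)) =
      x ^ t0 • shearing n x := by
    rw [shearing, ← Matrix.diagonal_smul]
    congr 1; ext k
    rw [Pi.smul_apply, smul_eq_mul, ← Complex.cpow_add _ _ hx0]
    congr 1; ring
  have hsum : (∑ J ∈ Finset.Icc 1 (r * n), time t J • evalAt (matH n) x ^ J) *
      (Matrix.diagonal fun k : Fin n => x ^ (t0 - (k.val : ℂ) / n)) =
      (Matrix.diagonal fun k : Fin n => x ^ (t0 - (k.val : ℂ) / n)) *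
        ∑ J ∈ Finset.Icc 1 (r * n), time t J • (c x • cyclicS n) ^ J := by
    rw [hD, Finset.sum_mul, Finset.mul_sum]
    refine Finset.sum_congr rfl fun J _ => ?_
    rw [mul_smul_comm, mul_smul_comm, smul_mul_assoc, smul_mul_assoc,
      evalAt_matH_pow_mul_shearing n hx0, smul_comm]
  have hprod : evalAt (logDerivMatrix n r t0 t) x * bareSolution n r t0 t x =
      (Matrix.diagonal fun k : Fin n => t0 - (k.val : ℂ) / n) *
        ((Matrix.diagonal fun k : Fin n => x ^ (t0 - (k.val : ℂ) / n)) *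
          NormedSpace.exp (K x)) +
      (1 / n : ℂ) • ((Matrix.diagonal fun k : Fin n => x ^ (t0 - (k.val : ℂ) / n)) *
        ((∑ J ∈ Finset.Icc 1 (r * n), time t J • (c x • cyclicS n) ^ J) *
          NormedSpace.exp (K x))) := by
    rw [evalAt_logDerivMatrix, add_mul, hbare, smul_mul_assoc, ← mul_assoc (Finset.sum _ _), hsum,
      mul_assoc (Matrix.diagonal fun k : Fin n => x ^ (t0 - (k.val : ℂ) / n))]
  rw [hprod, hK', smul_mul_assoc, Matrix.smul_apply, Matrix.smul_apply, Matrix.add_apply,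
    Matrix.smul_apply, Matrix.diagonal_mul, Matrix.diagonal_mul, Matrix.diagonal_mul]
  simp only [smul_eq_mul]
  ring

theorem isUnit_bareSolution (n r : ℕ) (t0 : ℂ) (t : Fin (r * n) → ℂ) {x : ℂ} (hx : x ≠ 0) :
    IsUnit (bareSolution n r t0 t x) := by
  refine (Matrix.isUnit_exp _).mul ?_
  rw [Matrix.isUnit_iff_isUnit_det, Matrix.det_diagonal, isUnit_iff_ne_zero,
    Finset.prod_ne_zero_iff]
  intro k _
  simp [Complex.cpow_eq_zero_iff, hx]

/-- The bare solution is invertible, so its logarithmic derivative is unique, and a polynomial is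
determined by its values on the slit plane. This makes the existential `P` of `IsFormalSolution`
explicit. -/
theorem eq_logDerivMatrix {n r : ℕ} {t0 : ℂ} {t : Fin (r * n) → ℂ}
    {P : Matrix (Fin n) (Fin n) ℂ[X]} (hP : HasLogDeriv (bareSolution n r t0 t) P) :
    P = logDerivMatrix n r t0 t := by
  have key : ∀ x ∈ Complex.slitPlane, evalAt P x = evalAt (logDerivMatrix n r t0 t) x := by
    intro x hx
    have hx0 : x ≠ 0 := Complex.slitPlane_ne_zero hx
    have h : x⁻¹ • (evalAt P x * bareSolution n r t0 t x) =
        x⁻¹ • (evalAt (logDerivMatrix n r t0 t) x * bareSolution n r t0 t x) := by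
      ext i j
      exact (hP x hx i j).unique (hasLogDeriv_bareSolution n r t0 t x hx i j)
    exact (isUnit_bareSolution n r t0 t hx0).mul_right_cancel
      (smul_right_injective _ (inv_ne_zero hx0) h)
  ext1 i j
  refine Polynomial.eq_of_infinite_eval_eq _ _ (Set.Infinite.mono (s := Complex.slitPlane) ?_ ?_)
  · intro x hx
    exact congrFun (congrFun (key x hx) i) j
  · exact infinite_of_mem_nhds 1 (Complex.isOpen_slitPlane.mem_nhds Complex.one_mem_slitPlane)

end LogDeriv

/-! ### The recursion in `s` for a matrix with cyclic leading term -/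

section Recursion

open scoped PowerSeries

theorem val_finRotate {n : ℕ} (i : Fin n) : (finRotate n i).val = (i.val + 1) % n := by
  cases n with
  | zero => exact i.elim0
  | succ n => rw [finRotate_apply, Fin.val_add, Fin.val_one', Nat.add_mod_mod]

/-- The operator `S - 1` of the cyclic shift is onto the vectors of sum zero: partial sums give a
solution, and subtracting their mean gives one of sum zero. -/
theorem exists_sub_eq_of_sum_eq_zero {n : ℕ} {R : Type*} [CommRing R] [Algebra ℂ R]
    (g : Fin n → R) (hg : ∑ i, g i = 0) :
    ∃ a : Fin n → R, ∑ i, a i = 0 ∧ ∀ i, a (finRotate n i) - a i = g i := by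
  rcases Nat.eq_zero_or_pos n with rfl | hn
  · exact ⟨0, by simp, fun i => i.elim0⟩
  set S : Fin n → R := fun i => ∑ j with j.val < i.val, g j with hS
  have hnc : (n : ℂ) ≠ 0 := by exact_mod_cast hn.ne'
  refine ⟨fun i => S i - algebraMap ℂ R (n : ℂ)⁻¹ * ∑ j, S j, ?_, fun i => ?_⟩
  · rw [Finset.sum_sub_distrib, Finset.sum_const, Finset.card_univ, Fintype.card_fin,
      nsmul_eq_mul, ← mul_assoc, ← map_natCast (algebraMap ℂ R), ← map_mul, mul_inv_cancel₀ hnc,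
      map_one, one_mul, sub_self]
  · rw [sub_sub_sub_cancel_right]
    simp only [hS, val_finRotate]
    by_cases h : i.val + 1 = n
    · rw [h, Nat.mod_self]
      have h1 : (Finset.univ.filter fun j : Fin n => j.val < 0) = ∅ := by ext; simp
      have h2 : (Finset.univ.filter fun j : Fin n => j.val < i.val) = Finset.univ.erase i := by
        ext j
        simp only [Finset.mem_filter, Finset.mem_univ, true_and, Finset.mem_erase, and_true, ne_eq,
          Fin.ext_iff]
        have := j.2
        omega
      rw [h1, h2, Finset.sum_empty, zero_sub, neg_eq_iff_add_eq_zero,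
        Finset.sum_erase_add _ _ (Finset.mem_univ i), hg]
    · have hlt : i.val + 1 < n := by have := i.2; omega
      rw [Nat.mod_eq_of_lt hlt]
      have h2 : (Finset.univ.filter fun j : Fin n => j.val < i.val + 1) =
          insert i (Finset.univ.filter fun j : Fin n => j.val < i.val) := by
        ext j
        simp only [Finset.mem_filter, Finset.mem_univ, true_and, Finset.mem_insert, Fin.ext_iff]
        omega
      rw [h2, Finset.sum_insert (by simp), add_sub_cancel_right]

/-- Recursive choice. The condition at step `m` sees only the earlier terms, so the default values
put at the later places are harmless. -/
theorem exists_seq_of_forall_exists {T : Type*} [Inhabited T] (P : ℕ → (ℕ → T) → T → Prop)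
    (hloc : ∀ m c c' x, (∀ k < m, c k = c' k) → P m c x → P m c' x)
    (hex : ∀ m c, ∃ x, P m c x) : ∃ c : ℕ → T, ∀ m, P m c (c m) := by
  choose f hf using hex
  let c : ℕ → T := fun m => Nat.strongRecOn (motive := fun _ => T) m
    fun m ih => f m fun k => if h : k < m then ih k h else default
  have hc : ∀ m, c m = f m fun k => if k < m then c k else default := by
    intro m
    simp only [c]
    rw [Nat.strongRecOn_eq]
    congr 1
  refine ⟨c, fun m => ?_⟩
  rw [hc m]
  exact hloc m _ _ _ (fun k hk => by simp [hk]) (hf m _)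

/-- Summation over the cycle kills the left side, hence `p = 0`; then `z` is constant along the
cycle, and its sum is zero. -/
theorem eq_zero_of_finRotate_sub_eq {n : ℕ} {z : Fin n → ℂ} (hz : ∑ i, z i = 0) {p : ℂ}
    (hn : 0 < n) (h : ∀ i, z (finRotate n i) - z i = p) : p = 0 ∧ ∀ i, z i = 0 := by
  have hnc : (n : ℂ) ≠ 0 := by exact_mod_cast hn.ne'
  have hp : p = 0 := by
    have h1 : ∑ i, (z (finRotate n i) - z i) = n * p := by
      rw [Finset.sum_congr rfl fun i _ => h i]; simp
    rw [Finset.sum_sub_distrib, Equiv.sum_comp (finRotate n) z, sub_self] at h1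
    exact (mul_eq_zero.1 h1.symm).resolve_left hnc
  have hconst : ∀ k (hk : k < n), z ⟨k, hk⟩ = z ⟨0, hn⟩ := by
    intro k
    induction k with
    | zero => intro _; rfl
    | succ k ih =>
      intro hk
      have h2 := h ⟨k, by omega⟩
      have h3 : finRotate n ⟨k, by omega⟩ = ⟨k + 1, hk⟩ := by
        ext; rw [val_finRotate]; exact Nat.mod_eq_of_lt hk
      rw [h3, hp, sub_eq_zero] at h2
      rw [h2, ih]
  have h0 : z ⟨0, hn⟩ = 0 := by
    have : ∑ i, z i = n * z ⟨0, hn⟩ := by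
      rw [Finset.sum_congr rfl fun i _ => hconst i.1 i.2]; simp
    rw [hz] at this
    exact (mul_eq_zero.1 this.symm).resolve_left hnc
  exact ⟨hp, fun i => (hconst i.1 i.2).trans h0⟩

/-- Truncated subtraction makes one formula serve all `k`: for `k ≤ N` the numerical factor is zero.
-/
theorem coeff_X_pow_succ_mul_derivative {R : Type*} [CommRing R] (N k : ℕ) (f : R⟦X⟧) :
    PowerSeries.coeff k (PowerSeries.X ^ (N + 1) * d⁄dX R f) = ((k - N : ℕ) : R) * PowerSeries.coeff (k - N) f := by
  rw [PowerSeries.coeff_X_pow_mul']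
  split_ifs with h
  · rw [PowerSeries.coeff_derivative, show k - (N + 1) + 1 = k - N by omega, mul_comm]
    congr 1
    rw [← Nat.cast_succ]
    congr 1
    omega
  · rw [show k - N = 0 by omega]; simp

variable {n : ℕ} {R : Type*} [CommRing R]

/-- `B = β₀ + β₁ S s + O(s²)`, where `S` is the cyclic shift. -/
structure IsCyclicLeading (B : Matrix (Fin n) (Fin n) R⟦X⟧) (β₀ β₁ : R) : Prop where
  coeff_zero : ∀ i j, PowerSeries.coeff 0 (B i j) = if j = i then β₀ else 0
  coeff_one : ∀ i j, PowerSeries.coeff 1 (B i j) = if j = finRotate n i then β₁ else 0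

theorem sum_coeff_mul_range (B : Matrix (Fin n) (Fin n) R⟦X⟧) (z : Fin n → R⟦X⟧) (i : Fin n)
    (k : ℕ) : PowerSeries.coeff k (∑ l, B i l * z l) =
      ∑ a ∈ Finset.range (k + 1), ∑ l, PowerSeries.coeff a (B i l) * PowerSeries.coeff (k - a) (z l) := by
  rw [map_sum, Finset.sum_comm]
  refine Finset.sum_congr rfl fun l _ => ?_
  rw [PowerSeries.coeff_mul, Finset.Nat.sum_antidiagonal_eq_sum_range_succ
    (fun a b => PowerSeries.coeff a (B i l) * PowerSeries.coeff b (z l))]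

theorem coeff_mul_range (f g : R⟦X⟧) (k : ℕ) :
    PowerSeries.coeff k (f * g) = ∑ a ∈ Finset.range (k + 1), PowerSeries.coeff a f * PowerSeries.coeff (k - a) g := by
  rw [PowerSeries.coeff_mul, Finset.Nat.sum_antidiagonal_eq_sum_range_succ
    (fun a b => PowerSeries.coeff a f * PowerSeries.coeff b g)]

/-- At the order `m + 2` the unknowns are `z_{m+1}`, entering through `β₁ (S - 1) z_{m+1}`, and the
scalar `Q_{m+2}`. The mean over the rows determines `Q_{m+2}`, and `S - 1` is inverted on the rest.
The derivative term involves `z_{m+2-N}`, which is known because `N ≥ 2`. The value `ε = 1` is used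
for the differential equation and `ε = 0` for the eigenvalue problem. -/
theorem exists_normalized [Algebra ℂ R] {B : Matrix (Fin n) (Fin n) R⟦X⟧} {β₀ β₁ : R}
    (hB : IsCyclicLeading B β₀ β₁) (hβ : IsUnit β₁) {N : ℕ} (hN : 2 ≤ N) (hn : 0 < n) (ε : R) :
    ∃ (z : Fin n → R⟦X⟧) (Q : R⟦X⟧), (∀ i, PowerSeries.coeff 0 (z i) = 1) ∧
      (∀ k, k ≠ 0 → ∑ i, PowerSeries.coeff k (z i) = 0) ∧ PowerSeries.coeff 0 Q = β₀ ∧ PowerSeries.coeff 1 Q = β₁ ∧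
      ∀ i, ∑ l, B i l * z l + PowerSeries.C ε * (PowerSeries.X ^ (N + 1) * d⁄dX R (z i)) = Q * z i := by
  obtain ⟨γ, hγ⟩ := hβ.exists_right_inv
  have hnc : (n : ℂ) ≠ 0 := by exact_mod_cast hn.ne'
  -- The entry `c m` stores the pair `(z_{m+1}, Q_{m+2})`; the values `z_0 = 1`, `Q_0 = β₀`, `Q_1 =
  -- β₁` are prescribed.
  let zs : (ℕ → (Fin n → R) × R) → ℕ → Fin n → R := fun c k => k.casesOn 1 fun k => (c k).1
  let qs : (ℕ → (Fin n → R) × R) → ℕ → R := fun c k =>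
    k.casesOn β₀ fun k => k.casesOn β₁ fun k => (c k).2
  let known : ℕ → (ℕ → (Fin n → R) × R) → Fin n → R := fun m c i =>
    ∑ a ∈ Finset.range m, (∑ l, PowerSeries.coeff (a + 2) (B i l) * zs c (m - a) l -
      qs c (a + 2) * zs c (m - a) i) + ∑ l, PowerSeries.coeff (m + 2) (B i l) * 1 +
      ε * (((m + 2 - N : ℕ) : R) * zs c (m + 2 - N) i)
  let P : ℕ → (ℕ → (Fin n → R) × R) → (Fin n → R) × R → Prop := fun m c x =>
    ∑ i, x.1 i = 0 ∧ ∀ i, known m c i + β₁ * (x.1 (finRotate n i) - x.1 i) = x.2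
  have : Inhabited R := ⟨0⟩
  obtain ⟨c, hc⟩ := exists_seq_of_forall_exists P
    (by
      intro m c c' x hcc hP
      have hz : ∀ k ≤ m, zs c k = zs c' k := by
        intro k hk
        cases k with
        | zero => rfl
        | succ k => exact congrArg Prod.fst (hcc k (by omega))
      have hq : ∀ a < m, qs c (a + 2) = qs c' (a + 2) := fun a ha => congrArg Prod.snd (hcc a ha)
      have hk : known m c' = known m c := by
        ext i
        simp only [known]
        rw [hz _ (show m + 2 - N ≤ m by omega)]
        congr 2
        refine Finset.sum_congr rfl fun a ha => ?_
        rw [hz (m - a) (by omega), hq a (Finset.mem_range.1 ha)]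
      exact ⟨hP.1, fun i => by rw [hk]; exact hP.2 i⟩)
    (by
      intro m c
      -- The mean of the known terms is the one choice of `Q_{m+2}` that leaves a right hand side of
      -- sum zero.
      set μ := algebraMap ℂ R (n : ℂ)⁻¹ * ∑ j, known m c j with hμ
      obtain ⟨a, ha, ha'⟩ := exists_sub_eq_of_sum_eq_zero (fun i => μ - known m c i) (by
        rw [Finset.sum_sub_distrib, Finset.sum_const, Finset.card_univ, Fintype.card_fin,
          nsmul_eq_mul, hμ, ← mul_assoc, ← map_natCast (algebraMap ℂ R), ← map_mul,
          mul_inv_cancel₀ hnc, map_one, one_mul, sub_self])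
      refine ⟨(fun i => γ * a i, μ), ?_, fun i => ?_⟩
      · simp only [← Finset.mul_sum, ha, mul_zero]
      · have := ha' i
        simp only
        linear_combination (a (finRotate n i) - a i) * hγ + this)
  have h0 : ∀ (f : Fin n → R) i, ∑ l, PowerSeries.coeff 0 (B i l) * f l = β₀ * f i := by
    intro f i
    simp [hB.coeff_zero, -PowerSeries.coeff_zero_eq_constantCoeff]
  have h1 : ∀ (f : Fin n → R) i, ∑ l, PowerSeries.coeff 1 (B i l) * f l = β₁ * f (finRotate n i) := by
    intro f i
    simp [hB.coeff_one]
  refine ⟨fun i => PowerSeries.mk fun k => zs c k i, PowerSeries.mk (qs c), fun i => by rw [PowerSeries.coeff_mk]; rfl,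
    fun k hk => ?_, by rw [PowerSeries.coeff_mk]; rfl, by rw [PowerSeries.coeff_mk]; rfl, fun i => ?_⟩
  · obtain ⟨k, rfl⟩ := Nat.exists_eq_succ_of_ne_zero hk
    simp only [PowerSeries.coeff_mk]
    exact (hc k).1
  · ext k
    rw [map_add, sum_coeff_mul_range, PowerSeries.coeff_C_mul, coeff_X_pow_succ_mul_derivative,
      coeff_mul_range]
    simp only [PowerSeries.coeff_mk]
    rcases k with _ | _ | m
    · have hz0 : zs c 0 = 1 := rfl
      have hq0 : qs c 0 = β₀ := rfl
      rw [Nat.zero_sub, Nat.cast_zero, zero_mul, mul_zero, add_zero, Finset.sum_range_one,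
        Finset.sum_range_one, Nat.sub_zero, h0, hq0]
    · rw [show 0 + 1 - N = 0 by omega, Nat.cast_zero, zero_mul, mul_zero, add_zero,
        Finset.sum_range_succ, Finset.sum_range_one, Finset.sum_range_succ, Finset.sum_range_one]
      simp only [zero_add, h0, h1, Nat.sub_self, Nat.sub_zero]
      rfl
    · have key := (hc m).2 i
      simp only [known] at key
      have hzm : (c m).1 = zs c (m + 1) := rfl
      have hqm : (c m).2 = qs c (m + 2) := rfl
      have hq0 : qs c 0 = β₀ := rfl
      have hq1 : qs c 1 = β₁ := rfl
      have hz0 : ∀ i, zs c 0 i = 1 := fun _ => rfl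
      rw [hzm, hqm] at key
      rw [Finset.sum_range_succ, Finset.sum_range_succ', Finset.sum_range_succ',
        Finset.sum_range_succ _ (m + 1 + 1), Finset.sum_range_succ' _ (m + 1),
        Finset.sum_range_succ' _ m]
      simp only [zero_add, h0, h1, hq0, hq1, Nat.sub_self, Nat.sub_zero, hz0, add_assoc,
        Nat.reduceAdd, Nat.add_sub_add_right, show m + 2 - 1 = m + 1 by omega] at key ⊢
      rw [Finset.sum_sub_distrib] at key
      linear_combination key

/-- This is the exponential of a primitive of `g`, obtained from `(k + 1) h_{k+1} = ∑ g_a h_{k-a}`;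
only positive integers are inverted. -/
theorem exists_logDerivative_eq [Algebra ℂ R] (g : R⟦X⟧) :
    ∃ h : R⟦X⟧, PowerSeries.coeff 0 h = 1 ∧ d⁄dX R h = g * h := by
  have : Inhabited R := ⟨0⟩
  obtain ⟨c, hc⟩ := exists_seq_of_forall_exists (T := R)
    (fun m c x => (m = 0 → x = 1) ∧ ∀ k, m = k + 1 →
      x * ((k : R) + 1) = ∑ a ∈ Finset.range (k + 1), PowerSeries.coeff a g * c (k - a))
    (by
      rintro m c c' x hcc ⟨h1, h2⟩
      refine ⟨h1, fun k hk => ?_⟩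
      rw [h2 k hk]
      exact Finset.sum_congr rfl fun a _ => by rw [hcc _ (by omega)])
    (by
      intro m c
      cases m with
      | zero => exact ⟨1, fun _ => rfl, fun k hk => by omega⟩
      | succ k =>
        refine ⟨algebraMap ℂ R ((k : ℂ) + 1)⁻¹ *
          ∑ a ∈ Finset.range (k + 1), PowerSeries.coeff a g * c (k - a), by omega, fun k' hk' => ?_⟩
        obtain rfl : k = k' := by omega
        have hk : (k : ℂ) + 1 ≠ 0 := by exact_mod_cast k.succ_ne_zero
        rw [mul_right_comm, show (k : R) + 1 = algebraMap ℂ R ((k : ℂ) + 1) by simp, ← map_mul,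
          inv_mul_cancel₀ hk, map_one, one_mul])
  refine ⟨PowerSeries.mk c, by rw [PowerSeries.coeff_mk]; exact (hc 0).1 rfl, ?_⟩
  ext k
  rw [PowerSeries.coeff_derivative, coeff_mul_range]
  simp only [PowerSeries.coeff_mk]
  exact (hc (k + 1)).2 k rfl

/-- Write `Q = p + s^{N+1} g` with `p` of degree at most `N`. Multiplying `z` by `h` with `h' = -g
h` subtracts `s^{N+1} g` from the scalar and leaves `p`. The price is the normalization of the sums;
the constant terms stay equal to one. -/
theorem exists_truncated_solution [Algebra ℂ R] {B : Matrix (Fin n) (Fin n) R⟦X⟧} {β₀ β₁ : R}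
    (hB : IsCyclicLeading B β₀ β₁) (hβ : IsUnit β₁) {N : ℕ} (hN : 2 ≤ N) (hn : 0 < n) :
    ∃ (z : Fin n → R⟦X⟧) (p : R⟦X⟧), (∀ i, PowerSeries.coeff 0 (z i) = 1) ∧
      (∀ k, N < k → PowerSeries.coeff k p = 0) ∧
      ∀ i, ∑ l, B i l * z l + PowerSeries.X ^ (N + 1) * d⁄dX R (z i) = p * z i := by
  obtain ⟨z, Q, hz, -, -, -, hQ⟩ := exists_normalized hB hβ hN hn 1
  set g : R⟦X⟧ := PowerSeries.mk fun k => PowerSeries.coeff (k + (N + 1)) Q with hg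
  set p : R⟦X⟧ := PowerSeries.mk fun k => if k ≤ N then PowerSeries.coeff k Q else 0 with hp
  have hQp : Q = p + PowerSeries.X ^ (N + 1) * g := by
    ext k
    rw [map_add, PowerSeries.coeff_X_pow_mul', hp, hg, PowerSeries.coeff_mk]
    split_ifs with h1 h2 h2
    · omega
    · simp
    · rw [PowerSeries.coeff_mk, Nat.sub_add_cancel h2]; simp
    · omega
  obtain ⟨h, h0, hh⟩ := exists_logDerivative_eq (-g)
  refine ⟨fun i => z i * h, p, fun i => ?_, fun k hk => ?_, fun i => ?_⟩
  · rw [coeff_mul_range, Finset.sum_range_one, Nat.sub_zero, hz, h0, one_mul]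
  · rw [hp, PowerSeries.coeff_mk, if_neg (by omega)]
  · have e := hQ i
    rw [map_one, one_mul] at e
    have e2 : ∑ l, B i l * (z l * h) = (∑ l, B i l * z l) * h := by
      rw [Finset.sum_mul]; simp only [mul_assoc]
    rw [e2, Derivation.leibniz, hh, smul_eq_mul, smul_eq_mul]
    linear_combination h * e + z i * h * hQp

/-- By induction the equation at the order `k` reduces to `β₁ (S - 1) z_{k-1} = p_k`, with the same
right side in every row. Since `z` has sum zero, both sides vanish. The error `s^M w` stops the
induction at `M`: arbitrary `M` with `w = 0` gives uniqueness, while `M = r n` compares the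
differential equation with the eigenvalue problem. -/
theorem eq_zero_of_truncated {B : Matrix (Fin n) (Fin n) ℂ⟦X⟧} {β₀ β₁ : ℂ}
    (hB : IsCyclicLeading B β₀ β₁) (hβ : β₁ ≠ 0) {N : ℕ} (hN : 2 ≤ N) (hn : 0 < n) (ε : ℂ)
    {Q p : ℂ⟦X⟧} (hQ0 : PowerSeries.coeff 0 Q = β₀) (hQ1 : PowerSeries.coeff 1 Q = β₁) {a z w : Fin n → ℂ⟦X⟧} {M : ℕ}
    (ha : ∀ i, PowerSeries.coeff 0 (a i) = 1) (hz : ∑ i, z i = 0)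
    (heq : ∀ i, ∑ l, B i l * z l + PowerSeries.C ε * (PowerSeries.X ^ (N + 1) * d⁄dX ℂ (z i)) =
      Q * z i + p * a i + PowerSeries.X ^ M * w i) :
    (∀ m < M, PowerSeries.coeff m p = 0) ∧ ∀ d, d + 1 < M → ∀ i, PowerSeries.coeff d (z i) = 0 := by
  have hzk : ∀ k, ∑ i, PowerSeries.coeff k (z i) = 0 := fun k => by rw [← map_sum, hz, map_zero]
  suffices H : ∀ k ≤ M, (∀ m < k, PowerSeries.coeff m p = 0) ∧ ∀ d, d + 1 < k → ∀ i, PowerSeries.coeff d (z i) = 0 from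
    H M le_rfl
  intro k
  induction k with
  | zero => exact fun _ => ⟨fun m hm => by omega, fun d hd => by omega⟩
  | succ k ih =>
    intro hk
    obtain ⟨ihp, ihz⟩ := ih (by omega)
    have h0 : ∀ (f : Fin n → ℂ) i, ∑ l, PowerSeries.coeff 0 (B i l) * f l = β₀ * f i := by
      intro f i
      simp [hB.coeff_zero, -PowerSeries.coeff_zero_eq_constantCoeff]
    have h1 : ∀ (f : Fin n → ℂ) i, ∑ l, PowerSeries.coeff 1 (B i l) * f l = β₁ * f (finRotate n i) := by
      intro f i
      simp [hB.coeff_one]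
    have hpk : ∀ i, PowerSeries.coeff k (p * a i) = PowerSeries.coeff k p := by
      intro i
      rw [coeff_mul_range, Finset.sum_range_succ, Nat.sub_self, ha, mul_one,
        Finset.sum_eq_zero fun m hm => by rw [ihp m (Finset.mem_range.1 hm), zero_mul], zero_add]
    have hδ : ∀ i, ((k - N : ℕ) : ℂ) * PowerSeries.coeff (k - N) (z i) = 0 := by
      intro i
      by_cases h : k ≤ N
      · rw [Nat.sub_eq_zero_of_le h]; simp
      · rw [ihz (k - N) (by omega) i, mul_zero]
    have hw : ∀ i, PowerSeries.coeff k (PowerSeries.X ^ M * w i) = 0 := by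
      intro i
      rw [PowerSeries.coeff_X_pow_mul', if_neg (by omega)]
    have hc := fun i => congrArg (PowerSeries.coeff k) (heq i)
    simp only [map_add, sum_coeff_mul_range, PowerSeries.coeff_C_mul, coeff_X_pow_succ_mul_derivative, hδ,
      hpk, hw, mul_zero, add_zero] at hc
    rcases k with _ | k
    · have h2 : PowerSeries.coeff 0 p = 0 := by
        have h3 := hc ⟨0, hn⟩
        rw [Finset.sum_range_one, Nat.sub_zero, h0, coeff_mul_range, Finset.sum_range_one, hQ0,
          Nat.sub_zero] at h3
        linear_combination -h3
      exact ⟨fun m hm => by rwa [show m = 0 by omega], fun d hd => by omega⟩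
    · have h4 : ∀ i, PowerSeries.coeff k (z (finRotate n i)) - PowerSeries.coeff k (z i) = PowerSeries.coeff (k + 1) p / β₁ := by
        intro i
        have h3 := hc i
        have e1 : ∀ x ∈ Finset.range k, ∑ l, PowerSeries.coeff (x + 1 + 1) (B i l) *
            PowerSeries.coeff (k + 1 - (x + 1 + 1)) (z l) = 0 := fun x hx =>
          Finset.sum_eq_zero fun l _ => by
            rw [ihz _ (by have := Finset.mem_range.1 hx; omega), mul_zero]
        have e2 : ∀ x ∈ Finset.range k, PowerSeries.coeff (x + 1 + 1) Q *
            PowerSeries.coeff (k + 1 - (x + 1 + 1)) (z i) = 0 := fun x hx => by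
          rw [ihz _ (by have := Finset.mem_range.1 hx; omega), mul_zero]
        rw [coeff_mul_range, Finset.sum_range_succ', Finset.sum_range_succ',
          Finset.sum_range_succ' _ (k + 1), Finset.sum_range_succ' _ k,
          Finset.sum_eq_zero e1, Finset.sum_eq_zero e2] at h3
        simp only [zero_add, Nat.sub_zero, Nat.add_sub_cancel, h0, h1, hQ0, hQ1] at h3
        field_simp
        linear_combination h3
      obtain ⟨h5, h6⟩ := eq_zero_of_finRotate_sub_eq (hzk k) hn h4
      have h7 : PowerSeries.coeff (k + 1) p = 0 := (div_eq_zero_iff.1 h5).resolve_right hβ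
      refine ⟨fun m hm => ?_, fun d hd i => ?_⟩
      · rcases Nat.lt_or_ge m (k + 1) with h | h
        · exact ihp m h
        · rwa [show m = k + 1 by omega]
      · rcases Nat.lt_or_ge d k with h | h
        · exact ihz d (by omega) i
        · rw [show d = k by omega]; exact h6 i

end Recursion

/-! ### Rows of matrices in `z` as series in `s` -/

section RowSeries

open scoped PowerSeries

variable {n : ℕ} {R : Type*} [CommRing R]

/-- The inverse of the matrix `ℋ`, in the variable `z = 1/x`. -/
noncomputable def shiftW (n : ℕ) (R : Type*) [CommRing R] : Matrix (Fin n) (Fin n) R⟦X⟧ :=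
  Matrix.of fun i j => if j = finRotate n i then (if i.val + 1 = n then PowerSeries.X else 1) else 0

/-- The grading matrix `G = diag (0, 1, …, n-1)`. -/
noncomputable def gradG (n : ℕ) (R : Type*) [CommRing R] : Matrix (Fin n) (Fin n) R⟦X⟧ :=
  Matrix.diagonal fun k : Fin n => ((k.val : ℕ) : R⟦X⟧)

/-- The Euler operator `z d/dz` on matrices of power series. -/
noncomputable def euler (Y : Matrix (Fin n) (Fin n) R⟦X⟧) : Matrix (Fin n) (Fin n) R⟦X⟧ :=
  Y.map fun f => PowerSeries.X * d⁄dX R f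

/-- The derivation of the principal grading, up to a commutator: `n z d/dz Y + Y G`. -/
noncomputable def gradDer (Y : Matrix (Fin n) (Fin n) R⟦X⟧) : Matrix (Fin n) (Fin n) R⟦X⟧ :=
  (n : R⟦X⟧) • euler Y + Y * gradG n R

/-- The polynomial `∑_{m ≤ N} p_m W^m` in the matrix `W = ℋ⁻¹`. -/
noncomputable def polyW (n N : ℕ) (p : R⟦X⟧) : Matrix (Fin n) (Fin n) R⟦X⟧ :=
  ∑ m ∈ Finset.range (N + 1), PowerSeries.C (PowerSeries.coeff m p) • shiftW n R ^ m

theorem coeff_X_mul_derivative (f : R⟦X⟧) (e : ℕ) :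
    PowerSeries.coeff e (PowerSeries.X * d⁄dX R f) = (e : R) * PowerSeries.coeff e f := by
  have := coeff_X_pow_succ_mul_derivative 0 e f
  simpa using this

variable [NeZero n]

/-- The row `i` of a matrix in `z` as one series in `s`, where `z = sⁿ`, with the column `j`
multiplied by `s^j`. -/
noncomputable def rowSeries (Y : Matrix (Fin n) (Fin n) R⟦X⟧) (i : Fin n) : R⟦X⟧ :=
  ∑ j, PowerSeries.expand n (NeZero.ne n) (Y i j) * PowerSeries.X ^ j.val

/-- Every exponent is `n k + j` for exactly one pair with `j < n`. In other words, the series in `s`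
are free over the series in `z = sⁿ` with basis `1, s, …, s^{n-1}`, so a row carries the same
information as one series in `s`. -/
theorem coeff_rowSeries (Y : Matrix (Fin n) (Fin n) R⟦X⟧) (i j : Fin n) (k : ℕ) :
    PowerSeries.coeff (n * k + j) (rowSeries Y i) = PowerSeries.coeff k (Y i j) := by
  rw [rowSeries, map_sum, Finset.sum_eq_single j]
  · rw [PowerSeries.coeff_mul_X_pow, PowerSeries.coeff_expand_mul]
  · intro l _ hl
    rw [PowerSeries.coeff_mul_X_pow']
    split_ifs with h
    · rw [PowerSeries.coeff_expand, if_neg]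
      intro hd
      apply hl
      have h1 : (n * k + j.val - l.val) % n = 0 := Nat.mod_eq_zero_of_dvd hd
      have hl2 := l.2
      have hj2 := j.2
      ext
      rcases Nat.lt_trichotomy l.val j.val with h2 | h2 | h2
      · rw [show n * k + j.val - l.val = (j.val - l.val) + n * k by omega,
          Nat.add_mul_mod_self_left, Nat.mod_eq_of_lt (by omega)] at h1
        omega
      · exact h2
      · obtain ⟨k, rfl⟩ : ∃ k', k = k' + 1 := ⟨k - 1, by
          rcases Nat.eq_zero_or_pos k with rfl | hk
          · omega
          · omega⟩
        rw [show n * (k + 1) + j.val - l.val = (n + j.val - l.val) + n * k by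
          rw [Nat.mul_succ]; omega, Nat.add_mul_mod_self_left, Nat.mod_eq_of_lt (by omega)] at h1
        omega
    · rfl
  · simp

theorem coeff_rowSeries' (Y : Matrix (Fin n) (Fin n) R⟦X⟧) (i : Fin n) (e : ℕ) :
    PowerSeries.coeff e (rowSeries Y i) =
      PowerSeries.coeff (e / n) (Y i ⟨e % n, Nat.mod_lt _ (NeZero.pos n)⟩) := by
  rw [← coeff_rowSeries]
  congr 1
  simp only
  rw [Nat.div_add_mod]

theorem rowSeries_injective {Y Y' : Matrix (Fin n) (Fin n) R⟦X⟧}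
    (h : ∀ i, rowSeries Y i = rowSeries Y' i) : Y = Y' := by
  ext i j k
  rw [← coeff_rowSeries, ← coeff_rowSeries, h]

theorem exists_rowSeries_eq (Φ : Fin n → R⟦X⟧) :
    ∃ Y : Matrix (Fin n) (Fin n) R⟦X⟧, ∀ i, rowSeries Y i = Φ i := by
  refine ⟨Matrix.of fun i j => PowerSeries.mk fun k => PowerSeries.coeff (n * k + j.val) (Φ i), fun i => ?_⟩
  ext e
  rw [coeff_rowSeries', Matrix.of_apply, PowerSeries.coeff_mk]
  simp only
  rw [Nat.div_add_mod]

theorem rowSeries_add (Y Y' : Matrix (Fin n) (Fin n) R⟦X⟧) (i : Fin n) :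
    rowSeries (Y + Y') i = rowSeries Y i + rowSeries Y' i := by
  simp only [rowSeries, Matrix.add_apply, map_add, add_mul, Finset.sum_add_distrib]

theorem rowSeries_smul (f : R⟦X⟧) (Y : Matrix (Fin n) (Fin n) R⟦X⟧) (i : Fin n) :
    rowSeries (f • Y) i = PowerSeries.expand n (NeZero.ne n) f * rowSeries Y i := by
  simp only [rowSeries, Matrix.smul_apply, smul_eq_mul, map_mul, Finset.mul_sum, mul_assoc]

theorem rowSeries_sum {ι : Type*} (s : Finset ι) (Y : ι → Matrix (Fin n) (Fin n) R⟦X⟧)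
    (i : Fin n) : rowSeries (∑ a ∈ s, Y a) i = ∑ a ∈ s, rowSeries (Y a) i := by
  simp only [rowSeries, Matrix.sum_apply, map_sum, Finset.sum_mul]
  exact Finset.sum_comm

theorem rowSeries_mul (M Y : Matrix (Fin n) (Fin n) R⟦X⟧) (i : Fin n) :
    rowSeries (M * Y) i = ∑ l, PowerSeries.expand n (NeZero.ne n) (M i l) * rowSeries Y l := by
  simp only [rowSeries, Matrix.mul_apply, map_sum, map_mul, Finset.sum_mul, Finset.mul_sum]
  rw [Finset.sum_comm]
  simp only [mul_assoc]

theorem rowSeries_one (i : Fin n) :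
    rowSeries (1 : Matrix (Fin n) (Fin n) R⟦X⟧) i = PowerSeries.X ^ i.val := by
  rw [rowSeries, Finset.sum_eq_single i]
  · simp
  · intro j _ hj
    simp [Matrix.one_apply_ne' hj]
  · simp

theorem rowSeries_shiftW (i : Fin n) : rowSeries (shiftW n R) i = PowerSeries.X ^ (i.val + 1) := by
  rw [rowSeries, Finset.sum_eq_single (finRotate n i)]
  · rw [shiftW, Matrix.of_apply, if_pos rfl, val_finRotate]
    split_ifs with h
    · rw [PowerSeries.expand_X, h, Nat.mod_self, pow_zero, mul_one]
    · rw [map_one, one_mul, Nat.mod_eq_of_lt (by have := i.2; omega)]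
  · intro j _ hj
    rw [shiftW, Matrix.of_apply, if_neg hj, map_zero, zero_mul]
  · simp

/-- `W` moves the column `j` to `j + 1` and picks up `z = sⁿ` when it wraps around; both amount to
one factor `s`. Polynomials in `ℋ⁻¹` on the right thereby become scalars. -/
theorem rowSeries_mul_shiftW (Y : Matrix (Fin n) (Fin n) R⟦X⟧) (i : Fin n) :
    rowSeries (Y * shiftW n R) i = PowerSeries.X * rowSeries Y i := by
  rw [rowSeries_mul, rowSeries, Finset.mul_sum]
  refine Finset.sum_congr rfl fun l _ => ?_
  rw [rowSeries_shiftW]; ring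

theorem rowSeries_mul_shiftW_pow (Y : Matrix (Fin n) (Fin n) R⟦X⟧) (m : ℕ) (i : Fin n) :
    rowSeries (Y * shiftW n R ^ m) i = PowerSeries.X ^ m * rowSeries Y i := by
  induction m with
  | zero => simp
  | succ m ih => rw [pow_succ, ← mul_assoc, rowSeries_mul_shiftW, ih, pow_succ]; ring

theorem rowSeries_shiftW_pow (m : ℕ) (i : Fin n) :
    rowSeries (shiftW n R ^ m) i = PowerSeries.X ^ (m + i.val) := by
  rw [← one_mul (shiftW n R ^ m), rowSeries_mul_shiftW_pow, rowSeries_one, pow_add]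

theorem shiftW_pow_card : shiftW n R ^ n = (PowerSeries.X : R⟦X⟧) • (1 : Matrix (Fin n) (Fin n) R⟦X⟧) := by
  refine rowSeries_injective fun i => ?_
  rw [rowSeries_shiftW_pow, rowSeries_smul, rowSeries_one, PowerSeries.expand_X, pow_add]

theorem shiftW_pow_mul_card (r : ℕ) :
    shiftW n R ^ (r * n) = (PowerSeries.X ^ r : R⟦X⟧) • (1 : Matrix (Fin n) (Fin n) R⟦X⟧) := by
  rw [mul_comm, pow_mul, shiftW_pow_card, _root_.smul_pow, one_pow]

theorem sum_C_coeff_mul_X_pow {N : ℕ} {p : R⟦X⟧} (hp : ∀ k, N < k → PowerSeries.coeff k p = 0) :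
    ∑ m ∈ Finset.range (N + 1), PowerSeries.C (PowerSeries.coeff m p) * PowerSeries.X ^ m = p := by
  ext k
  simp only [map_sum, PowerSeries.coeff_C_mul, PowerSeries.coeff_X_pow, mul_ite, mul_one, mul_zero,
    Finset.sum_ite_eq, Finset.mem_range]
  split_ifs with h
  · rfl
  · exact (hp k (by omega)).symm

theorem rowSeries_mul_polyW {N : ℕ} {p : R⟦X⟧} (hp : ∀ k, N < k → PowerSeries.coeff k p = 0)
    (Y : Matrix (Fin n) (Fin n) R⟦X⟧) (i : Fin n) :
    rowSeries (Y * polyW n N p) i = p * rowSeries Y i := by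
  rw [polyW, Finset.mul_sum, rowSeries_sum]
  conv_rhs => rw [← sum_C_coeff_mul_X_pow hp, Finset.sum_mul]
  refine Finset.sum_congr rfl fun m _ => ?_
  rw [mul_smul_comm, rowSeries_smul, rowSeries_mul_shiftW_pow, PowerSeries.expand_C, mul_assoc]

/-- At the exponent `e = n k + j` the Euler term contributes `n k` and the grading contributes `j`;
together they give the factor `e` of `s d/ds`. -/
theorem rowSeries_gradDer (Y : Matrix (Fin n) (Fin n) R⟦X⟧) (i : Fin n) :
    rowSeries (gradDer Y) i = PowerSeries.X * d⁄dX R (rowSeries Y i) := by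
  ext e
  rw [coeff_X_mul_derivative, coeff_rowSeries', coeff_rowSeries', gradDer, Matrix.add_apply,
    Matrix.smul_apply, gradG, Matrix.mul_diagonal, map_add, smul_eq_mul, euler, Matrix.map_apply,
    ← map_natCast (PowerSeries.C (R := R)), PowerSeries.coeff_C_mul, coeff_X_mul_derivative, ← map_natCast (PowerSeries.C (R := R)),
    PowerSeries.coeff_mul_C]
  simp only
  rw [← mul_assoc, mul_comm _ ((e % n : ℕ) : R), ← add_mul, ← Nat.cast_mul, ← Nat.cast_add,
    Nat.div_add_mod]

end RowSeries

/-! ### The formal equation and its solution -/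

section FormalEquation

open scoped PowerSeries

variable {n : ℕ} {R : Type*} [CommRing R]

/-- `Y` is a formal gauge which brings the connection with the reversed coefficient series `Â` to
the normal form `∑_{m ≤ N} p_m ℋ^{N-m}`. -/
def FormalEq (r : ℕ) (Â Y : Matrix (Fin n) (Fin n) R⟦X⟧) (p : R⟦X⟧) : Prop :=
  Â * Y + (PowerSeries.X ^ r : R⟦X⟧) • gradDer Y = Y * polyW n (r * n) p

/-- The leading coefficients are `β₀ + β₁ 𝒩 + ⋯`, as in the gauge-fixed form. -/
structure IsAdmissible (Â : Matrix (Fin n) (Fin n) R⟦X⟧) (β₀ β₁ : R) : Prop where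
  lower : ∀ i j : Fin n, j < i → PowerSeries.coeff 0 (Â i j) = 0
  diag : ∀ i, PowerSeries.coeff 0 (Â i i) = β₀
  super : ∀ i j : Fin n, j.val = i.val + 1 → PowerSeries.coeff 0 (Â i j) = β₁
  corner : ∀ i j : Fin n, i.val + 1 = n → j.val = 0 → PowerSeries.coeff 1 (Â i j) = β₁

/-- The constant term is upper unitriangular. -/
def IsUnipotentGauge (Y : Matrix (Fin n) (Fin n) R⟦X⟧) : Prop :=
  ∀ i j : Fin n, j ≤ i → PowerSeries.coeff 0 (Y i j) = if j = i then 1 else 0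

/-- Such a diagonal arises from the derivative of the factor `s^i` of the row `i`; as `N ≥ 2`, it
leaves the two leading coefficients alone. -/
theorem IsCyclicLeading.add_diagonal {B : Matrix (Fin n) (Fin n) R⟦X⟧} {β₀ β₁ : R}
    (hB : IsCyclicLeading B β₀ β₁) {N : ℕ} (hN : 2 ≤ N) (d : Fin n → R⟦X⟧) :
    IsCyclicLeading (B + Matrix.diagonal fun i => PowerSeries.X ^ N * d i) β₀ β₁ := by
  have h : ∀ i j, ∀ k < 2, PowerSeries.coeff k ((Matrix.diagonal fun i => PowerSeries.X ^ N * d i) i j) = 0 := by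
    intro i j k hk
    rw [Matrix.diagonal_apply]
    split_ifs
    · rw [PowerSeries.coeff_X_pow_mul', if_neg (by omega)]
    · rw [map_zero]
  exact ⟨fun i j => by rw [Matrix.add_apply, map_add, h i j 0 (by omega), add_zero, hB.coeff_zero],
    fun i j => by rw [Matrix.add_apply, map_add, h i j 1 (by omega), add_zero, hB.coeff_one]⟩

variable [NeZero n]

/-- `B` is the conjugate `s^{-G} Â(sⁿ) s^G`, whose entry at `(i, j)` has the exponents `n k + j -
i`. They are nonnegative because the entries below the diagonal have no constant term. The exponent
zero occurs only on the diagonal, and the exponent one only just above it or, with `k = 1`, in the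
lower left corner; the equality of these coefficients makes the linear term a multiple of the shift.
-/
theorem exists_isCyclicLeading {Â : Matrix (Fin n) (Fin n) R⟦X⟧} {β₀ β₁ : R}
    (hA : IsAdmissible Â β₀ β₁) :
    ∃ B : Matrix (Fin n) (Fin n) R⟦X⟧, IsCyclicLeading B β₀ β₁ ∧
      ∀ i j, PowerSeries.X ^ i.val * B i j = PowerSeries.X ^ j.val * PowerSeries.expand n (NeZero.ne n) (Â i j) := by
  refine ⟨Matrix.of fun i j => PowerSeries.mk fun c => if j.val ≤ c + i.val then
    PowerSeries.coeff (c + i.val - j.val) (PowerSeries.expand n (NeZero.ne n) (Â i j)) else 0, ⟨fun i j => ?_, fun i j => ?_⟩,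
    fun i j => ?_⟩
  · rw [Matrix.of_apply, PowerSeries.coeff_mk, zero_add, PowerSeries.coeff_expand]
    have hi := i.2
    split_ifs with h1 h2 h3 h3 h3
    · subst h3; simp only [Nat.sub_self, Nat.zero_div, hA.diag]
    · exfalso
      obtain ⟨k, hk⟩ := h2
      have : k = 0 := by
        by_contra hk0
        have : n * 1 ≤ n * k := Nat.mul_le_mul_left n (by omega)
        omega
      subst this
      exact h3 (Fin.ext (by omega))
    · subst h3; simp at h2
    · rfl
    · subst h3; omega
    · rfl
  · rw [Matrix.of_apply, PowerSeries.coeff_mk, PowerSeries.coeff_expand]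
    have hi := i.2
    have hj := j.2
    have hv := val_finRotate i
    by_cases h0 : i.val + 1 = n
    · rw [h0, Nat.mod_self] at hv
      by_cases h1 : j = finRotate n i
      · have hj0 : j.val = 0 := by rw [h1, hv]
        rw [if_pos h1, if_pos (by omega), if_pos (by
          rw [hj0, Nat.sub_zero, add_comm 1, h0]), hj0, Nat.sub_zero, add_comm 1, h0,
          Nat.div_self (by omega), hA.corner i j h0 hj0]
      · have hj0 : j.val ≠ 0 := fun h => h1 (Fin.ext (by rw [h, hv]))
        rw [if_neg h1, if_pos (by omega), if_neg]
        intro hd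
        have := Nat.le_of_dvd (by omega) hd
        omega
    · rw [Nat.mod_eq_of_lt (by omega)] at hv
      by_cases h1 : j = finRotate n i
      · have hj0 : j.val = i.val + 1 := by rw [h1, hv]
        rw [if_pos h1, if_pos (by omega), show 1 + i.val - j.val = 0 by omega, if_pos (dvd_zero _),
          Nat.zero_div, hA.super i j hj0]
      · rw [if_neg h1]
        have hj0 : j.val ≠ i.val + 1 := fun h => h1 (Fin.ext (by rw [h, hv]))
        split_ifs with h2 h3
        · have := Nat.le_of_dvd (by omega) h3
          omega
        · rfl
        · rfl
  · ext e
    rw [Matrix.of_apply, PowerSeries.coeff_X_pow_mul', PowerSeries.coeff_X_pow_mul']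
    split_ifs with h1 h2 h2
    · rw [PowerSeries.coeff_mk, if_pos (by omega)]
      congr 1; congr 1; omega
    · rw [PowerSeries.coeff_mk, if_neg (by omega)]
    · rw [PowerSeries.coeff_expand]
      split_ifs with h3
      · have h4 : e - j.val = 0 := by
          by_contra h5
          have := Nat.le_of_dvd (by omega) h3
          have := i.2
          omega
        rw [h4, Nat.zero_div, hA.lower i j (by rw [Fin.lt_def]; omega)]
      · rfl
    · rfl

theorem exists_rowSeries_eq_X_pow_mul {Y : Matrix (Fin n) (Fin n) R⟦X⟧} {i : Fin n}
    (h : ∀ j < i, PowerSeries.coeff 0 (Y i j) = 0) :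
    ∃ z, rowSeries Y i = PowerSeries.X ^ i.val * z ∧ PowerSeries.coeff 0 z = PowerSeries.coeff 0 (Y i i) := by
  have hd : (PowerSeries.X : R⟦X⟧) ^ i.val ∣ rowSeries Y i := by
    rw [PowerSeries.X_pow_dvd_iff]
    intro e he
    have := i.2
    rw [coeff_rowSeries', Nat.div_eq_of_lt (by omega)]
    exact h _ (by rw [Fin.lt_def]; simp only; rwa [Nat.mod_eq_of_lt (by omega)])
  obtain ⟨z, hz⟩ := hd
  refine ⟨z, hz, ?_⟩
  have h1 := coeff_rowSeries Y i i 0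
  rw [← h1, hz, Nat.mul_zero, zero_add]
  have := PowerSeries.coeff_X_pow_mul z i.val 0
  rw [zero_add] at this
  exact this.symm

theorem X_pow_mul_left_cancel {k : ℕ} {f g : R⟦X⟧} (h : PowerSeries.X ^ k * f = PowerSeries.X ^ k * g) : f = g := by
  ext e
  have := congrArg (PowerSeries.coeff (e + k)) h
  rwa [PowerSeries.coeff_X_pow_mul, PowerSeries.coeff_X_pow_mul] at this

theorem X_pow_mul_derivative_X_pow_mul (N i : ℕ) (z : R⟦X⟧) :
    PowerSeries.X ^ (N + 1) * d⁄dX R (PowerSeries.X ^ i * z) =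
      PowerSeries.X ^ i * (PowerSeries.X ^ (N + 1) * d⁄dX R z + PowerSeries.X ^ N * (i : R⟦X⟧) * z) := by
  have h : PowerSeries.X * d⁄dX R (PowerSeries.X ^ i : R⟦X⟧) = (i : R⟦X⟧) * PowerSeries.X ^ i := by
    rw [Derivation.leibniz_pow, PowerSeries.derivative_X, smul_eq_mul, nsmul_eq_mul, mul_one]
    cases i with
    | zero => simp
    | succ i => rw [Nat.add_sub_cancel, pow_succ]; ring
  rw [Derivation.leibniz, smul_eq_mul, smul_eq_mul, pow_succ]
  linear_combination PowerSeries.X ^ N * z * h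

/-- The inhomogeneous equation for the rows, after division by powers of `s`. -/
theorem sum_add_eq_of_rowSeries {Â B : Matrix (Fin n) (Fin n) R⟦X⟧}
    (hB : ∀ i j, PowerSeries.X ^ i.val * B i j = PowerSeries.X ^ j.val * PowerSeries.expand n (NeZero.ne n) (Â i j))
    {Y : Matrix (Fin n) (Fin n) R⟦X⟧} {z : Fin n → R⟦X⟧}
    (hz : ∀ i, rowSeries Y i = PowerSeries.X ^ i.val * z i) (r : ℕ) (i : Fin n) :
    rowSeries (Â * Y + (PowerSeries.X ^ r : R⟦X⟧) • gradDer Y) i =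
      PowerSeries.X ^ i.val * (∑ l, (B + Matrix.diagonal fun i : Fin n => PowerSeries.X ^ (r * n) * (i.val : R⟦X⟧) :
          Matrix (Fin n) (Fin n) R⟦X⟧) i l * z l +
        PowerSeries.X ^ (r * n + 1) * d⁄dX R (z i)) := by
  rw [rowSeries_add, rowSeries_mul, rowSeries_smul, rowSeries_gradDer, map_pow, PowerSeries.expand_X,
    ← pow_mul, mul_comm n r, ← mul_assoc, ← pow_succ, hz i, X_pow_mul_derivative_X_pow_mul]
  simp only [Matrix.add_apply, add_mul, Finset.sum_add_distrib, Matrix.diagonal_apply, ite_mul,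
    zero_mul, Finset.sum_ite_eq, Finset.mem_univ, if_true]
  have : ∑ l, PowerSeries.expand n (NeZero.ne n) (Â i l) * rowSeries Y l = PowerSeries.X ^ i.val * ∑ l, B i l * z l := by
    rw [Finset.mul_sum]
    refine Finset.sum_congr rfl fun l _ => ?_
    rw [hz l]
    linear_combination -(z l) * hB i l
  rw [this]
  ring

/-- Row series of the form `s^i (1 + ⋯)` are those of matrices with upper unitriangular constant
term, so the vector solution in `s` reassembles to a unipotent gauge. -/
theorem exists_formalEq [Algebra ℂ R] {Â : Matrix (Fin n) (Fin n) R⟦X⟧} {β₀ β₁ : R}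
    (hA : IsAdmissible Â β₀ β₁) (hβ : IsUnit β₁) {r : ℕ} (hN : 2 ≤ r * n) :
    ∃ (Y : Matrix (Fin n) (Fin n) R⟦X⟧) (p : R⟦X⟧), IsUnipotentGauge Y ∧
      (∀ k, r * n < k → PowerSeries.coeff k p = 0) ∧ FormalEq r Â Y p := by
  obtain ⟨B, hB, hBA⟩ := exists_isCyclicLeading hA
  obtain ⟨z, p, hz0, hp, hz⟩ := exists_truncated_solution
    (hB.add_diagonal hN fun i => (i.val : R⟦X⟧)) hβ hN (NeZero.pos n)
  obtain ⟨Y, hY⟩ := exists_rowSeries_eq fun i => PowerSeries.X ^ i.val * z i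
  refine ⟨Y, p, fun i j hji => ?_, hp, rowSeries_injective fun i => ?_⟩
  · have := coeff_rowSeries Y i j 0
    rw [← this, hY, PowerSeries.coeff_X_pow_mul', Nat.mul_zero, zero_add]
    by_cases h : j = i
    · rw [if_pos h, if_pos (by rw [h]), h, Nat.sub_self, hz0]
    · rw [if_neg h, if_neg]
      rw [Fin.le_def] at hji
      exact fun h' => h (Fin.ext (by omega))
  · rw [sum_add_eq_of_rowSeries hBA hY, hz, rowSeries_mul_polyW hp, hY]
    ring

end FormalEquation

/-! ### Uniqueness, linearized uniqueness and comparison with the spectrum -/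

section Uniqueness

open scoped PowerSeries

variable {n : ℕ} [NeZero n]

/-- The quotient `g` of the sums is the factor for which `z - a g` has sum zero. This difference
solves the equation with the scalar defect `p''` times `a`, so `eq_zero_of_truncated` at every order
kills both; `p'' = 0` is the remaining scalar equation for `g`. -/
theorem exists_eq_mul_of_linearized {B : Matrix (Fin n) (Fin n) ℂ⟦X⟧} {β₀ β₁ : ℂ}
    (hB : IsCyclicLeading B β₀ β₁) (hβ : β₁ ≠ 0) {N : ℕ} (hN : 2 ≤ N) {P P' q : ℂ⟦X⟧}
    (hP0 : PowerSeries.coeff 0 P = β₀) (hP1 : PowerSeries.coeff 1 P = β₁) {a z : Fin n → ℂ⟦X⟧}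
    (ha : ∀ i, PowerSeries.coeff 0 (a i) = 1) (hz : ∀ i, PowerSeries.coeff 0 (z i) = 0)
    (haeq : ∀ i, ∑ l, B i l * a l + PowerSeries.X ^ (N + 1) * d⁄dX ℂ (a i) = P' * a i)
    (hzeq : ∀ i, ∑ l, B i l * z l + PowerSeries.X ^ (N + 1) * d⁄dX ℂ (z i) = P * z i + q * a i) :
    ∃ g : ℂ⟦X⟧, PowerSeries.coeff 0 g = 0 ∧ (∀ i, z i = a i * g) ∧
      (P - P') * g + q = PowerSeries.X ^ (N + 1) * d⁄dX ℂ g := by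
  have hn : (n : ℂ) ≠ 0 := by exact_mod_cast NeZero.ne n
  set g : ℂ⟦X⟧ := (∑ i, z i) * (∑ i, a i)⁻¹ with hg
  have hS : PowerSeries.constantCoeff (∑ i, a i) ≠ 0 := by
    rw [← PowerSeries.coeff_zero_eq_constantCoeff_apply, map_sum, Finset.sum_congr rfl fun i _ => ha i]
    simpa using hn
  have hg0 : PowerSeries.coeff 0 g = 0 := by
    rw [hg, coeff_mul_range, Finset.sum_range_one, map_sum, Finset.sum_congr rfl fun i _ => hz i]
    simp
  have hsum : ∑ i, (z i - a i * g) = 0 := by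
    rw [Finset.sum_sub_distrib, ← Finset.sum_mul, hg, mul_left_comm,
      PowerSeries.mul_inv_cancel _ hS, mul_one, sub_self]
  set p'' := (P - P') * g + q - PowerSeries.X ^ (N + 1) * d⁄dX ℂ g with hp''
  have key : ∀ M, (∀ m < M, PowerSeries.coeff m p'' = 0) ∧
      ∀ d, d + 1 < M → ∀ i, PowerSeries.coeff d (z i - a i * g) = 0 := by
    intro M
    refine eq_zero_of_truncated hB hβ hN (NeZero.pos n) 1 hP0 hP1 (w := 0) ha hsum fun i => ?_
    have e : ∑ l, B i l * (z l - a l * g) = ∑ l, B i l * z l - (∑ l, B i l * a l) * g := by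
      simp only [mul_sub, Finset.sum_sub_distrib, Finset.sum_mul, mul_assoc]
    rw [e, map_sub, Derivation.leibniz, smul_eq_mul, smul_eq_mul, map_one, Pi.zero_apply, mul_zero,
      add_zero, hp'']
    linear_combination hzeq i - g * haeq i
  refine ⟨g, hg0, fun i => ?_, ?_⟩
  · ext d
    have := (key (d + 2)).2 d (by omega) i
    rwa [map_sub, sub_eq_zero] at this
  · rw [← sub_eq_zero]
    ext m
    rw [map_zero]
    exact (key (m + 1)).1 m (by omega)

/-- A polynomial of degree at most `N` that is divisible by `s^{N+1}` vanishes. This is how the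
truncation of the exponents removes the freedom of a scalar factor. -/
theorem eq_zero_of_X_pow_mul_derivative {N : ℕ} {q g u : ℂ⟦X⟧} (hq : ∀ k, N < k → PowerSeries.coeff k q = 0)
    (hg : PowerSeries.coeff 0 g = 0) (h : q = PowerSeries.X ^ (N + 1) * u) (hu : u = 0 → d⁄dX ℂ g = 0) :
    q = 0 ∧ g = 0 := by
  have hq0 : q = 0 := by
    ext k
    rw [map_zero]
    rcases Nat.lt_or_ge N k with hk | hk
    · exact hq k hk
    · rw [h, PowerSeries.coeff_X_pow_mul', if_neg (by omega)]
  have hu0 : u = 0 := by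
    refine X_pow_mul_left_cancel (k := N + 1) ?_
    rw [← h, hq0, mul_zero]
  refine ⟨hq0, ?_⟩
  ext k
  rw [map_zero]
  cases k with
  | zero => exact hg
  | succ k =>
    have := congrArg (PowerSeries.coeff k) (hu hu0)
    rw [PowerSeries.coeff_derivative, map_zero] at this
    exact (mul_eq_zero.1 this).resolve_right (by exact_mod_cast k.succ_ne_zero)

/-- The two leading coefficients of the scalar are forced because `S` fixes the vector `(1, …, 1)`
of constant terms. -/
theorem coeff_eq_of_cyclicLeading {B : Matrix (Fin n) (Fin n) ℂ⟦X⟧} {β₀ β₁ : ℂ}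
    (hB : IsCyclicLeading B β₀ β₁) {N : ℕ} (hN : 2 ≤ N) {P : ℂ⟦X⟧} {a : Fin n → ℂ⟦X⟧}
    (ha : ∀ i, PowerSeries.coeff 0 (a i) = 1)
    (haeq : ∀ i, ∑ l, B i l * a l + PowerSeries.X ^ (N + 1) * d⁄dX ℂ (a i) = P * a i) :
    PowerSeries.coeff 0 P = β₀ ∧ PowerSeries.coeff 1 P = β₁ := by
  have h0 : ∀ (f : Fin n → ℂ) i, ∑ l, PowerSeries.coeff 0 (B i l) * f l = β₀ * f i := by
    intro f i
    simp [hB.coeff_zero, -PowerSeries.coeff_zero_eq_constantCoeff]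
  have h1 : ∀ (f : Fin n → ℂ) i, ∑ l, PowerSeries.coeff 1 (B i l) * f l = β₁ * f (finRotate n i) := by
    intro f i
    simp [hB.coeff_one]
  have hδ : ∀ i, ∀ k < 2, PowerSeries.coeff k (PowerSeries.X ^ (N + 1) * d⁄dX ℂ (a i)) = 0 := by
    intro i k hk
    rw [PowerSeries.coeff_X_pow_mul', if_neg (by omega)]
  have hP0 : PowerSeries.coeff 0 P = β₀ := by
    have := congrArg (PowerSeries.coeff 0) (haeq 0)
    rw [map_add, hδ _ _ (by omega), sum_coeff_mul_range, coeff_mul_range, Finset.sum_range_one,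
      Finset.sum_range_one, Nat.sub_zero, h0, ha] at this
    linear_combination -this
  refine ⟨hP0, ?_⟩
  have hS : ∑ i, (PowerSeries.coeff 1 (a (finRotate n i)) - PowerSeries.coeff 1 (a i)) = 0 := by
    rw [Finset.sum_sub_distrib, Equiv.sum_comp (finRotate n) fun i => PowerSeries.coeff 1 (a i), sub_self]
  have := congrArg (PowerSeries.coeff 1) (haeq 0)
  rw [map_add, hδ _ _ (by omega), sum_coeff_mul_range, coeff_mul_range, Finset.sum_range_succ,
    Finset.sum_range_one, Finset.sum_range_succ, Finset.sum_range_one, Nat.sub_zero, Nat.sub_self,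
    h0, h1, ha, ha, hP0] at this
  linear_combination -this

/-- Uniqueness of the solution of the linearized formal equation. -/
theorem eq_zero_of_linearized {Â Y Z : Matrix (Fin n) (Fin n) ℂ⟦X⟧} {β₀ β₁ : ℂ}
    (hA : IsAdmissible Â β₀ β₁) (hβ : β₁ ≠ 0) {r : ℕ} (hN : 2 ≤ r * n) {p q : ℂ⟦X⟧}
    (hp : ∀ k, r * n < k → PowerSeries.coeff k p = 0) (hq : ∀ k, r * n < k → PowerSeries.coeff k q = 0)
    (hY : IsUnipotentGauge Y) (hYeq : FormalEq r Â Y p)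
    (hZ : ∀ i j : Fin n, j ≤ i → PowerSeries.coeff 0 (Z i j) = 0)
    (hZeq : Â * Z + (PowerSeries.X ^ r : ℂ⟦X⟧) • gradDer Z =
      Z * polyW n (r * n) p + Y * polyW n (r * n) q) : Z = 0 ∧ q = 0 := by
  obtain ⟨B, hB, hBA⟩ := exists_isCyclicLeading hA
  choose a ha ha0 using fun i => exists_rowSeries_eq_X_pow_mul (Y := Y) (i := i)
    fun j hj => by rw [hY i j hj.le, if_neg hj.ne]
  choose z hz hz0 using fun i => exists_rowSeries_eq_X_pow_mul (Y := Z) (i := i)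
    fun j hj => hZ i j hj.le
  have ha1 : ∀ i, PowerSeries.coeff 0 (a i) = 1 := fun i => by rw [ha0, hY i i le_rfl, if_pos rfl]
  have hz1 : ∀ i, PowerSeries.coeff 0 (z i) = 0 := fun i => by rw [hz0, hZ i i le_rfl]
  have hB' := hB.add_diagonal hN fun i => (i.val : ℂ⟦X⟧)
  have haeq : ∀ i, _ := fun i => by
    have := sum_add_eq_of_rowSeries hBA ha r i
    rw [hYeq, rowSeries_mul_polyW hp, ha i, mul_left_comm] at this
    exact (X_pow_mul_left_cancel this).symm
  have hzeq : ∀ i, _ := fun i => by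
    have := sum_add_eq_of_rowSeries hBA hz r i
    rw [hZeq, rowSeries_add, rowSeries_mul_polyW hp, rowSeries_mul_polyW hq, ha i, hz i,
      mul_left_comm, mul_left_comm q, ← mul_add] at this
    exact (X_pow_mul_left_cancel this).symm
  obtain ⟨hp0, hp1⟩ := coeff_eq_of_cyclicLeading hB' hN ha1 haeq
  obtain ⟨g, hg0, hzg, hg⟩ := exists_eq_mul_of_linearized hB' hβ hN hp0 hp1 ha1 hz1 haeq hzeq
  rw [sub_self, zero_mul, zero_add] at hg
  obtain ⟨hq0, hg⟩ := eq_zero_of_X_pow_mul_derivative hq hg0 hg id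
  refine ⟨rowSeries_injective fun i => ?_, hq0⟩
  rw [hz, hzg, hg]
  simp [rowSeries]

/-- Uniqueness of the formal gauge and of the normal form. -/
theorem FormalEq.unique {Â Y Y' : Matrix (Fin n) (Fin n) ℂ⟦X⟧} {β₀ β₁ : ℂ}
    (hA : IsAdmissible Â β₀ β₁) (hβ : β₁ ≠ 0) {r : ℕ} (hN : 2 ≤ r * n) {p p' : ℂ⟦X⟧}
    (hp : ∀ k, r * n < k → PowerSeries.coeff k p = 0) (hp' : ∀ k, r * n < k → PowerSeries.coeff k p' = 0)
    (hY : IsUnipotentGauge Y) (hYeq : FormalEq r Â Y p)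
    (hY' : IsUnipotentGauge Y') (hYeq' : FormalEq r Â Y' p') : Y = Y' ∧ p = p' := by
  obtain ⟨B, hB, hBA⟩ := exists_isCyclicLeading hA
  choose a ha ha0 using fun i => exists_rowSeries_eq_X_pow_mul (Y := Y) (i := i)
    fun j hj => by rw [hY i j hj.le, if_neg hj.ne]
  choose b hb hb0 using fun i => exists_rowSeries_eq_X_pow_mul (Y := Y') (i := i)
    fun j hj => by rw [hY' i j hj.le, if_neg hj.ne]
  have ha1 : ∀ i, PowerSeries.coeff 0 (a i) = 1 := fun i => by rw [ha0, hY i i le_rfl, if_pos rfl]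
  have hb1 : ∀ i, PowerSeries.coeff 0 (b i) = 1 := fun i => by rw [hb0, hY' i i le_rfl, if_pos rfl]
  have hB' := hB.add_diagonal hN fun i => (i.val : ℂ⟦X⟧)
  have haeq : ∀ i, _ := fun i => by
    have := sum_add_eq_of_rowSeries hBA ha r i
    rw [hYeq, rowSeries_mul_polyW hp, ha i, mul_left_comm] at this
    exact (X_pow_mul_left_cancel this).symm
  have hbeq : ∀ i, _ := fun i => by
    have := sum_add_eq_of_rowSeries hBA hb r i
    rw [hYeq', rowSeries_mul_polyW hp', hb i, mul_left_comm] at this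
    exact (X_pow_mul_left_cancel this).symm
  obtain ⟨hp0, hp1⟩ := coeff_eq_of_cyclicLeading hB' hN ha1 haeq
  -- With `b` as the reference solution, `b - a` satisfies the linearized equation with the source
  -- `p' - p`. The scalar equation becomes `(p' - p)(1 - g) = s^{rn+1} g'`, where `1 - g` is a unit.
  obtain ⟨g, hg0, hzg, hg⟩ := exists_eq_mul_of_linearized hB' hβ hN (P' := p') (q := p' - p)
    (z := fun i => b i - a i) hp0 hp1 hb1 (fun i => by rw [map_sub, ha1, hb1, sub_self]) hbeq
    (fun i => by
      simp only [mul_sub, Finset.sum_sub_distrib, map_sub]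
      linear_combination hbeq i - haeq i)
  have hu : PowerSeries.constantCoeff (1 - g) ≠ 0 := by
    rw [← PowerSeries.coeff_zero_eq_constantCoeff_apply, map_sub, hg0, PowerSeries.coeff_zero_one]; simp
  have hg' : p' - p = PowerSeries.X ^ ((r * n) + 1) * (d⁄dX ℂ g * (1 - g)⁻¹) := by
    have e : (p' - p) * (1 - g) = PowerSeries.X ^ ((r * n) + 1) * d⁄dX ℂ g := by linear_combination hg
    rw [← mul_assoc, ← e, mul_assoc, PowerSeries.mul_inv_cancel _ hu, mul_one]
  obtain ⟨hq0, hg⟩ := eq_zero_of_X_pow_mul_derivative (fun k hk => by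
    rw [map_sub, hp k hk, hp' k hk, sub_self]) hg0 hg' (fun h => by
    have := congrArg (· * (1 - g)) h
    simpa only [mul_assoc, PowerSeries.inv_mul_cancel _ hu, mul_one, zero_mul] using this)
  refine ⟨rowSeries_injective fun i => ?_, (sub_eq_zero.1 hq0).symm⟩
  have := hzg i
  rw [hg, mul_zero, sub_eq_zero] at this
  rw [ha, hb, this]

/-- The spectral version of the formal equation: an eigenvector of `Â(sⁿ)` over `ℂ⟦s⟧`, whose
eigenvalue agrees with the normal form up to the order `r n`. -/
theorem exists_eigenvector {Â Y : Matrix (Fin n) (Fin n) ℂ⟦X⟧} {β₀ β₁ : ℂ}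
    (hA : IsAdmissible Â β₀ β₁) (hβ : β₁ ≠ 0) {r : ℕ} (hN : 2 ≤ r * n) {p : ℂ⟦X⟧}
    (hp : ∀ k, r * n < k → PowerSeries.coeff k p = 0) (hY : IsUnipotentGauge Y) (hYeq : FormalEq r Â Y p) :
    ∃ (Φ : Fin n → ℂ⟦X⟧) (Q : ℂ⟦X⟧), Φ ≠ 0 ∧
      (∀ i, ∑ l, PowerSeries.expand n (NeZero.ne n) (Â i l) * Φ l = Q * Φ i) ∧
      PowerSeries.coeff 1 Q = β₁ ∧ ∀ m < r * n, PowerSeries.coeff m Q = PowerSeries.coeff m p := by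
  have hn : (n : ℂ) ≠ 0 := by exact_mod_cast NeZero.ne n
  obtain ⟨B, hB, hBA⟩ := exists_isCyclicLeading hA
  obtain ⟨z, Q, hz0, hzk, hQ0, hQ1, hQ⟩ := exists_normalized hB (isUnit_iff_ne_zero.2 hβ) hN
    (NeZero.pos n) 0
  simp only [map_zero, zero_mul, add_zero] at hQ
  choose a ha ha0 using fun i => exists_rowSeries_eq_X_pow_mul (Y := Y) (i := i)
    fun j hj => by rw [hY i j hj.le, if_neg hj.ne]
  have ha1 : ∀ i, PowerSeries.coeff 0 (a i) = 1 := fun i => by rw [ha0, hY i i le_rfl, if_pos rfl]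
  have haeq : ∀ i, _ := fun i => by
    have := sum_add_eq_of_rowSeries hBA ha r i
    rw [hYeq, rowSeries_mul_polyW hp, ha i, mul_left_comm] at this
    exact (X_pow_mul_left_cancel this).symm
  refine ⟨fun i => PowerSeries.X ^ i.val * z i, Q, fun h => ?_, fun i => ?_, hQ1, ?_⟩
  · have := congrArg (PowerSeries.coeff 0) (congrFun h 0)
    simp at this
    have h1 := hz0 0
    rw [PowerSeries.coeff_zero_eq_constantCoeff] at h1
    rw [h1] at this
    exact one_ne_zero this
  · rw [mul_left_comm, ← hQ i, Finset.mul_sum]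
    exact Finset.sum_congr rfl fun l _ => by linear_combination -(z l) * hBA i l
  -- `h` is the mean of the `a i`, so that `a / h` has the same sum as the normalized eigenvector
  -- `z`. In the difference, the derivative and the grading terms carry the factor `s^{rn}` and go
  -- into the remainder `w`.
  · set h : ℂ⟦X⟧ := PowerSeries.C (n : ℂ)⁻¹ * ∑ i, a i with hh
    have hh0 : PowerSeries.constantCoeff h ≠ 0 := by
      rw [← PowerSeries.coeff_zero_eq_constantCoeff_apply, hh, PowerSeries.coeff_C_mul, map_sum,
        Finset.sum_congr rfl fun i _ => ha1 i]
      simp [hn]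
    have hh1 : PowerSeries.coeff 0 h = 1 := by
      rw [hh, PowerSeries.coeff_C_mul, map_sum, Finset.sum_congr rfl fun i _ => ha1 i]
      simp [hn]
    have hi : h * h⁻¹ = 1 := PowerSeries.mul_inv_cancel _ hh0
    have hi0 : PowerSeries.coeff 0 h⁻¹ = 1 := by
      have := congrArg (PowerSeries.coeff 0) hi
      rwa [coeff_mul_range, Finset.sum_range_one, Nat.sub_zero, hh1, one_mul,
        PowerSeries.coeff_zero_one] at this
    have hsz : ∑ i, z i = (n : ℂ⟦X⟧) := by
      ext k
      rw [map_sum, ← map_natCast (PowerSeries.C (R := ℂ)), PowerSeries.coeff_C]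
      split_ifs with hk
      · rw [hk, Finset.sum_congr rfl fun i _ => hz0 i]; simp
      · exact hzk k hk
    have hsa : ∑ i, a i = (n : ℂ⟦X⟧) * h := by
      rw [hh, ← mul_assoc, ← map_natCast (PowerSeries.C (R := ℂ)), ← map_mul, mul_inv_cancel₀ hn, map_one,
        one_mul]
    have main := eq_zero_of_truncated hB hβ hN (NeZero.pos n) 0 hQ0 hQ1
      (z := fun i => z i - a i * h⁻¹) (a := fun i => a i * h⁻¹) (p := Q - p) (M := r * n)
      (w := fun i => (i.val : ℂ⟦X⟧) * (a i * h⁻¹) + PowerSeries.X * d⁄dX ℂ (a i) * h⁻¹)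
      (fun i => by rw [coeff_mul_range, Finset.sum_range_one, Nat.sub_zero, hi0, ha1, one_mul])
      (by rw [Finset.sum_sub_distrib, ← Finset.sum_mul, hsz, hsa, mul_assoc, hi, mul_one,
        sub_self])
      (fun i => by
        have e := haeq i
        have e2 : ∑ l, B i l * (z l - a l * h⁻¹) = ∑ l, B i l * z l - (∑ l, B i l * a l) * h⁻¹ := by
          simp only [mul_sub, Finset.sum_sub_distrib, Finset.sum_mul, mul_assoc]
        simp only [Matrix.add_apply, add_mul, Finset.sum_add_distrib, Matrix.diagonal_apply,
          ite_mul, zero_mul, Finset.sum_ite_eq, Finset.mem_univ, if_true] at e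
        rw [e2, map_zero, zero_mul, add_zero]
        linear_combination hQ i - h⁻¹ * e)
    intro m hm
    have := main.1 m hm
    rwa [map_sub, sub_eq_zero] at this

end Uniqueness

/-! ### From the definitions in `x` to the formal equation in `z` -/

section Bridge

open scoped PowerSeries

theorem jordanN_pow_apply (n k : ℕ) (i j : Fin n) :
    (jordanN n ^ k) i j = if j.val = i.val + k then 1 else 0 := by
  induction k generalizing i j with
  | zero =>
    rw [pow_zero, Matrix.one_apply, add_zero]
    exact if_congr ⟨fun h => by rw [h], fun h => Fin.ext h.symm⟩ rfl rfl
  | succ k ih =>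
    rw [pow_succ, Matrix.mul_apply]
    have h1 : ∀ l, jordanN n l j = if j.val = l.val + 1 then 1 else 0 := fun l => rfl
    simp only [ih, h1, ite_mul, one_mul, zero_mul]
    split_ifs with h
    · have hj := j.2
      rw [Finset.sum_eq_single ⟨i.val + k, by omega⟩]
      · rw [if_pos rfl, if_pos (by simp only; omega)]
      · intro l _ hl
        rw [if_neg fun h' => hl (Fin.ext h')]
      · simp
    · refine Finset.sum_eq_zero fun l _ => ?_
      split_ifs with h1 h2
      · omega
      · rfl
      · rfl

/-- The series `n z^{r-1} A(1/z)` of a polynomial connection with given coefficients. -/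
noncomputable def coeffSeries {R : Type*} [CommRing R] {n : ℕ} (r : ℕ)
    (a : ℕ → Matrix (Fin n) (Fin n) R) : Matrix (Fin n) (Fin n) R⟦X⟧ :=
  Matrix.of fun i j => PowerSeries.mk fun k => if k < r then (n : R) * a (r - 1 - k) i j else 0

/-- The series `n z^{r-1} A(1/z)`. -/
noncomputable def connSeries {n : ℕ} (r : ℕ) (A : Matrix (Fin n) (Fin n) ℂ[X]) :
    Matrix (Fin n) (Fin n) ℂ⟦X⟧ :=
  coeffSeries r fun k => A.map fun f => f.coeff k

theorem coeff_connSeries {n : ℕ} (r : ℕ) (A : Matrix (Fin n) (Fin n) ℂ[X]) (i j : Fin n) (k : ℕ) :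
    PowerSeries.coeff k (connSeries r A i j) =
      if k < r then (n : ℂ) * (A i j).coeff (r - 1 - k) else 0 := by
  rw [connSeries, coeffSeries, Matrix.of_apply, PowerSeries.coeff_mk]
  rfl

/-- The power series `n t₀ z^r + ∑ t_J s^{rn - J}`. -/
noncomputable def normalForm (n r : ℕ) (t0 : ℂ) (t : Fin (r * n) → ℂ) : ℂ⟦X⟧ :=
  PowerSeries.mk fun m => if m = r * n then n * t0 else time t (r * n - m)

theorem time_zero {n r : ℕ} (t : Fin (r * n) → ℂ) : time t 0 = 0 := by
  rw [time, dif_neg (by omega)]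

theorem coeff_normalForm_of_lt {n r : ℕ} (t0 : ℂ) (t : Fin (r * n) → ℂ) {k : ℕ}
    (hk : r * n < k) : PowerSeries.coeff k (normalForm n r t0 t) = 0 := by
  rw [normalForm, PowerSeries.coeff_mk, if_neg (by omega), Nat.sub_eq_zero_of_le hk.le, time_zero]

theorem normalForm_injective {n r : ℕ} (hn : n ≠ 0) {t0 t0' : ℂ} {t t' : Fin (r * n) → ℂ}
    (h : normalForm n r t0 t = normalForm n r t0' t') : t0 = t0' ∧ t = t' := by
  have hc := fun k => congrArg (PowerSeries.coeff k) h
  simp only [normalForm, PowerSeries.coeff_mk] at hc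
  constructor
  · have := hc (r * n)
    simp only [if_true] at this
    exact mul_left_cancel₀ (by exact_mod_cast hn) this
  · ext i
    have hi := i.2
    have := hc (r * n - (i.val + 1))
    rw [if_neg (by omega), if_neg (by omega), show r * n - (r * n - (i.val + 1)) = i.val + 1 by omega,
      time, time, dif_pos (by omega), dif_pos (by omega)] at this
    exact this

theorem exists_normalForm_eq {n r : ℕ} (hn : n ≠ 0) {p : ℂ⟦X⟧}
    (hp : ∀ k, r * n < k → PowerSeries.coeff k p = 0) :
    ∃ t0 t, normalForm n r t0 t = p := by
  refine ⟨(n : ℂ)⁻¹ * PowerSeries.coeff (r * n) p,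
    fun i => PowerSeries.coeff (r * n - (i.val + 1)) p, ?_⟩
  have hnc : (n : ℂ) ≠ 0 := by exact_mod_cast hn
  ext k
  rw [normalForm, PowerSeries.coeff_mk]
  split_ifs with h
  · rw [h, mul_inv_cancel_left₀ hnc]
  · rw [time]
    split_ifs with h1
    · congr 1; congr 1; simp only; omega
    · exact (hp k (by omega)).symm

/-- Power series in `z` as Laurent series. -/
noncomputable abbrev toLaurent : ℂ⟦X⟧ →+* LaurentSeries ℂ := HahnSeries.ofPowerSeries ℤ ℂ

theorem toLaurent_injective : Function.Injective toLaurent := HahnSeries.ofPowerSeries_injective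

theorem toLaurent_X_pow (k : ℕ) :
    toLaurent (PowerSeries.X ^ k) = HahnSeries.single (k : ℤ) (1 : ℂ) := by
  rw [HahnSeries.ofPowerSeries_X_pow]

theorem toLaurent_mapMatrix_injective {n : ℕ} {Y Y' : Matrix (Fin n) (Fin n) ℂ⟦X⟧}
    (h : toLaurent.mapMatrix Y = toLaurent.mapMatrix Y') : Y = Y' := by
  ext1 i j
  exact toLaurent_injective (congrFun (congrFun h i) j)

theorem single_mul_substInvPow {m : ℕ} (hm : m ≠ 0) {D : ℕ} {f : ℂ[X]} (hf : f.natDegree ≤ D) :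
    HahnSeries.single ((m : ℤ) * D) (1 : ℂ) * substInvPow m f =
      toLaurent (PowerSeries.expand m hm
        (PowerSeries.mk fun k => if k ≤ D then f.coeff (D - k) else 0)) := by
  have h1 : (PowerSeries.mk fun k => if k ≤ D then f.coeff (D - k) else 0 : ℂ⟦X⟧) =
      ∑ k ∈ Finset.range (D + 1), PowerSeries.C (f.coeff k) * PowerSeries.X ^ (D - k) := by
    ext e
    rw [PowerSeries.coeff_mk, map_sum]
    simp only [PowerSeries.coeff_C_mul, PowerSeries.coeff_X_pow, mul_ite, mul_one, mul_zero]
    split_ifs with h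
    · rw [Finset.sum_eq_single (D - e)]
      · rw [if_pos (by omega)]
      · intro k hk hke
        rw [if_neg]
        have := Finset.mem_range.1 hk
        omega
      · intro hk
        exact absurd (Finset.mem_range.2 (by omega)) hk
    · refine (Finset.sum_eq_zero fun k hk => ?_).symm
      rw [if_neg]
      omega
  rw [h1, substInvPow, Polynomial.aeval_eq_sum_range' (Nat.lt_succ_of_le hf), map_sum, map_sum,
    Finset.mul_sum]
  refine Finset.sum_congr rfl fun k hk => ?_
  have hkD : k ≤ D := by have := Finset.mem_range.1 hk; omega
  rw [map_mul, PowerSeries.expand_C, map_pow, PowerSeries.expand_X, ← pow_mul, map_mul,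
    HahnSeries.ofPowerSeries_C, HahnSeries.ofPowerSeries_X_pow, HahnSeries.single_pow, one_pow,
    Algebra.smul_def, LaurentSeries.algebraMap_apply, mul_left_comm, HahnSeries.single_mul_single, mul_one]
  congr 2
  rw [smul_neg, nsmul_eq_mul]
  push_cast [Nat.cast_sub hkD]
  ring_nf

theorem single_mul_substInvPow_eq {n : ℕ} (r : ℕ) {m : ℕ} (hm : m ≠ 0)
    {A : Matrix (Fin n) (Fin n) ℂ[X]} (hr : 1 ≤ r) {i j : Fin n} (hA : (A i j).degree < r) :
    HahnSeries.single ((m : ℤ) * (r - 1)) (n : ℂ) * substInvPow m (A i j) =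
      toLaurent (PowerSeries.expand m hm (connSeries r A i j)) := by
  have hd : (A i j).natDegree ≤ r - 1 := by
    refine Polynomial.natDegree_le_iff_coeff_eq_zero.2 fun k hk => ?_
    exact Polynomial.coeff_eq_zero_of_degree_lt (hA.trans_le (by exact_mod_cast (by omega : r ≤ k)))
  have h1 : connSeries r A i j = PowerSeries.C (n : ℂ) *
      PowerSeries.mk fun k => if k ≤ r - 1 then (A i j).coeff (r - 1 - k) else 0 := by
    ext k
    rw [coeff_connSeries, PowerSeries.coeff_C_mul, PowerSeries.coeff_mk, mul_ite, mul_zero]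
    exact if_congr (by omega) rfl rfl
  rw [h1, map_mul, map_mul, ← single_mul_substInvPow hm hd, PowerSeries.expand_C,
    HahnSeries.ofPowerSeries_C, ← mul_assoc, HahnSeries.C_apply, HahnSeries.single_mul_single,
    zero_add, mul_one, Nat.cast_sub hr, Nat.cast_one]

theorem laurent_smul_mul {n : ℕ} (c : LaurentSeries ℂ)
    (M N : Matrix (Fin n) (Fin n) (LaurentSeries ℂ)) : c • M * N = c • (M * N) := by
  ext1 i j
  simp only [Matrix.mul_apply, Matrix.smul_apply, smul_eq_mul, Finset.mul_sum, mul_assoc]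

theorem laurent_mul_smul {n : ℕ} (c : LaurentSeries ℂ)
    (M N : Matrix (Fin n) (Fin n) (LaurentSeries ℂ)) : M * c • N = c • (M * N) := by
  ext1 i j
  simp only [Matrix.mul_apply, Matrix.smul_apply, smul_eq_mul, Finset.mul_sum, mul_left_comm]

theorem laurent_smul_smul {n : ℕ} (c d : LaurentSeries ℂ)
    (M : Matrix (Fin n) (Fin n) (LaurentSeries ℂ)) : c • d • M = (c * d) • M := by
  ext1 i j
  simp only [Matrix.smul_apply, smul_eq_mul, mul_assoc]

theorem laurent_smul_add {n : ℕ} (c : LaurentSeries ℂ)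
    (M N : Matrix (Fin n) (Fin n) (LaurentSeries ℂ)) : c • (M + N) = c • M + c • N :=
  smul_add c M N

theorem laurent_smul_comm {n : ℕ} (c d : LaurentSeries ℂ)
    (M : Matrix (Fin n) (Fin n) (LaurentSeries ℂ)) : c • d • M = d • c • M := by
  rw [laurent_smul_smul, laurent_smul_smul, mul_comm]

theorem seriesAtInfty_eq {n : ℕ} (Y : Matrix (Fin n) (Fin n) ℂ⟦X⟧) :
    seriesAtInfty Y = toLaurent.mapMatrix Y := rfl

theorem substInvPow_one_X : substInvPow 1 X = HahnSeries.single (-1 : ℤ) (1 : ℂ) := by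
  rw [substInvPow, Polynomial.aeval_X]; rfl

theorem single_smul_polyAtInfty {n : ℕ} {r : ℕ} (hr : 1 ≤ r) {A : Matrix (Fin n) (Fin n) ℂ[X]}
    (hA : ∀ i j, (A i j).degree < r) :
    (HahnSeries.single ((r : ℤ) - 1) (n : ℂ) : LaurentSeries ℂ) • polyAtInfty A =
      seriesAtInfty (connSeries r A) := by
  ext1 i j
  have := single_mul_substInvPow_eq r one_ne_zero hr (hA i j)
  rw [PowerSeries.expand_one_apply, Nat.cast_one, one_mul] at this
  exact this

theorem shiftW_mul_matH (n : ℕ) :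
    seriesAtInfty (shiftW n ℂ) * polyAtInfty (matH n) = 1 := by
  ext1 i j
  have hi := i.2
  have hj := j.2
  have hv := val_finRotate i
  rw [Matrix.mul_apply, Finset.sum_eq_single (finRotate n i)]
  · simp only [seriesAtInfty, polyAtInfty, Matrix.map_apply, shiftW, matH, Matrix.of_apply, if_true]
    by_cases h : i.val + 1 = n
    · rw [h, Nat.mod_self] at hv
      rw [if_pos h, if_neg (by omega), HahnSeries.ofPowerSeries_X, Matrix.one_apply]
      by_cases hij : i = j
      · rw [if_pos hij, if_pos ⟨hv, by rw [← hij, h]⟩, substInvPow_one_X,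
          HahnSeries.single_mul_single]
        simp
      · rw [if_neg hij, if_neg fun h' => hij (Fin.ext (by omega)), map_zero, mul_zero]
    · rw [Nat.mod_eq_of_lt (by omega)] at hv
      rw [if_neg h, map_one, one_mul, Matrix.one_apply]
      by_cases hij : i = j
      · rw [if_pos hij, if_pos (by rw [hv, hij]), map_one]
      · rw [if_neg hij, if_neg fun h' => hij (Fin.ext (by omega)), if_neg (by omega), map_zero]
  · intro l _ hl
    simp only [seriesAtInfty, Matrix.map_apply, shiftW, Matrix.of_apply, if_neg hl, map_zero,
      zero_mul]
  · simp

/-- Only the part of the gauge-fixed form that drives the recursion is kept: `τ₀` on the diagonal,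
and one value `τ₁` both above the diagonal and, at the order `z`, in the lower left corner. -/
theorem IsGaugeFixed.isAdmissible {n r : ℕ} (hr : 2 ≤ r) {τ : ℕ → ℂ}
    {A : Matrix (Fin n) (Fin n) ℂ[X]} (hA : IsGaugeFixed n r τ A) :
    IsAdmissible (connSeries r A) (τ 0) (τ 1) := by
  have key : ∀ i j, PowerSeries.coeff 0 (connSeries r A i j) =
      ∑ k ∈ Finset.range n, if j.val = i.val + k then τ k else 0 := by
    intro i j
    have hnc : (n : ℂ) ≠ 0 := by exact_mod_cast i.pos.ne'
    have := congrFun (congrFun hA.leading i) j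
    rw [coeff_connSeries, if_pos (by omega), Nat.sub_zero]
    simp only [Matrix.map_apply, Matrix.smul_apply, Matrix.sum_apply, smul_eq_mul,
      jordanN_pow_apply, mul_ite, mul_one, mul_zero] at this
    rw [this, ← mul_assoc, mul_one_div_cancel hnc, one_mul]
  have hn : ∀ i j : Fin n, ∀ k, j.val = i.val + k →
      PowerSeries.coeff 0 (connSeries r A i j) = τ k := by
    intro i j k h
    have := j.2
    rw [key, Finset.sum_eq_single k]
    · rw [if_pos h]
    · intro l _ hl
      rw [if_neg (by omega)]
    · intro hk
      exact absurd (Finset.mem_range.2 (by omega)) hk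
  refine ⟨fun i j hij => ?_, fun i => hn i i 0 rfl, fun i j h => hn i j 1 h, fun i j hi hj => ?_⟩
  · rw [key]
    refine Finset.sum_eq_zero fun k _ => ?_
    rw [if_neg]
    rw [Fin.lt_def] at hij
    omega
  · have hnc : (n : ℂ) ≠ 0 := by exact_mod_cast i.pos.ne'
    rw [coeff_connSeries, if_pos (by omega), show r - 1 - 1 = r - 2 by omega,
      hA.corner i j hi hj, mul_div_cancel₀ _ hnc]

variable {n : ℕ} [NeZero n]

/-- Because `W^{rn} = z^r`, the factor `z^r` converts all the powers of `ℋ` in question into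
nonnegative powers of `W`. -/
theorem single_smul_matH_pow {r J : ℕ} (hJ : J ≤ r * n) :
    (HahnSeries.single (r : ℤ) (1 : ℂ) : LaurentSeries ℂ) • polyAtInfty (matH n) ^ J =
      seriesAtInfty (shiftW n ℂ ^ (r * n - J)) := by
  have h1 := pow_mul_pow_eq_one J (shiftW_mul_matH n)
  have h2 : seriesAtInfty (shiftW n ℂ ^ (r * n - J)) * seriesAtInfty (shiftW n ℂ) ^ J =
      (HahnSeries.single (r : ℤ) (1 : ℂ) : LaurentSeries ℂ) • 1 := by
    simp only [seriesAtInfty_eq]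
    rw [← map_pow, ← map_mul, ← pow_add, Nat.sub_add_cancel hJ, shiftW_pow_mul_card,
      ← toLaurent_X_pow]
    ext1 i j
    simp only [RingHom.mapMatrix_apply, Matrix.map_apply, Matrix.smul_apply, smul_eq_mul, map_mul,
      Matrix.one_apply]
    split_ifs <;> simp
  calc _ = ((HahnSeries.single (r : ℤ) (1 : ℂ) : LaurentSeries ℂ) • 1) *
        polyAtInfty (matH n) ^ J := by rw [laurent_smul_mul, one_mul]
    _ = _ := by rw [← h2, mul_assoc, h1, mul_one]

/-- Up to the grading term, `n z^r P` is a polynomial in `W`. The grading term passes to the other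
side of the formal equation, where it is the `Y G` of `gradDer`. -/
theorem single_smul_logDerivMatrix {r : ℕ} (t0 : ℂ) (t : Fin (r * n) → ℂ) :
    (HahnSeries.single (r : ℤ) (n : ℂ) : LaurentSeries ℂ) • polyAtInfty (logDerivMatrix n r t0 t) =
      seriesAtInfty (polyW n (r * n) (normalForm n r t0 t) -
        (PowerSeries.X ^ r : ℂ⟦X⟧) • gradG n ℂ) := by
  have hnc : (n : ℂ) ≠ 0 := by exact_mod_cast NeZero.ne n
  have hs : (HahnSeries.single (r : ℤ) (n : ℂ) : LaurentSeries ℂ) =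
      HahnSeries.C (n : ℂ) * HahnSeries.single (r : ℤ) (1 : ℂ) := by
    rw [HahnSeries.C_apply, HahnSeries.single_mul_single, zero_add, mul_one]
  have hW : polyW n (r * n) (normalForm n r t0 t) =
      (PowerSeries.C ((n : ℂ) * t0) * PowerSeries.X ^ r) • (1 : Matrix (Fin n) (Fin n) ℂ⟦X⟧) +
        ∑ J ∈ Finset.Icc 1 (r * n), PowerSeries.C (time t J) • shiftW n ℂ ^ (r * n - J) := by
    rw [polyW, Finset.sum_range_succ, add_comm]
    congr 1
    · rw [normalForm, PowerSeries.coeff_mk, if_pos rfl, shiftW_pow_mul_card, smul_smul]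
    · refine Finset.sum_bij' (fun m _ => r * n - m) (fun J _ => r * n - J) ?_ ?_ ?_ ?_ ?_
      · intro m hm; have := Finset.mem_range.1 hm; exact Finset.mem_Icc.2 ⟨by omega, by omega⟩
      · intro J hJ; have := Finset.mem_Icc.1 hJ; exact Finset.mem_range.2 (by omega)
      · intro m hm; have := Finset.mem_range.1 hm; omega
      · intro J hJ; have := Finset.mem_Icc.1 hJ; omega
      · intro m hm
        have := Finset.mem_range.1 hm
        rw [normalForm, PowerSeries.coeff_mk, if_neg (by omega),
          show r * n - (r * n - m) = m by omega]
  have hH : polyAtInfty (logDerivMatrix n r t0 t) =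
      (Matrix.diagonal fun k : Fin n => HahnSeries.C (t0 - (k.val : ℂ) / n)) +
        (HahnSeries.C (1 / n : ℂ) : LaurentSeries ℂ) • ∑ J ∈ Finset.Icc 1 (r * n),
          (HahnSeries.C (time t J) : LaurentSeries ℂ) • polyAtInfty (matH n) ^ J := by
    have hC : ∀ c : ℂ, substInvPow 1 (C c) = HahnSeries.C c := fun c => by
      rw [substInvPow, Polynomial.aeval_C, LaurentSeries.algebraMap_apply]
    have hpow : ∀ J, polyAtInfty (matH n) ^ J = polyAtInfty (matH n ^ J) := fun J =>
      (map_pow (substInvPow 1).toRingHom.mapMatrix (matH n) J).symm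
    simp only [hpow]
    ext1 i j
    simp only [logDerivMatrix, polyAtInfty, Matrix.map_apply, Matrix.add_apply, Matrix.smul_apply,
      Matrix.sum_apply, map_add, Polynomial.smul_eq_C_mul, map_mul, hC, map_sum,
      Matrix.diagonal_apply, smul_eq_mul]
    split_ifs with h
    · rw [hC]
    · rw [map_zero]
  have hS : seriesAtInfty (∑ J ∈ Finset.Icc 1 (r * n),
      PowerSeries.C (time t J) • shiftW n ℂ ^ (r * n - J)) =
      (HahnSeries.single (r : ℤ) (1 : ℂ) : LaurentSeries ℂ) • ∑ J ∈ Finset.Icc 1 (r * n),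
          (HahnSeries.C (time t J) : LaurentSeries ℂ) • polyAtInfty (matH n) ^ J := by
    rw [seriesAtInfty_eq, map_sum, Finset.smul_sum]
    refine Finset.sum_congr rfl fun J hJ => ?_
    rw [laurent_smul_comm, single_smul_matH_pow (Finset.mem_Icc.1 hJ).2]
    ext1 i j
    simp only [RingHom.mapMatrix_apply, Matrix.map_apply, Matrix.smul_apply, smul_eq_mul, map_mul,
      seriesAtInfty, HahnSeries.ofPowerSeries_C]
  have hone : HahnSeries.C (n : ℂ) * HahnSeries.single (r : ℤ) (1 : ℂ) * HahnSeries.C (1 / n : ℂ) =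
      HahnSeries.single (r : ℤ) (1 : ℂ) := by
    rw [HahnSeries.C_apply, HahnSeries.C_apply, HahnSeries.single_mul_single,
      HahnSeries.single_mul_single, zero_add, add_zero, mul_one, mul_one_div_cancel hnc]
  rw [hW, hH, seriesAtInfty_eq, map_sub, map_add, ← seriesAtInfty_eq (∑ J ∈ _, _), hS, hs, laurent_smul_add,
    laurent_smul_smul, hone, add_sub_right_comm]
  congr 1
  ext1 i j
  simp only [RingHom.mapMatrix_apply, Matrix.map_apply, Matrix.smul_apply, Matrix.sub_apply,
    smul_eq_mul, gradG, Matrix.diagonal_apply, Matrix.one_apply]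
  split_ifs with h
  · simp only [mul_one, map_mul, HahnSeries.ofPowerSeries_X_pow, HahnSeries.ofPowerSeries_C,
      map_natCast, map_sub]
    rw [← map_natCast (HahnSeries.C (Γ := ℤ) (R := ℂ)), mul_sub, map_div₀, map_natCast, map_natCast]
    have : (HahnSeries.C (Γ := ℤ) (n : ℂ)) ≠ 0 := HahnSeries.C_ne_zero hnc
    rw [map_natCast] at this
    field_simp
  · simp

/-- The equation is multiplied by `n z^{r-1}`, and `d/dx = -z² d/dz` supplies the term `-n z^r (z
dY/dz)`. After this step the bare solution plays no role. -/
theorem isFormalSolution_iff {r : ℕ} (hr : 1 ≤ r) {A : Matrix (Fin n) (Fin n) ℂ[X]}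
    (hA : ∀ i j, (A i j).degree < r) (t0 : ℂ) (t : Fin (r * n) → ℂ)
    (Y : Matrix (Fin n) (Fin n) ℂ⟦X⟧) :
    IsFormalSolution n r A t0 t Y ↔
      IsUnipotentGauge Y ∧ FormalEq r (connSeries r A) Y (normalForm n r t0 t) := by
  have hnc : (n : ℂ) ≠ 0 := by exact_mod_cast NeZero.ne n
  have h1 : (∀ i j : Fin n, j ≤ i → casimirU Y i j = 0) ↔ IsUnipotentGauge Y := by
    refine forall_congr' fun i => forall_congr' fun j => forall_congr' fun _ => ?_
    rw [casimirU, valueAtInfty, Matrix.sub_apply, Matrix.map_apply, sub_eq_zero, Matrix.one_apply,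
      PowerSeries.coeff_zero_eq_constantCoeff_apply]
    simp only [eq_comm]
  have h2 : (seriesAtInfty (dxSeries Y) + (HahnSeries.single (1 : ℤ) (1 : ℂ) : LaurentSeries ℂ) •
      (seriesAtInfty Y * polyAtInfty (logDerivMatrix n r t0 t)) =
        polyAtInfty A * seriesAtInfty Y) ↔
      FormalEq r (connSeries r A) Y (normalForm n r t0 t) := by
    set c : LaurentSeries ℂ := HahnSeries.single ((r : ℤ) - 1) (n : ℂ) with hc
    have hc0 : c ≠ 0 := by simpa [hc] using hnc
    have hcinj : Function.Injective fun M : Matrix (Fin n) (Fin n) (LaurentSeries ℂ) => c • M := by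
      intro M M' h
      ext1 i j
      exact mul_left_cancel₀ hc0 (congrFun (congrFun h i) j)
    have e1 : c • (polyAtInfty A * seriesAtInfty Y) =
        seriesAtInfty (connSeries r A * Y) := by
      rw [← laurent_smul_mul, hc, single_smul_polyAtInfty hr hA]
      exact (map_mul toLaurent.mapMatrix _ _).symm
    have e2 : c • (seriesAtInfty (dxSeries Y)) = seriesAtInfty
        (-((PowerSeries.X ^ r : ℂ⟦X⟧) • (n : ℂ⟦X⟧) • euler Y)) := by
      ext1 i j
      simp only [seriesAtInfty, dxSeries, euler, Matrix.map_apply, Matrix.smul_apply, smul_eq_mul,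
        Matrix.neg_apply]
      have : c = toLaurent (PowerSeries.X ^ (r - 1) * (n : ℂ⟦X⟧)) := by
        rw [hc, ← map_natCast (PowerSeries.C (R := ℂ)), map_mul, toLaurent_X_pow, Nat.cast_sub hr,
          Nat.cast_one, HahnSeries.ofPowerSeries_C, HahnSeries.C_apply,
          HahnSeries.single_mul_single, one_mul, add_zero]
      rw [this]
      change toLaurent _ * toLaurent _ = toLaurent _
      rw [← map_mul]
      congr 1
      obtain ⟨k, rfl⟩ : ∃ k, r = k + 1 := ⟨r - 1, by omega⟩
      change _ = -(PowerSeries.X ^ (k + 1) * ((n : ℂ⟦X⟧) * (PowerSeries.X *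
        PowerSeries.derivative ℂ (Y i j))))
      rw [Nat.add_sub_cancel]
      ring
    have e3 : c • ((HahnSeries.single (1 : ℤ) (1 : ℂ) : LaurentSeries ℂ) •
        (seriesAtInfty Y * polyAtInfty (logDerivMatrix n r t0 t))) =
        seriesAtInfty (Y * (polyW n (r * n) (normalForm n r t0 t) -
          (PowerSeries.X ^ r : ℂ⟦X⟧) • gradG n ℂ)) := by
      rw [laurent_smul_smul, hc, HahnSeries.single_mul_single, mul_one, sub_add_cancel, ← laurent_mul_smul,
        single_smul_logDerivMatrix]
      exact (map_mul toLaurent.mapMatrix _ _).symm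
    rw [← hcinj.eq_iff]
    change c • _ = c • _ ↔ _
    rw [laurent_smul_add, e1, e2, e3, seriesAtInfty_eq, seriesAtInfty_eq, seriesAtInfty_eq, ← map_add]
    constructor
    · intro h
      have := toLaurent_mapMatrix_injective h
      rw [FormalEq, ← this, gradDer, smul_add, mul_sub, mul_smul_comm]
      abel
    · intro h
      congr 1
      rw [FormalEq, gradDer, smul_add] at h
      rw [mul_sub, ← h, mul_smul_comm]
      abel
  constructor
  · rintro ⟨hs, P, hP, he⟩
    rw [eq_logDerivMatrix hP] at he
    exact ⟨h1.1 hs, h2.1 he⟩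
  · rintro ⟨hs, he⟩
    exact ⟨h1.2 hs, _, hasLogDeriv_bareSolution n r t0 t, h2.2 he⟩

end Bridge

set_option linter.unusedSectionVars false

/-! ### Puiseux eigenvalues and the first times -/

section Spectral

open scoped PowerSeries

theorem isRoot_charpoly_iff {n : ℕ} {K : Type*} [CommRing K] [IsDomain K]
    (M : Matrix (Fin n) (Fin n) K) (y : K) :
    M.charpoly.IsRoot y ↔ ∃ v : Fin n → K, v ≠ 0 ∧ ∀ i, ∑ l, M i l * v l = y * v i := by
  rw [Polynomial.IsRoot, Matrix.eval_charpoly, ← Matrix.exists_mulVec_eq_zero_iff]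
  refine exists_congr fun v => and_congr_right fun _ => ?_
  rw [Matrix.sub_mulVec, sub_eq_zero, funext_iff]
  refine forall_congr' fun i => ?_
  rw [Matrix.scalar_apply, Matrix.mulVec_diagonal, eq_comm]
  rfl

theorem mem_of_isRoot_charpoly {n : ℕ} {K : Type*} [CommRing K] [IsDomain K]
    {M : Matrix (Fin n) (Fin n) K} {S : Finset K} (hS : S.card = n)
    (h : ∀ y ∈ S, M.charpoly.IsRoot y) {y : K} (hy : M.charpoly.IsRoot y) : y ∈ S := by
  classical
  by_contra hyS
  have h0 := (Matrix.charpoly_monic M).ne_zero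
  have := Polynomial.card_le_degree_of_subset_roots (p := M.charpoly) (Z := insert y S)
    (fun x hx => by
      rw [Polynomial.mem_roots h0]
      rcases Finset.mem_insert.1 hx with rfl | hx
      · exact hy
      · exact h x hx)
  rw [Finset.card_insert_of_notMem hyS, Matrix.charpoly_natDegree_eq_dim, Fintype.card_fin] at this
  omega

theorem rescale_expand {n : ℕ} (hn : n ≠ 0) {ζ : ℂ} (hζ : ζ ^ n = 1) (f : ℂ⟦X⟧) :
    PowerSeries.rescale ζ (PowerSeries.expand n hn f) = PowerSeries.expand n hn f := by
  ext k
  rw [PowerSeries.coeff_rescale, PowerSeries.coeff_expand]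
  split_ifs with h
  · obtain ⟨m, rfl⟩ := h
    rw [pow_mul, hζ, one_pow, one_mul]
  · rw [mul_zero]

variable {n : ℕ} [NeZero n]

/-- The eigenvalues of `Â(sⁿ)` are conjugate under the roots of unity. -/
theorem exists_rescale_of_isRoot {Â : Matrix (Fin n) (Fin n) ℂ⟦X⟧} {Φ : Fin n → ℂ⟦X⟧} {Q : ℂ⟦X⟧}
    (hΦ : Φ ≠ 0)
    (hQ : ∀ i, ∑ l, PowerSeries.expand n (NeZero.ne n) (Â i l) * Φ l = Q * Φ i)
    (hQ1 : PowerSeries.coeff 1 Q ≠ 0) {y : LaurentSeries ℂ}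
    (hy : (Matrix.of fun i j => toLaurent
      (PowerSeries.expand n (NeZero.ne n) (Â i j))).charpoly.IsRoot y) :
    ∃ ζ : ℂ, ζ ^ n = 1 ∧ y = toLaurent (PowerSeries.rescale ζ Q) := by
  classical
  -- The conjugates `Q(ζ s)` under the `n`-th roots of unity are distinct because the linear
  -- coefficient of `Q` is not zero; being `n` in number, they are the whole spectrum.
  have hinj : Function.Injective fun ζ : ℂ => toLaurent (PowerSeries.rescale ζ Q) := by
    intro ζ ζ' h
    have := congrArg (PowerSeries.coeff 1) (toLaurent_injective h)
    rw [PowerSeries.coeff_rescale, PowerSeries.coeff_rescale, pow_one, pow_one] at this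
    exact mul_right_cancel₀ hQ1 this
  have hmem : y ∈ (Polynomial.nthRootsFinset n (1 : ℂ)).image
      fun ζ : ℂ => toLaurent (PowerSeries.rescale ζ Q) := by
    refine mem_of_isRoot_charpoly ?_ ?_ hy
    · rw [Finset.card_image_of_injective _ hinj,
        (Complex.isPrimitiveRoot_exp n (NeZero.ne n)).card_nthRootsFinset]
    · intro x hx
      obtain ⟨ζ, hζ, rfl⟩ := Finset.mem_image.1 hx
      rw [Polynomial.mem_nthRootsFinset (NeZero.pos n)] at hζ
      have hζ0 : ζ ≠ 0 := fun h => by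
        rw [h, zero_pow (NeZero.ne n)] at hζ
        exact zero_ne_one hζ
      refine (isRoot_charpoly_iff _ _).2 ⟨fun i => toLaurent (PowerSeries.rescale ζ (Φ i)),
        fun h => hΦ (funext fun i => ?_), fun i => ?_⟩
      · refine PowerSeries.rescale_injective hζ0 (toLaurent_injective ?_)
        rw [Pi.zero_apply, map_zero, map_zero]
        exact congrFun h i
      · simp only [Matrix.of_apply]
        rw [← map_mul, ← map_mul, ← hQ, map_sum, map_sum]
        simp only [map_mul, rescale_expand _ hζ]
  obtain ⟨ζ, hζ, rfl⟩ := Finset.mem_image.1 hmem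
  exact ⟨ζ, (Polynomial.mem_nthRootsFinset (NeZero.pos n) _).1 hζ, rfl⟩

/-- The factor relating the eigenvalues of `A(s⁻ⁿ)` and those of `Â(sⁿ)`. -/
noncomputable def eigenScale (n r : ℕ) : LaurentSeries ℂ :=
  HahnSeries.single ((n : ℤ) * (r - 1)) (n : ℂ)

theorem coeff_eigenScale_mul {r : ℕ} (y : LaurentSeries ℂ) (k : ℤ) :
    (eigenScale n r * y).coeff k = n * y.coeff (k - n * (r - 1)) := by
  have := HahnSeries.coeff_single_mul_add (r := (n : ℂ)) (x := y) (a := k - n * (r - 1))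
    (b := (n : ℤ) * (r - 1))
  rwa [sub_add_cancel] at this

theorem eigenScale_ne_zero {r : ℕ} : eigenScale n r ≠ 0 := by
  have hnc : (n : ℂ) ≠ 0 := by exact_mod_cast NeZero.ne n
  simpa [eigenScale] using hnc

theorem isRoot_charpoly_map_iff {r : ℕ} (hr : 1 ≤ r) {A : Matrix (Fin n) (Fin n) ℂ[X]}
    (hA : ∀ i j, (A i j).degree < r) (y : LaurentSeries ℂ) :
    (A.map (substInvPow n)).charpoly.IsRoot y ↔
      (Matrix.of fun i j => toLaurent (PowerSeries.expand n (NeZero.ne n)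
        (connSeries r A i j))).charpoly.IsRoot (eigenScale n r * y) := by
  rw [isRoot_charpoly_iff, isRoot_charpoly_iff]
  refine exists_congr fun v => and_congr_right fun _ => forall_congr' fun i => ?_
  simp only [Matrix.of_apply, Matrix.map_apply,
    ← single_mul_substInvPow_eq r (NeZero.ne n) hr (hA i _)]
  rw [← mul_right_inj' (eigenScale_ne_zero (n := n) (r := r)), Finset.mul_sum]
  simp only [eigenScale, mul_assoc]

theorem coeff_toLaurent (f : ℂ⟦X⟧) (k : ℕ) : (toLaurent f).coeff k = PowerSeries.coeff k f :=
  LaurentSeries.coeff_coe_powerSeries f k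

theorem time_eq_coeff_normalForm {r : ℕ} (t0 : ℂ) (t : Fin (r * n) → ℂ) {j : ℕ}
    (hj : j ≠ r * n) : time t (r * n - j) = PowerSeries.coeff j (normalForm n r t0 t) := by
  rw [normalForm, PowerSeries.coeff_mk, if_neg hj]

theorem two_le_mul_card {r : ℕ} (hr : 2 ≤ r) : 2 ≤ r * n :=
  hr.trans (Nat.le_mul_of_pos_right r (NeZero.pos n))

/-- The prescribed Puiseux branch is `Q(ζ s)` for some root of unity `ζ`, where `Q` agrees with the
normal form below the order `rn`. The corner condition gives `t_{rn-1} = τ₁` whatever the branch,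
and the comparison of the linear coefficients then forces `ζ = 1`. For `n = 1` only the constant
coefficient has to be compared. -/
theorem IsGaugeFixed.time_eq {r : ℕ} (hr : 2 ≤ r) {τ : ℕ → ℂ} {A : Matrix (Fin n) (Fin n) ℂ[X]}
    (hA : IsGaugeFixed n r τ A) {t0 : ℂ} {t : Fin (r * n) → ℂ} {Y : Matrix (Fin n) (Fin n) ℂ⟦X⟧}
    (hY : IsFormalSolution n r A t0 t Y) :
    (∀ j < n, time t (r * n - j) = τ j) ∧ time t (r * n - 1) = τ 1 := by
  have hnc : (n : ℂ) ≠ 0 := by exact_mod_cast NeZero.ne n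
  have hN := two_le_mul_card (n := n) hr
  have hnN : n < r * n := by
    have := Nat.mul_le_mul_right n hr
    have := NeZero.pos n
    omega
  obtain ⟨hU, hE⟩ := (isFormalSolution_iff (by omega) hA.degree_lt t0 t Y).1 hY
  obtain ⟨Φ, Q, hΦ, hQ, hQ1, hQp⟩ := exists_eigenvector (hA.isAdmissible hr) hA.lidskii_ne_zero hN
    (fun k hk => coeff_normalForm_of_lt t0 t hk) hU hE
  have ht1 : time t (r * n - 1) = τ 1 := by
    rw [time_eq_coeff_normalForm t0 t (by omega), ← hQp 1 (by omega), hQ1]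
  obtain ⟨y, hy, -, hyc⟩ := hA.eigenvalue
  obtain ⟨ζ, hζ, hyζ⟩ := exists_rescale_of_isRoot hΦ hQ (by rw [hQ1]; exact hA.lidskii_ne_zero)
    ((isRoot_charpoly_map_iff (by omega) hA.degree_lt y).1 hy)
  have hc : ∀ j < n, ζ ^ j * time t (r * n - j) = τ j := by
    intro j hj
    have := coeff_eigenScale_mul (n := n) (r := r) y j
    rw [hyζ, coeff_toLaurent, hyc j hj, mul_div_cancel₀ _ hnc, PowerSeries.coeff_rescale,
      hQp j (by omega), ← time_eq_coeff_normalForm t0 t (by omega)] at this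
    exact this
  refine ⟨fun j hj => ?_, ht1⟩
  have hζ1 : ζ = 1 ∨ n = 1 := by
    by_cases h1 : n = 1
    · exact Or.inr h1
    · left
      have := hc 1 (by have := NeZero.pos n; omega)
      rw [pow_one, ht1] at this
      exact mul_right_cancel₀ hA.lidskii_ne_zero (this.trans (one_mul _).symm)
  rcases hζ1 with rfl | h1
  · rw [← hc j hj, one_pow, one_mul]
  · rw [← hc j hj, show j = 0 by omega, pow_zero, one_mul]

/-- An eigenvalue with the Puiseux expansion prescribed by the times. -/
theorem exists_eigenvalue_of_formalEq {r : ℕ} (hr : 2 ≤ r) {A : Matrix (Fin n) (Fin n) ℂ[X]}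
    (hd : ∀ i j, (A i j).degree < r) {β₀ β₁ : ℂ} (hA : IsAdmissible (connSeries r A) β₀ β₁)
    (hβ : β₁ ≠ 0) {p : ℂ⟦X⟧} (hp : ∀ k, r * n < k → PowerSeries.coeff k p = 0)
    {Y : Matrix (Fin n) (Fin n) ℂ⟦X⟧} (hU : IsUnipotentGauge Y)
    (hE : FormalEq r (connSeries r A) Y p) :
    PowerSeries.coeff 1 p = β₁ ∧ ∃ y : LaurentSeries ℂ,
    (A.map (substInvPow n)).charpoly.IsRoot y ∧
    (∀ k : ℤ, k < -((n : ℤ) * (r - 1)) → y.coeff k = 0) ∧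
    ∀ j : ℕ, j < n → y.coeff (j - (n : ℤ) * (r - 1)) = PowerSeries.coeff j p / n := by
  have hnc : (n : ℂ) ≠ 0 := by exact_mod_cast NeZero.ne n
  have hN := two_le_mul_card (n := n) hr
  have hnN : n < r * n := by
    have := Nat.mul_le_mul_right n hr
    have := NeZero.pos n
    omega
  obtain ⟨Φ, Q, hΦ, hQ, hQ1, hQp⟩ := exists_eigenvector hA hβ hN hp hU hE
  have hc : ∀ k : ℤ, ((eigenScale n r)⁻¹ * toLaurent Q).coeff (k - (n : ℤ) * (r - 1)) =
      (toLaurent Q).coeff k / n := by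
    intro k
    rw [eq_div_iff hnc, mul_comm, ← coeff_eigenScale_mul, mul_inv_cancel_left₀ eigenScale_ne_zero]
  refine ⟨by rw [← hQp 1 (by omega), hQ1], (eigenScale n r)⁻¹ * toLaurent Q, ?_, fun k hk => ?_,
    fun j hj => ?_⟩
  · rw [isRoot_charpoly_map_iff (by omega) hd, mul_inv_cancel_left₀ eigenScale_ne_zero,
      isRoot_charpoly_iff]
    refine ⟨fun i => toLaurent (Φ i), fun h => hΦ (funext fun i => toLaurent_injective ?_),
      fun i => ?_⟩
    · rw [Pi.zero_apply, map_zero]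
      exact congrFun h i
    · simp only [Matrix.of_apply]
      rw [← map_mul toLaurent Q, ← hQ, map_sum]
      simp only [map_mul]
  · have := hc (k + n * (r - 1))
    rw [add_sub_cancel_right] at this
    rw [this, PowerSeries.coeff_coe, if_pos (by omega), zero_div]
  · rw [hc, coeff_toLaurent, hQp j (by omega)]

end Spectral

/-! ### The constant term of the gauge commutes with `𝒩` -/

section Commutation

open scoped PowerSeries

/-- An element which commutes with `f(N)`, `N` nilpotent and `f'(0) ≠ 0`, commutes with `N`. -/
theorem commute_of_commute_aeval {R : Type*} [Ring R] [Algebra ℂ R] {N Y : R} {m : ℕ}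
    (hN : N ^ m = 0) {f : ℂ[X]} (hf : f.coeff 1 ≠ 0) (h : Commute Y (Polynomial.aeval N f)) :
    Commute Y N := by
  have h0 : Commute Y (Polynomial.aeval N (f.divX * X)) := by
    have : f.divX * X = f - C (f.coeff 0) := by
      rw [eq_sub_iff_add_eq, Polynomial.divX_mul_X_add]
    rw [this, map_sub, Polynomial.aeval_C]
    exact h.sub_right (Algebra.commutes _ _).symm
  -- Downward induction on the exponent: `(f(N) - f(0))^{k+1}` is `f'(0)^{k+1} N^{k+1}` up to higher
  -- powers of `N`, which already commute with `Y`.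
  have key : ∀ d k, d + k = m → ∀ l, k + 1 ≤ l → Commute Y (N ^ l) := by
    intro d
    induction d with
    | zero =>
      intro k hk l hl
      rw [show N ^ l = 0 from pow_eq_zero_of_le (by omega) hN]
      exact Commute.zero_right Y
    | succ d ih =>
      intro k hk l hl
      rcases hl.lt_or_eq with hl | rfl
      · exact ih (k + 1) (by omega) l (by omega)
      · obtain ⟨g, hg⟩ : X ∣ f.divX ^ (k + 1) - C (f.coeff 1) ^ (k + 1) := by
          refine (Polynomial.X_dvd_iff.2 ?_).trans (sub_dvd_pow_sub_pow _ _ _)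
          rw [Polynomial.coeff_sub, Polynomial.coeff_C_zero, Polynomial.coeff_divX, zero_add,
            sub_self]
        have h1 : C (f.coeff 1 ^ (k + 1)) * X ^ (k + 1) =
            (f.divX * X) ^ (k + 1) - X ^ (k + 1 + 1) * g := by
          rw [map_pow, mul_pow, pow_succ _ (k + 1)]
          linear_combination (-(X : ℂ[X]) ^ (k + 1)) * hg
        have h2 : Commute Y (Polynomial.aeval N (X ^ (k + 1 + 1) * g)) := by
          rw [g.as_sum_range, Finset.mul_sum, map_sum]
          refine Commute.sum_right _ _ _ fun i _ => ?_
          rw [← Polynomial.C_mul_X_pow_eq_monomial, mul_left_comm, ← pow_add, map_mul,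
            Polynomial.aeval_C, map_pow, Polynomial.aeval_X]
          exact Commute.mul_right (Algebra.commutes _ _).symm (ih (k + 1) (by omega) _ (by omega))
        have h3 : Commute Y (Polynomial.aeval N (C (f.coeff 1 ^ (k + 1)) * X ^ (k + 1))) := by
          rw [h1, map_sub, map_pow]
          exact (h0.pow_right _).sub_right h2
        rw [map_mul, Polynomial.aeval_C, map_pow (Polynomial.aeval N), Polynomial.aeval_X,
            ← Algebra.smul_def] at h3
        have := h3.smul_right (f.coeff 1 ^ (k + 1))⁻¹
        rwa [smul_smul, inv_mul_cancel₀ (pow_ne_zero _ hf), one_smul] at this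
  simpa using key m 0 (by omega) 1 (by omega)

/-- The constant terms of a matrix of power series. -/
noncomputable abbrev constTerm {n : ℕ} :
    Matrix (Fin n) (Fin n) ℂ⟦X⟧ →+* Matrix (Fin n) (Fin n) ℂ :=
  (PowerSeries.constantCoeff (R := ℂ)).mapMatrix

theorem constTerm_smul {n : ℕ} (f : ℂ⟦X⟧) (M : Matrix (Fin n) (Fin n) ℂ⟦X⟧) :
    constTerm (f • M) = PowerSeries.constantCoeff f • constTerm M := by
  ext1 i j
  simp

theorem jordanN_pow_card (n : ℕ) : jordanN n ^ n = 0 := by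
  ext1 i j
  rw [jordanN_pow_apply, if_neg (by omega), Matrix.zero_apply]

variable {n : ℕ} [NeZero n]

theorem constTerm_shiftW : constTerm (shiftW n ℂ) = jordanN n := by
  ext1 i j
  have hi := i.2
  have hj := j.2
  have hv := val_finRotate i
  simp only [RingHom.mapMatrix_apply, Matrix.map_apply, shiftW, jordanN, Matrix.of_apply]
  by_cases h : i.val + 1 = n
  · simp only [h, if_true]
    rw [show (if j.val = n then (1 : ℂ) else 0) = 0 from if_neg (by omega)]
    split_ifs <;> simp
  · rw [Nat.mod_eq_of_lt (by omega)] at hv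
    simp only [h, if_false, Fin.ext_iff, hv]
    split_ifs <;> simp

theorem constTerm_polyW {r : ℕ} (hr : 1 ≤ r) (p : ℂ⟦X⟧) :
    constTerm (polyW n (r * n) p) =
      ∑ m ∈ Finset.range n, PowerSeries.coeff m p • jordanN n ^ m := by
  have hnN : n ≤ r * n := Nat.le_mul_of_pos_left n hr
  rw [polyW, map_sum]
  refine Eq.trans ?_ (Finset.sum_subset (Finset.range_subset_range.2 (by omega : n ≤ r * n + 1))
    fun m _ hm => ?_).symm
  rotate_left
  · rw [show jordanN n ^ m = 0 from
      pow_eq_zero_of_le (by rw [Finset.mem_range] at hm; omega) (jordanN_pow_card n), smul_zero]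
  · refine Finset.sum_congr rfl fun m _ => ?_
    rw [constTerm_smul, map_pow, constTerm_shiftW, PowerSeries.constantCoeff_C]

/-- At `z = 0` the derivative term disappears, and `W` becomes the nilpotent block `𝒩`. -/
theorem FormalEq.constTerm_eq {r : ℕ} (hr : 1 ≤ r) {Â Y : Matrix (Fin n) (Fin n) ℂ⟦X⟧} {p : ℂ⟦X⟧}
    (h : FormalEq r Â Y p) :
    constTerm Â * constTerm Y = constTerm Y *
      ∑ m ∈ Finset.range n, PowerSeries.coeff m p • jordanN n ^ m := by
  have := congrArg constTerm h
  rw [map_add, map_mul, map_mul, constTerm_smul, map_pow, PowerSeries.constantCoeff_X,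
    zero_pow (by omega), zero_smul, add_zero, constTerm_polyW hr] at this
  exact this

theorem sum_smul_jordanN_pow_eq_aeval (c : ℕ → ℂ) :
    ∑ m ∈ Finset.range n, c m • jordanN n ^ m =
      Polynomial.aeval (jordanN n) (∑ m ∈ Finset.range n, Polynomial.monomial m (c m)) := by
  rw [map_sum]
  simp only [Polynomial.aeval_monomial, Algebra.smul_def]

theorem commute_jordanN_of_commute_sum {c : ℕ → ℂ} (hc : c 1 ≠ 0)
    {M : Matrix (Fin n) (Fin n) ℂ}
    (h : Commute M (∑ m ∈ Finset.range n, c m • jordanN n ^ m)) : Commute M (jordanN n) := by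
  by_cases h1 : n = 1
  · subst h1
    have := jordanN_pow_card 1
    rw [pow_one] at this
    rw [this]
    exact Commute.zero_right M
  · rw [sum_smul_jordanN_pow_eq_aeval] at h
    refine commute_of_commute_aeval (jordanN_pow_card n) ?_ h
    rw [Polynomial.finsetSum_coeff]
    simp only [Polynomial.coeff_monomial, Finset.sum_ite_eq', Finset.mem_range]
    rwa [if_pos (by have := NeZero.pos n; omega)]

theorem constTerm_connSeries {r : ℕ} (hr : 1 ≤ r) (A : Matrix (Fin n) (Fin n) ℂ[X]) :
    constTerm (connSeries r A) = (n : ℂ) • A.map fun p => p.coeff (r - 1) := by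
  ext1 i j
  rw [RingHom.mapMatrix_apply, Matrix.map_apply, ← PowerSeries.coeff_zero_eq_constantCoeff_apply,
    coeff_connSeries, if_pos (by omega)]
  rfl

/-- By `time_eq` the gauge-fixed `Â(0)` is the very polynomial in `𝒩` to which `1 + U` conjugates
it. So `1 + U` commutes with this polynomial, and its linear coefficient `τ₁` is not zero. -/
theorem IsGaugeFixed.commute_casimirU {r : ℕ} (hr : 2 ≤ r) {τ : ℕ → ℂ}
    {A : Matrix (Fin n) (Fin n) ℂ[X]}
    (hA : IsGaugeFixed n r τ A) {t0 : ℂ} {t : Fin (r * n) → ℂ} {Y : Matrix (Fin n) (Fin n) ℂ⟦X⟧}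
    (hY : IsFormalSolution n r A t0 t Y) : Commute (casimirU Y) (jordanN n) := by
  have hnc : (n : ℂ) ≠ 0 := by exact_mod_cast NeZero.ne n
  have hnN : n < r * n := by
    have := Nat.mul_le_mul_right n hr
    have := NeZero.pos n
    omega
  obtain ⟨hU, hE⟩ := (isFormalSolution_iff (by omega) hA.degree_lt t0 t Y).1 hY
  have h1 := hE.constTerm_eq (by omega)
  have h2 : ∑ m ∈ Finset.range n, PowerSeries.coeff m (normalForm n r t0 t) • jordanN n ^ m =
      ∑ m ∈ Finset.range n, τ m • jordanN n ^ m := by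
    refine Finset.sum_congr rfl fun m hm => ?_
    have := Finset.mem_range.1 hm
    rw [← (hA.time_eq hr hY).1 m this, ← time_eq_coeff_normalForm t0 t (by omega)]
  rw [h2, constTerm_connSeries (by omega), hA.leading, smul_smul, mul_one_div_cancel hnc, one_smul]
    at h1
  exact (commute_jordanN_of_commute_sum hA.lidskii_ne_zero h1.symm).sub_left (Commute.one_left _)

end Commutation

/-! ### Base change of the formal equation -/

section BaseChange

open scoped PowerSeries

variable {n : ℕ} {R R' : Type*} [CommRing R] [CommRing R']

/-- Base change of matrices of power series. -/
noncomputable abbrev mapSeries (φ : R →+* R') :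
    Matrix (Fin n) (Fin n) R⟦X⟧ →+* Matrix (Fin n) (Fin n) R'⟦X⟧ :=
  (PowerSeries.map φ).mapMatrix

theorem mapSeries_smul (φ : R →+* R') (f : R⟦X⟧) (M : Matrix (Fin n) (Fin n) R⟦X⟧) :
    mapSeries φ (f • M) = PowerSeries.map φ f • mapSeries φ M := by
  ext1 i j
  simp

theorem mapSeries_shiftW (φ : R →+* R') : mapSeries φ (shiftW n R) = shiftW n R' := by
  ext1 i j
  simp only [RingHom.mapMatrix_apply, Matrix.map_apply, shiftW, Matrix.of_apply]
  split_ifs <;> simp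

theorem mapSeries_gradDer (φ : R →+* R') (Y : Matrix (Fin n) (Fin n) R⟦X⟧) :
    mapSeries φ (gradDer Y) = gradDer (mapSeries φ Y) := by
  have h1 : mapSeries φ (gradG n R) = gradG n R' := by
    ext1 i j
    simp only [RingHom.mapMatrix_apply, Matrix.map_apply, gradG, Matrix.diagonal_apply]
    split_ifs <;> simp
  have h2 : mapSeries φ (euler Y) = euler (mapSeries φ Y) := by
    ext1 i j
    ext k
    simp only [RingHom.mapMatrix_apply, Matrix.map_apply, euler]
    rw [PowerSeries.coeff_map, coeff_X_mul_derivative, coeff_X_mul_derivative,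
      PowerSeries.coeff_map, map_mul, map_natCast]
  rw [gradDer, map_add, mapSeries_smul, map_mul, h1, h2, map_natCast, gradDer]

theorem mapSeries_polyW (φ : R →+* R') (N : ℕ) (p : R⟦X⟧) :
    mapSeries φ (polyW n N p) = polyW n N (PowerSeries.map φ p) := by
  rw [polyW, map_sum]
  refine Finset.sum_congr rfl fun m _ => ?_
  rw [mapSeries_smul, map_pow, mapSeries_shiftW, PowerSeries.map_C, PowerSeries.coeff_map]

theorem FormalEq.map (φ : R →+* R') {r : ℕ} {Â Y : Matrix (Fin n) (Fin n) R⟦X⟧} {p : R⟦X⟧}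
    (h : FormalEq r Â Y p) :
    FormalEq r (mapSeries φ Â) (mapSeries φ Y) (PowerSeries.map φ p) := by
  have := congrArg (mapSeries φ) h
  rw [map_add, map_mul, map_mul, mapSeries_smul, mapSeries_gradDer, mapSeries_polyW, map_pow,
    PowerSeries.map_X] at this
  exact this

theorem IsUnipotentGauge.map (φ : R →+* R') {Y : Matrix (Fin n) (Fin n) R⟦X⟧}
    (h : IsUnipotentGauge Y) : IsUnipotentGauge (mapSeries φ Y) := by
  intro i j hij
  rw [RingHom.mapMatrix_apply, Matrix.map_apply, PowerSeries.coeff_map, h i j hij]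
  split_ifs <;> simp

/-- The determinant has the constant term one over any ring, so inverting the gauge introduces no
new denominators. -/
theorem IsUnipotentGauge.isUnit_det {Y : Matrix (Fin n) (Fin n) R⟦X⟧}
    (h : IsUnipotentGauge Y) : IsUnit Y.det := by
  rw [PowerSeries.isUnit_iff_constantCoeff, RingHom.map_det, Matrix.det_of_isUpperTriangular]
  · rw [Finset.prod_eq_one fun i _ => ?_]
    · exact isUnit_one
    · rw [RingHom.mapMatrix_apply, Matrix.map_apply,
        ← PowerSeries.coeff_zero_eq_constantCoeff_apply, h i i le_rfl, if_pos rfl]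
  · intro i j hij
    rw [RingHom.mapMatrix_apply, Matrix.map_apply,
      ← PowerSeries.coeff_zero_eq_constantCoeff_apply, h i j (le_of_lt hij)]
    exact if_neg (ne_of_lt hij)

end BaseChange

/-! ### Parameters for admissible connections and the generic gauge -/

section Chart

open scoped PowerSeries

variable {n r : ℕ} [NeZero n] {R R' : Type*} [CommRing R] [CommRing R']

/-- The index of the lower left entry of the subleading coefficient. -/
def cornerIdx (n : ℕ) [NeZero n] {r : ℕ} (hr : 2 ≤ r) : Fin r × Fin n × Fin n :=
  (⟨r - 2, by omega⟩, ⟨n - 1, Nat.sub_lt (NeZero.pos n) one_pos⟩, ⟨0, NeZero.pos n⟩)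

/-- The coefficients of an admissible connection in terms of free parameters: the leading
coefficient is upper triangular, with constant diagonal, and the entries above the diagonal equal
the lower left entry of the subleading coefficient. -/
def admCoeff (hr : 2 ≤ r) (v : Fin r × Fin n × Fin n → R) (k : ℕ) : Matrix (Fin n) (Fin n) R :=
  Matrix.of fun i j =>
    if k = r - 1 then
      if j < i then 0
      else if j = i then v (⟨r - 1, by omega⟩, ⟨0, NeZero.pos n⟩, ⟨0, NeZero.pos n⟩)
      else if j.val = i.val + 1 then v (cornerIdx n hr)
      else v (⟨r - 1, by omega⟩, i, j)
    else if h : k < r then v (⟨k, h⟩, i, j) else 0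

/-- The series `n z^{r-1} A(1/z)` of an admissible connection with given parameters. -/
noncomputable def admSeries (hr : 2 ≤ r) (v : Fin r × Fin n × Fin n → R) :
    Matrix (Fin n) (Fin n) R⟦X⟧ :=
  coeffSeries r (admCoeff hr v)

theorem coeff_admSeries (hr : 2 ≤ r) (v : Fin r × Fin n × Fin n → R) (i j : Fin n) (k : ℕ) :
    PowerSeries.coeff k (admSeries hr v i j) =
      if k < r then (n : R) * admCoeff hr v (r - 1 - k) i j else 0 := by
  rw [admSeries, coeffSeries, Matrix.of_apply, PowerSeries.coeff_mk]

theorem mapSeries_admSeries (φ : R →+* R') (hr : 2 ≤ r) (v : Fin r × Fin n × Fin n → R) :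
    mapSeries φ (admSeries hr v) = admSeries hr fun x => φ (v x) := by
  ext1 i j
  ext k
  rw [RingHom.mapMatrix_apply, Matrix.map_apply, PowerSeries.coeff_map, coeff_admSeries,
    coeff_admSeries, apply_ite φ, map_zero, map_mul, map_natCast]
  congr 2
  simp only [admCoeff, Matrix.of_apply]
  split_ifs <;> simp

theorem isAdmissible_admSeries (hr : 2 ≤ r) (v : Fin r × Fin n × Fin n → R) :
    IsAdmissible (admSeries hr v)
      (n * v (⟨r - 1, by omega⟩, ⟨0, NeZero.pos n⟩, ⟨0, NeZero.pos n⟩)) (n * v (cornerIdx n hr)) := by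
  refine ⟨fun i j h => ?_, fun i => ?_, fun i j h => ?_, fun i j hi hj => ?_⟩
  · rw [coeff_admSeries, if_pos (by omega), admCoeff, Matrix.of_apply, if_pos (by omega), if_pos h,
      mul_zero]
  · rw [coeff_admSeries, if_pos (by omega), admCoeff, Matrix.of_apply, if_pos (by omega),
      if_neg (lt_irrefl i), if_pos rfl]
  · rw [coeff_admSeries, if_pos (by omega), admCoeff, Matrix.of_apply, if_pos (by omega),
      if_neg (by rw [Fin.lt_def]; omega), if_neg (by rw [Fin.ext_iff]; omega), if_pos h]
  · rw [coeff_admSeries, if_pos (by omega), admCoeff, Matrix.of_apply, if_neg (by omega),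
      dif_pos (by omega)]
    congr 2
    rw [cornerIdx, Prod.mk.injEq, Prod.mk.injEq, Fin.ext_iff, Fin.ext_iff, Fin.ext_iff]
    simp only
    omega

/-- The parameters of a series. -/
noncomputable def paramsOf (r : ℕ) (M : Matrix (Fin n) (Fin n) ℂ⟦X⟧) :
    Fin r × Fin n × Fin n → ℂ :=
  fun x => (n : ℂ)⁻¹ * PowerSeries.coeff (r - 1 - x.1.val) (M x.2.1 x.2.2)

/-- The parameters at the constrained positions are redundant, as `admSeries` ignores them. A series
is therefore recovered from its parameters, but not every parameter vector from its series. -/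
theorem admSeries_paramsOf (hr : 2 ≤ r) {M : Matrix (Fin n) (Fin n) ℂ⟦X⟧} {β₀ β₁ : ℂ}
    (hM : IsAdmissible M β₀ β₁) (hd : ∀ i j, ∀ k, r ≤ k → PowerSeries.coeff k (M i j) = 0) :
    admSeries hr (paramsOf r M) = M := by
  have hnc : (n : ℂ) ≠ 0 := by exact_mod_cast NeZero.ne n
  ext1 i j
  ext k
  rw [coeff_admSeries]
  split_ifs with h
  · rw [admCoeff, Matrix.of_apply]
    split_ifs with h1 h2 h3 h4 h5
    · rw [show k = 0 by omega, hM.lower i j h2, mul_zero]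
    · subst h3
      rw [show k = 0 by omega, hM.diag, paramsOf]
      simp only [Nat.sub_self, hM.diag]
      rw [mul_inv_cancel_left₀ hnc]
    · rw [show k = 0 by omega, hM.super i j h4, paramsOf, cornerIdx]
      simp only
      rw [show r - 1 - (r - 2) = 1 by omega, hM.corner _ _ _ rfl, mul_inv_cancel_left₀ hnc]
      simp only
      have := NeZero.pos n
      omega
    · rw [show k = 0 by omega, paramsOf]
      simp only [Nat.sub_self]
      rw [mul_inv_cancel_left₀ hnc]
    · rw [paramsOf]
      simp only
      rw [mul_inv_cancel_left₀ hnc, show r - 1 - (r - 1 - k) = k by omega]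
    · omega
  · exact (hd i j k (by omega)).symm

/-- A function of the parameters which is a polynomial divided by a power of the lower left entry of
the subleading coefficient. -/
def IsCornerRational (hr : 2 ≤ r) (f : (Fin r × Fin n × Fin n → ℂ) → ℂ) : Prop :=
  ∃ (k : ℕ) (P : MvPolynomial (Fin r × Fin n × Fin n) ℂ), ∀ v, v (cornerIdx n hr) ≠ 0 →
    f v = MvPolynomial.eval v P / v (cornerIdx n hr) ^ k

/-- The formal gauge of the generic admissible connection. -/
theorem exists_generic (n : ℕ) [NeZero n] {r : ℕ} (hr : 2 ≤ r) :
    ∃ (Y Y' : (Fin r × Fin n × Fin n → ℂ) → Matrix (Fin n) (Fin n) ℂ⟦X⟧)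
      (p : (Fin r × Fin n × Fin n → ℂ) → ℂ⟦X⟧),
      (∀ v, v (cornerIdx n hr) ≠ 0 → IsUnipotentGauge (Y v) ∧ Y v * Y' v = 1 ∧
        (∀ k, r * n < k → PowerSeries.coeff k (p v) = 0) ∧
        FormalEq r (admSeries hr v) (Y v) (p v)) ∧
      (∀ i j k, IsCornerRational hr fun v => PowerSeries.coeff k (Y v i j)) ∧
      (∀ i j k, IsCornerRational hr fun v => PowerSeries.coeff k (Y' v i j)) ∧
      ∀ k, IsCornerRational hr fun v => PowerSeries.coeff k (p v) := by
  classical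
  have hnc : (n : ℂ) ≠ 0 := by exact_mod_cast NeZero.ne n
  let x : MvPolynomial (Fin r × Fin n × Fin n) ℂ := MvPolynomial.X (cornerIdx n hr)
  -- The recursion divides only by nonzero integers and by `β₁ = n x`. It therefore runs over the
  -- polynomial ring localized at the corner variable, whence the shape of the denominators.
  let S := Localization.Away x
  let V : Fin r × Fin n × Fin n → S := fun a =>
    algebraMap (MvPolynomial (Fin r × Fin n × Fin n) ℂ) S (MvPolynomial.X a)
  have hu : IsUnit ((n : S) * V (cornerIdx n hr)) := by
    refine IsUnit.mul ?_ (IsLocalization.Away.algebraMap_isUnit x)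
    rw [← map_natCast (algebraMap ℂ S)]
    exact (isUnit_iff_ne_zero.2 hnc).map _
  obtain ⟨Y, p, hY, hp, hE⟩ := exists_formalEq (isAdmissible_admSeries hr V) hu
    (two_le_mul_card hr)
  -- Specialization of the parameters. When the corner vanishes the lift does not exist, and a dummy
  -- value, the point with all coordinates one, is used instead.
  let ev : (Fin r × Fin n × Fin n → ℂ) → S →+* ℂ := fun v =>
    if h : v (cornerIdx n hr) ≠ 0 then
      IsLocalization.Away.lift x (g := MvPolynomial.eval v) (by
        rw [MvPolynomial.eval_X]; exact isUnit_iff_ne_zero.2 h)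
    else IsLocalization.Away.lift x (g := MvPolynomial.eval fun _ => (1 : ℂ)) (by
        rw [MvPolynomial.eval_X]; exact isUnit_one)
  have hev : ∀ v, v (cornerIdx n hr) ≠ 0 → ∀ q, ev v (algebraMap _ S q) = MvPolynomial.eval v q := by
    intro v hv q
    simp only [ev, dif_pos hv]
    exact IsLocalization.Away.lift_eq x _ q
  have hrat : ∀ s : S, IsCornerRational hr fun v => ev v s := by
    intro s
    obtain ⟨k, q, hq⟩ := IsLocalization.Away.surj x s
    refine ⟨k, q, fun v hv => ?_⟩
    rw [eq_div_iff (pow_ne_zero _ hv), ← hev v hv q, ← hq, map_mul, map_pow, hev v hv,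
      MvPolynomial.eval_X]
  have hcoeff : ∀ (M : Matrix (Fin n) (Fin n) S⟦X⟧) i j k,
      IsCornerRational hr fun v => PowerSeries.coeff k (mapSeries (ev v) M i j) := by
    intro M i j k
    simp only [RingHom.mapMatrix_apply, Matrix.map_apply, PowerSeries.coeff_map]
    exact hrat _
  refine ⟨fun v => mapSeries (ev v) Y, fun v => mapSeries (ev v) Y⁻¹,
    fun v => PowerSeries.map (ev v) p, fun v hv => ⟨hY.map _, ?_, fun k hk => ?_, ?_⟩,
    hcoeff Y, hcoeff Y⁻¹, fun k => ?_⟩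
  · rw [← map_mul, Matrix.mul_nonsing_inv _ hY.isUnit_det, map_one]
  · rw [PowerSeries.coeff_map, hp k hk, map_zero]
  · have := hE.map (ev v)
    rw [mapSeries_admSeries] at this
    simpa only [V, hev v hv, MvPolynomial.eval_X] using this
  · simp only [PowerSeries.coeff_map]
    exact hrat _

theorem IsCornerRational.contDiffAt {hr : 2 ≤ r} {f : (Fin r × Fin n × Fin n → ℂ) → ℂ}
    (hf : IsCornerRational hr f) {v : Fin r × Fin n × Fin n → ℂ} (hv : v (cornerIdx n hr) ≠ 0)
    (m : WithTop ℕ∞) : ContDiffAt ℂ m f v := by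
  obtain ⟨k, P, hP⟩ := hf
  have hpoly : ContDiff ℂ m fun v : Fin r × Fin n × Fin n → ℂ => MvPolynomial.eval v P := by
    clear hP
    induction P using MvPolynomial.induction_on with
    | C a => simpa using contDiff_const
    | add p q hp hq => simpa using (hp).add (hq)
    | mul_X p i hp => simpa using (hp).mul (contDiff_apply ℂ ℂ i)
  have h1 : ContDiffAt ℂ m (fun v : Fin r × Fin n × Fin n → ℂ =>
      MvPolynomial.eval v P / v (cornerIdx n hr) ^ k) v :=
    hpoly.contDiffAt.div ((contDiff_apply ℂ ℂ _).pow k).contDiffAt (pow_ne_zero _ hv)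
  refine h1.congr_of_eventuallyEq ?_
  have : ∀ᶠ w in nhds v, w (cornerIdx n hr) ≠ 0 :=
    (continuous_apply (cornerIdx n hr)).continuousAt.eventually_ne hv
  filter_upwards [this] with w hw using hP w hw

end Chart

/-! ### Noncommutative identities behind the flows -/

section Algebra

variable {R A : Type*} [CommRing R] [Ring A] [Algebra R A]

/-- Here `x` stands for `z^r`, `Ξ` for the tail of `Θ`, `E` and `F` for the Euler derivatives of `Θ`
and `Ξ`, and `h` for the Lax equation. The left side is the velocity written with the tail, the
right side the same with the truncation `Θ - x Ξ`. -/
theorem smul_velocity_aux {x n r k : R} {Θ Ξ E F a : A}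
    (h : x • n • E = Θ * a - a * Θ + x • k • Θ) :
    x • ((r * n - k) • Θ + (a * Ξ - Ξ * a) + (n * x) • F) =
      x • n • (r • (Θ - x • Ξ) - (E - x • (r • Ξ + F))) +
        ((Θ - x • Ξ) * a - a * (Θ - x • Ξ)) := by
  simp only [smul_add, smul_sub, sub_mul, mul_sub, smul_mul_assoc, mul_smul_comm, smul_smul] at h ⊢
  linear_combination (norm := module) h

/-- `S` and `S'` stand for the tails of the two brackets `Θ' Ξ - Ξ Θ'` and `Θ Ξ' - Ξ' Θ`, so that
every difference with a factor `x` is a truncation. -/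
theorem lowPart_bracket_aux {x : R} {Θ Θ' Ξ Ξ' S S' : A} (h : Θ * Θ' = Θ' * Θ) :
    x • ((Θ' * Ξ - Ξ * Θ' - x • S) - (Θ * Ξ' - Ξ' * Θ - x • S')) -
      ((Θ - x • Ξ) * (Θ' - x • Ξ') - (Θ' - x • Ξ') * (Θ - x • Ξ)) =
      x • x • (S' - S - (Ξ * Ξ' - Ξ' * Ξ)) := by
  simp only [smul_sub, sub_mul, mul_sub, smul_mul_assoc, mul_smul_comm, smul_smul]
  linear_combination (norm := module) -h

/-- `T, T'` are the truncations, `G, G'` the velocities, `DT, DG` the derivatives along the primed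
flow and `DT', DG'` those along the unprimed one; `e, e', d, d'` are Euler derivatives. `hD` is the
zero curvature of the two flows, and `he` is its Euler derivative. -/
theorem mixed_velocity_aux {x n r : R} {a T T' G G' DT DT' DG DG' e e' d d' : A}
    (hG : x • G = x • n • (r • T - e) + (T * a - a * T))
    (hG' : x • G' = x • n • (r • T' - e') + (T' * a - a * T'))
    (hDG : x • DG = x • n • (r • DT - d) + (DT * a + T * G' - (G' * T + a * DT)))
    (hDG' : x • DG' = x • n • (r • DT' - d') + (DT' * a + T' * G - (G * T' + a * DT')))
    (hD : x • (DT' - DT) = T * T' - T' * T)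
    (he : x • (r • (DT' - DT) + (d' - d)) = e * T' + T * e' - (e' * T + T' * e)) :
    x • x • DG' = x • x • DG := by
  have hDA := congrArg (fun M => M * a) hD
  have hAD := congrArg (fun M => a * M) hD
  have h1 := congrArg (fun M => T * M) hG'
  have h2 := congrArg (fun M => M * T) hG'
  have h3 := congrArg (fun M => T' * M) hG
  have h4 := congrArg (fun M => M * T') hG
  rw [hDG, hDG']
  simp only [smul_add, smul_sub, sub_mul, mul_sub, add_mul, mul_add, smul_mul_assoc,
    mul_smul_comm, smul_smul, mul_assoc] at he hDA hAD h1 h2 h3 h4 hD ⊢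
  linear_combination (norm := module) (2 * x * n * r) • hD - (x * n) • he + hDA - hAD - h1 + h2 +
    h3 - h4

end Algebra

/-! ### Dressed matrices, the Lax equation and the velocities -/

section Flows

open scoped PowerSeries

variable {n r : ℕ}

theorem euler_add (M M' : Matrix (Fin n) (Fin n) ℂ⟦X⟧) : euler (M + M') = euler M + euler M' := by
  ext1 i j
  simp only [euler, Matrix.map_apply, Matrix.add_apply, map_add, mul_add]

theorem euler_sub (M M' : Matrix (Fin n) (Fin n) ℂ⟦X⟧) : euler (M - M') = euler M - euler M' := by
  ext1 i j
  simp only [euler, Matrix.map_apply, Matrix.sub_apply, map_sub, mul_sub]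

theorem euler_mul (M M' : Matrix (Fin n) (Fin n) ℂ⟦X⟧) :
    euler (M * M') = euler M * M' + M * euler M' := by
  ext1 i j
  simp only [euler, Matrix.map_apply, Matrix.add_apply, Matrix.mul_apply, map_sum, Finset.mul_sum,
    ← Finset.sum_add_distrib]
  refine Finset.sum_congr rfl fun l _ => ?_
  rw [Derivation.leibniz, smul_eq_mul, smul_eq_mul]
  ring

theorem coeff_euler (M : Matrix (Fin n) (Fin n) ℂ⟦X⟧) (i j : Fin n) (k : ℕ) :
    PowerSeries.coeff k (euler M i j) = k * PowerSeries.coeff k (M i j) :=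
  coeff_X_mul_derivative _ _

theorem coeff_X_pow_smul_matrix (d : ℕ) (M : Matrix (Fin n) (Fin n) ℂ⟦X⟧) (i j : Fin n) (k : ℕ) :
    PowerSeries.coeff k (((PowerSeries.X ^ d : ℂ⟦X⟧) • M) i j) =
      if d ≤ k then PowerSeries.coeff (k - d) (M i j) else 0 := by
  rw [Matrix.smul_apply, smul_eq_mul, PowerSeries.coeff_X_pow_mul']

theorem coeff_C_smul_matrix (c : ℂ) (M : Matrix (Fin n) (Fin n) ℂ⟦X⟧) (i j : Fin n) (k : ℕ) :
    PowerSeries.coeff k ((PowerSeries.C c • M) i j) = c * PowerSeries.coeff k (M i j) := by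
  rw [Matrix.smul_apply, smul_eq_mul, PowerSeries.coeff_C_mul]

theorem coeff_natCast_smul_matrix (c : ℕ) (M : Matrix (Fin n) (Fin n) ℂ⟦X⟧) (i j : Fin n) (k : ℕ) :
    PowerSeries.coeff k (((c : ℂ⟦X⟧) • M) i j) = c * PowerSeries.coeff k (M i j) := by
  rw [← map_natCast (PowerSeries.C (R := ℂ)), coeff_C_smul_matrix]

theorem euler_X_pow_smul (d : ℕ) (M : Matrix (Fin n) (Fin n) ℂ⟦X⟧) :
    euler ((PowerSeries.X ^ d : ℂ⟦X⟧) • M) =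
      (PowerSeries.X ^ d : ℂ⟦X⟧) • ((d : ℂ⟦X⟧) • M + euler M) := by
  ext i j k
  rw [coeff_euler, coeff_X_pow_smul_matrix, coeff_X_pow_smul_matrix]
  split_ifs with h
  · rw [Matrix.add_apply, map_add, coeff_natCast_smul_matrix, coeff_euler, Nat.cast_sub h]
    ring
  · rw [mul_zero]

theorem X_pow_smul_matrix_cancel {d : ℕ} {M M' : Matrix (Fin n) (Fin n) ℂ⟦X⟧}
    (h : (PowerSeries.X ^ d : ℂ⟦X⟧) • M = (PowerSeries.X ^ d : ℂ⟦X⟧) • M') : M = M' := by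
  ext1 i j
  exact X_pow_mul_left_cancel (congrFun (congrFun h i) j)

/-- The terms of order at most `r`. -/
noncomputable def lowPart (r : ℕ) (M : Matrix (Fin n) (Fin n) ℂ⟦X⟧) :
    Matrix (Fin n) (Fin n) ℂ⟦X⟧ :=
  M.map fun f => PowerSeries.mk fun m => if m ≤ r then PowerSeries.coeff m f else 0

/-- The terms of order greater than `r`, divided by `z^r`. -/
noncomputable def tailPart (r : ℕ) (M : Matrix (Fin n) (Fin n) ℂ⟦X⟧) :
    Matrix (Fin n) (Fin n) ℂ⟦X⟧ :=
  M.map fun f => PowerSeries.mk fun m => if m = 0 then 0 else PowerSeries.coeff (m + r) f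

theorem coeff_lowPart (M : Matrix (Fin n) (Fin n) ℂ⟦X⟧) (i j : Fin n) (k : ℕ) :
    PowerSeries.coeff k (lowPart r M i j) = if k ≤ r then PowerSeries.coeff k (M i j) else 0 := by
  rw [lowPart, Matrix.map_apply, PowerSeries.coeff_mk]

theorem coeff_tailPart (M : Matrix (Fin n) (Fin n) ℂ⟦X⟧) (i j : Fin n) (k : ℕ) :
    PowerSeries.coeff k (tailPart r M i j) =
      if k = 0 then 0 else PowerSeries.coeff (k + r) (M i j) := by
  rw [tailPart, Matrix.map_apply, PowerSeries.coeff_mk]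

theorem lowPart_add_tailPart (r : ℕ) (M : Matrix (Fin n) (Fin n) ℂ⟦X⟧) :
    lowPart r M + (PowerSeries.X ^ r : ℂ⟦X⟧) • tailPart r M = M := by
  ext i j k
  rw [Matrix.add_apply, map_add, coeff_lowPart, coeff_X_pow_smul_matrix, coeff_tailPart]
  split_ifs with h1 h2 h3 h3
  · rw [add_zero]
  · rw [show k = r by omega] at h3; omega
  · rw [add_zero]
  · omega
  · rw [zero_add, Nat.sub_add_cancel (by assumption)]
  · omega

theorem coeff_mul_matrix_eq_zero {M M' : Matrix (Fin n) (Fin n) ℂ⟦X⟧} {a b : ℕ}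
    (hM : ∀ i j, ∀ k, a < k → PowerSeries.coeff k (M i j) = 0)
    (hM' : ∀ i j, ∀ k, b < k → PowerSeries.coeff k (M' i j) = 0) (i j : Fin n) {k : ℕ}
    (hk : a + b < k) : PowerSeries.coeff k ((M * M') i j) = 0 := by
  rw [Matrix.mul_apply, map_sum]
  refine Finset.sum_eq_zero fun l _ => ?_
  rw [PowerSeries.coeff_mul]
  refine Finset.sum_eq_zero fun x hx => ?_
  have := Finset.HasAntidiagonal.mem_antidiagonal.1 hx
  by_cases h : a < x.1
  · rw [hM _ _ _ h, zero_mul]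
  · rw [hM' _ _ _ (by omega), mul_zero]

/-- The conjugate `Y ℋ^J Y⁻¹ / J`, multiplied by `z^r`. -/
noncomputable def dressed (n r : ℕ) (Y Y' : Matrix (Fin n) (Fin n) ℂ⟦X⟧) (J : ℕ) :
    Matrix (Fin n) (Fin n) ℂ⟦X⟧ :=
  PowerSeries.C (J : ℂ)⁻¹ • (Y * shiftW n ℂ ^ (r * n - J) * Y')

/-- The series `n z^{r-1} (∂ₓ 𝒯 + [𝒯, A])` of the velocity of `A` along the flow generated by the
nonnegative part `𝒯` of `z^{-r} Θ`. -/
noncomputable def velocity (r J : ℕ) (Â Θ : Matrix (Fin n) (Fin n) ℂ⟦X⟧) :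
    Matrix (Fin n) (Fin n) ℂ⟦X⟧ :=
  PowerSeries.C (J : ℂ) • Θ + (Â * tailPart r Θ - tailPart r Θ * Â) +
    ((n : ℂ⟦X⟧) * PowerSeries.X ^ r) • euler (tailPart r Θ)

theorem gradDer_mul (M Y : Matrix (Fin n) (Fin n) ℂ⟦X⟧) :
    gradDer (M * Y) = (n : ℂ⟦X⟧) • (euler M * Y) + M * gradDer Y := by
  rw [gradDer, gradDer, euler_mul, smul_add, mul_add, mul_smul_comm, mul_assoc, add_assoc]

theorem dressed_commute {Y Y' : Matrix (Fin n) (Fin n) ℂ⟦X⟧} (hY : Y' * Y = 1) (J K : ℕ) :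
    dressed n r Y Y' J * dressed n r Y Y' K = dressed n r Y Y' K * dressed n r Y Y' J := by
  have h : ∀ a b : ℕ, Y * shiftW n ℂ ^ a * Y' * (Y * shiftW n ℂ ^ b * Y') =
      Y * shiftW n ℂ ^ (a + b) * Y' := by
    intro a b
    calc _ = Y * shiftW n ℂ ^ a * (Y' * Y) * shiftW n ℂ ^ b * Y' := by simp only [mul_assoc]
      _ = _ := by rw [hY, mul_one, mul_assoc Y, ← pow_add]
  simp only [dressed, smul_mul_assoc, mul_smul_comm, h]
  rw [smul_comm, add_comm]

theorem commute_polyW_shiftW_pow (N k : ℕ) (p : ℂ⟦X⟧) :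
    polyW n N p * shiftW n ℂ ^ k = shiftW n ℂ ^ k * polyW n N p := by
  rw [polyW, Finset.sum_mul, Finset.mul_sum]
  refine Finset.sum_congr rfl fun m _ => ?_
  rw [smul_mul_assoc, mul_smul_comm, ← pow_add, ← pow_add, add_comm]

theorem dressed_mul {Y Y' : Matrix (Fin n) (Fin n) ℂ⟦X⟧} (hY : Y' * Y = 1) (J : ℕ) :
    dressed n r Y Y' J * Y = PowerSeries.C (J : ℂ)⁻¹ • (Y * shiftW n ℂ ^ (r * n - J)) := by
  rw [dressed, smul_mul_assoc, mul_assoc _ Y', hY, mul_one]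

variable [NeZero n]

theorem gradDer_mul_shiftW_pow (Y : Matrix (Fin n) (Fin n) ℂ⟦X⟧) (k : ℕ) :
    gradDer (Y * shiftW n ℂ ^ k) =
      gradDer Y * shiftW n ℂ ^ k + (k : ℂ⟦X⟧) • (Y * shiftW n ℂ ^ k) := by
  refine rowSeries_injective fun i => ?_
  rw [rowSeries_gradDer, rowSeries_add, rowSeries_mul_shiftW_pow, rowSeries_mul_shiftW_pow,
    rowSeries_smul, rowSeries_mul_shiftW_pow, rowSeries_gradDer, map_natCast]
  have h := X_pow_mul_derivative_X_pow_mul 0 k (rowSeries Y i)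
  rw [zero_add, pow_one, pow_zero, one_mul] at h
  rw [h]
  ring

/-- This is the Lax equation. The derivation `gradDer` is applied to `Θ Y = J⁻¹ Y W^k`, where right
multiplication by `W^k` raises the degree by `k`, and `gradDer Y` is eliminated by the formal
equation. -/
theorem euler_dressed {Â Y Y' : Matrix (Fin n) (Fin n) ℂ⟦X⟧} {p : ℂ⟦X⟧} (hY : Y' * Y = 1)
    (hE : FormalEq r Â Y p) (J : ℕ) :
    (PowerSeries.X ^ r : ℂ⟦X⟧) • (n : ℂ⟦X⟧) • euler (dressed n r Y Y' J) =
      dressed n r Y Y' J * Â - Â * dressed n r Y Y' J +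
        (PowerSeries.X ^ r : ℂ⟦X⟧) • ((r * n - J : ℕ) : ℂ⟦X⟧) • dressed n r Y Y' J := by
  set Θ := dressed n r Y Y' J with hΘ
  set k := r * n - J
  have hYY : Y * Y' = 1 := mul_eq_one_comm.1 hY
  have h1 : Θ * Y = PowerSeries.C (J : ℂ)⁻¹ • (Y * shiftW n ℂ ^ k) := dressed_mul hY J
  have hC : ∀ M : Matrix (Fin n) (Fin n) ℂ⟦X⟧, gradDer (PowerSeries.C (J : ℂ)⁻¹ • M) =
      PowerSeries.C (J : ℂ)⁻¹ • gradDer M := by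
    intro M
    refine rowSeries_injective fun i => ?_
    rw [rowSeries_gradDer, rowSeries_smul, rowSeries_smul, rowSeries_gradDer, PowerSeries.expand_C,
      Derivation.leibniz, PowerSeries.derivative_C, smul_zero, add_zero, smul_eq_mul]
    ring
  have h2 : (n : ℂ⟦X⟧) • (euler Θ * Y) + Θ * gradDer Y =
      PowerSeries.C (J : ℂ)⁻¹ • (gradDer Y * shiftW n ℂ ^ k) + (k : ℂ⟦X⟧) • (Θ * Y) := by
    rw [← gradDer_mul, h1, hC, gradDer_mul_shiftW_pow, smul_add]
    congr 1
    rw [smul_comm]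
  have h3 : (PowerSeries.X ^ r : ℂ⟦X⟧) • gradDer Y = Y * polyW n (r * n) p - Â * Y :=
    eq_sub_of_add_eq' hE
  have h4 : ((PowerSeries.X ^ r : ℂ⟦X⟧) • (n : ℂ⟦X⟧) • euler Θ) * Y =
      (Θ * Â - Â * Θ + (PowerSeries.X ^ r : ℂ⟦X⟧) • (k : ℂ⟦X⟧) • Θ) * Y := by
    have h5 : Θ * ((PowerSeries.X ^ r : ℂ⟦X⟧) • gradDer Y) =
        PowerSeries.C (J : ℂ)⁻¹ • (Y * polyW n (r * n) p * shiftW n ℂ ^ k) - Θ * Â * Y := by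
      rw [h3, mul_sub, ← mul_assoc, h1, smul_mul_assoc, mul_assoc, mul_assoc Y,
        commute_polyW_shiftW_pow, mul_assoc Θ]
    have h6 : PowerSeries.C (J : ℂ)⁻¹ • (((PowerSeries.X ^ r : ℂ⟦X⟧) • gradDer Y) *
        shiftW n ℂ ^ k) =
        PowerSeries.C (J : ℂ)⁻¹ • (Y * polyW n (r * n) p * shiftW n ℂ ^ k) - Â * Θ * Y := by
      rw [h3, sub_mul, smul_sub, mul_assoc Â Θ, h1, mul_smul_comm, mul_assoc Â]
    have h7 := congrArg ((PowerSeries.X ^ r : ℂ⟦X⟧) • ·) h2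
    simp only [smul_add] at h7
    rw [smul_comm _ (PowerSeries.C (J : ℂ)⁻¹), ← smul_mul_assoc _ (gradDer Y), h6,
      ← mul_smul_comm _ Θ, h5] at h7
    simp only [add_mul, sub_mul, smul_mul_assoc]
    linear_combination (norm := abel) h7
  have h8 := congrArg (· * Y') h4
  simpa only [mul_assoc, hYY, mul_one] using h8

/-- The right side is `∂ₓ𝒯 + [𝒯, A]` read in `z`, whereas `velocity` is defined through the tail;
the Lax equation makes the two agree. -/
theorem X_pow_smul_velocity {Â Y Y' : Matrix (Fin n) (Fin n) ℂ⟦X⟧} {p : ℂ⟦X⟧} (hY : Y' * Y = 1)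
    (hE : FormalEq r Â Y p) {J : ℕ} (hJ : J ≤ r * n) :
    (PowerSeries.X ^ r : ℂ⟦X⟧) • velocity r J Â (dressed n r Y Y' J) =
      (PowerSeries.X ^ r : ℂ⟦X⟧) • (n : ℂ⟦X⟧) •
          ((r : ℂ⟦X⟧) • lowPart r (dressed n r Y Y' J) - euler (lowPart r (dressed n r Y Y' J))) +
        (lowPart r (dressed n r Y Y' J) * Â - Â * lowPart r (dressed n r Y Y' J)) := by
  have h1 := euler_dressed hY hE J
  have h2 := lowPart_add_tailPart r (dressed n r Y Y' J)
  set Θ := dressed n r Y Y' J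
  set T := lowPart r Θ
  set Ξ := tailPart r Θ
  have h3 := congrArg euler h2
  rw [euler_add, euler_X_pow_smul] at h3
  have hT : T = Θ - (PowerSeries.X ^ r : ℂ⟦X⟧) • Ξ := eq_sub_of_add_eq h2
  have hc : PowerSeries.C (J : ℂ) = (r : ℂ⟦X⟧) * (n : ℂ⟦X⟧) - ((r * n - J : ℕ) : ℂ⟦X⟧) := by
    rw [Nat.cast_sub hJ, Nat.cast_mul, map_natCast]
    ring
  rw [eq_sub_of_add_eq h3, hT, velocity, hc]
  exact smul_velocity_aux h1

/-- The definition through the tail shows that no negative powers of `z` occur, and the expression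
through the truncation shows that the series stops before the order `r`. At the order `r` itself the
coefficient carries the factor `r - k = 0`. -/
theorem coeff_velocity_eq_zero {Â Y Y' : Matrix (Fin n) (Fin n) ℂ⟦X⟧} {p : ℂ⟦X⟧} (hY : Y' * Y = 1)
    (hE : FormalEq r Â Y p) (hr : 1 ≤ r)
    (hA : ∀ i j, ∀ k, r ≤ k → PowerSeries.coeff k (Â i j) = 0) {J : ℕ}
    (hJ : J ≤ r * n) (i j : Fin n) (k : ℕ) (hk : r ≤ k) :
    PowerSeries.coeff k (velocity r J Â (dressed n r Y Y' J) i j) = 0 := by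
  have h := congrArg (fun M => PowerSeries.coeff (k + r) (M i j)) (X_pow_smul_velocity hY hE hJ)
  beta_reduce at h
  have hT : ∀ i j, ∀ k, r < k →
      PowerSeries.coeff k (lowPart r (dressed n r Y Y' J) i j) = 0 := fun i j k hk => by
    rw [coeff_lowPart, if_neg (by omega)]
  have hA' : ∀ i j, ∀ k, r - 1 < k → PowerSeries.coeff k (Â i j) = 0 := fun i j k hk =>
    hA i j k (by omega)
  rw [coeff_X_pow_smul_matrix, if_pos (by omega), Nat.add_sub_cancel, Matrix.add_apply, map_add,
    coeff_X_pow_smul_matrix, if_pos (by omega), Nat.add_sub_cancel, coeff_natCast_smul_matrix,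
    Matrix.sub_apply, map_sub, coeff_natCast_smul_matrix, coeff_euler, Matrix.sub_apply, map_sub,
    coeff_mul_matrix_eq_zero hT hA' i j (by omega), coeff_mul_matrix_eq_zero hA' hT i j (by omega)]
    at h
  rw [h, ← sub_mul]
  rcases hk.lt_or_eq with hk | rfl
  · rw [hT i j k hk]; simp
  · simp

/-- The zero curvature of the flows, in terms of the truncations. -/
theorem lowPart_bracket {Θ Θ' : Matrix (Fin n) (Fin n) ℂ⟦X⟧} (h : Θ * Θ' = Θ' * Θ) :
    (PowerSeries.X ^ r : ℂ⟦X⟧) • (lowPart r (Θ' * tailPart r Θ - tailPart r Θ * Θ') -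
        lowPart r (Θ * tailPart r Θ' - tailPart r Θ' * Θ)) =
      lowPart r Θ * lowPart r Θ' - lowPart r Θ' * lowPart r Θ := by
  have hT : ∀ (M : Matrix (Fin n) (Fin n) ℂ⟦X⟧) i j, ∀ k, r < k →
      PowerSeries.coeff k (lowPart r M i j) = 0 := fun M i j k hk => by
    rw [coeff_lowPart, if_neg (by omega)]
  set A := Θ' * tailPart r Θ - tailPart r Θ * Θ' with hA
  set B := Θ * tailPart r Θ' - tailPart r Θ' * Θ with hB
  -- The difference of the two sides is `z^{2r} Z`, and `Z` has no constant term because tails begin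
  -- at the order one; but both sides have order at most `2r`.
  set Z := tailPart r B - tailPart r A - (tailPart r Θ * tailPart r Θ' -
    tailPart r Θ' * tailPart r Θ) with hZ
  have hZ0 : constTerm Z = 0 := by
    have ht : ∀ M : Matrix (Fin n) (Fin n) ℂ⟦X⟧, constTerm (tailPart r M) = 0 := by
      intro M
      ext1 i j
      rw [RingHom.mapMatrix_apply, Matrix.map_apply,
        ← PowerSeries.coeff_zero_eq_constantCoeff_apply, coeff_tailPart, if_pos rfl,
        Matrix.zero_apply]
    rw [hZ]
    simp only [map_sub, map_mul, ht, mul_zero, sub_zero]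
  have key : (PowerSeries.X ^ r : ℂ⟦X⟧) • (lowPart r A - lowPart r B) -
      (lowPart r Θ * lowPart r Θ' - lowPart r Θ' * lowPart r Θ) =
      (PowerSeries.X ^ r : ℂ⟦X⟧) • (PowerSeries.X ^ r : ℂ⟦X⟧) • Z := by
    rw [eq_sub_of_add_eq (lowPart_add_tailPart r A), eq_sub_of_add_eq (lowPart_add_tailPart r B),
      eq_sub_of_add_eq (lowPart_add_tailPart r Θ), eq_sub_of_add_eq (lowPart_add_tailPart r Θ'),
      hZ]
    nth_rewrite 1 [hA]
    nth_rewrite 2 [hB]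
    exact lowPart_bracket_aux h
  rw [← sub_eq_zero]
  ext i j k
  rw [Matrix.zero_apply, map_zero]
  by_cases hk : k ≤ r + r
  · rw [key, coeff_X_pow_smul_matrix]
    split_ifs
    · rw [coeff_X_pow_smul_matrix]
      split_ifs
      · rw [show k - r - r = 0 by omega, PowerSeries.coeff_zero_eq_constantCoeff_apply]
        exact congrFun (congrFun hZ0 i) j
      · rfl
    · rfl
  · rw [Matrix.sub_apply, map_sub, Matrix.sub_apply, map_sub,
      coeff_mul_matrix_eq_zero (hT _) (hT _) i j (by omega),
      coeff_mul_matrix_eq_zero (hT _) (hT _) i j (by omega), coeff_X_pow_smul_matrix,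
      if_pos (by omega), Matrix.sub_apply, map_sub, hT _ _ _ _ (by omega), hT _ _ _ _ (by omega)]
    simp

/-- Compatibility of two flows: the mixed derivatives of the connection agree. -/
theorem mixed_velocity_eq {Â T T' G G' DT DT' DG DG' : Matrix (Fin n) (Fin n) ℂ⟦X⟧}
    (hG : (PowerSeries.X ^ r : ℂ⟦X⟧) • G = (PowerSeries.X ^ r : ℂ⟦X⟧) • (n : ℂ⟦X⟧) •
      ((r : ℂ⟦X⟧) • T - euler T) + (T * Â - Â * T))
    (hG' : (PowerSeries.X ^ r : ℂ⟦X⟧) • G' = (PowerSeries.X ^ r : ℂ⟦X⟧) • (n : ℂ⟦X⟧) •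
      ((r : ℂ⟦X⟧) • T' - euler T') + (T' * Â - Â * T'))
    (hDG : (PowerSeries.X ^ r : ℂ⟦X⟧) • DG = (PowerSeries.X ^ r : ℂ⟦X⟧) • (n : ℂ⟦X⟧) •
      ((r : ℂ⟦X⟧) • DT - euler DT) + (DT * Â + T * G' - (G' * T + Â * DT)))
    (hDG' : (PowerSeries.X ^ r : ℂ⟦X⟧) • DG' = (PowerSeries.X ^ r : ℂ⟦X⟧) • (n : ℂ⟦X⟧) •
      ((r : ℂ⟦X⟧) • DT' - euler DT') + (DT' * Â + T' * G - (G * T' + Â * DT')))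
    (hD : (PowerSeries.X ^ r : ℂ⟦X⟧) • (DT' - DT) = T * T' - T' * T) : DG' = DG := by
  refine X_pow_smul_matrix_cancel (d := r) (X_pow_smul_matrix_cancel (d := r) ?_)
  have he := congrArg euler hD
  rw [euler_X_pow_smul, euler_sub, euler_sub, euler_mul, euler_mul] at he
  exact mixed_velocity_aux hG hG' hDG hDG' hD he

end Flows

/-! ### The velocities preserve the admissible form -/

section Tangency

open scoped PowerSeries

variable {n r : ℕ}

/-- Unipotent upper triangular factors, not necessarily inverse to each other, alter `𝒩^k` only
strictly above its own superdiagonal. -/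
theorem unipotent_mul_jordanN_pow_mul {P Q : Matrix (Fin n) (Fin n) ℂ}
    (hP : ∀ i j : Fin n, j ≤ i → P i j = if j = i then 1 else 0)
    (hQ : ∀ i j : Fin n, j ≤ i → Q i j = if j = i then 1 else 0) {k : ℕ} {i j : Fin n}
    (h : j.val ≤ i.val + k) :
    (P * jordanN n ^ k * Q) i j = if j.val = i.val + k then 1 else 0 := by
  have hterm : ∀ a b : Fin n, ¬ (a = i ∧ b = j ∧ j.val = i.val + k) →
      P i a * (jordanN n ^ k) a b * Q b j = 0 := by
    intro a b hab
    rw [jordanN_pow_apply]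
    by_cases h1 : b.val = a.val + k
    · by_cases h2 : a < i
      · rw [hP i a h2.le, if_neg h2.ne, zero_mul, zero_mul]
      · by_cases h3 : j < b
        · rw [hQ b j h3.le, if_neg h3.ne, mul_zero]
        · exfalso
          rw [Fin.lt_def] at h2 h3
          exact hab ⟨Fin.ext (by omega), Fin.ext (by omega), by omega⟩
    · rw [if_neg h1, mul_zero, zero_mul]
  simp only [Matrix.mul_apply, Finset.sum_mul]
  split_ifs with hk
  · rw [Finset.sum_eq_single j, Finset.sum_eq_single i]
    · rw [hP i i le_rfl, hQ j j le_rfl, jordanN_pow_apply, if_pos hk]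
      simp
    · exact fun a _ ha => hterm a j fun h => ha h.1
    · simp
    · exact fun b _ hb => Finset.sum_eq_zero fun a _ => hterm a b fun h => hb h.2.1
    · simp
  · exact Finset.sum_eq_zero fun b _ => Finset.sum_eq_zero fun a _ => hterm a b fun h => hk h.2.2

theorem unipotent_of_mul_eq_one {P Q : Matrix (Fin n) (Fin n) ℂ}
    (hP : ∀ i j : Fin n, j ≤ i → P i j = if j = i then 1 else 0) (h : P * Q = 1) (i j : Fin n)
    (hij : j ≤ i) : Q i j = if j = i then 1 else 0 := by
  have key : ∀ d, ∀ i : Fin n, n - i.val = d → ∀ j ≤ i, Q i j = if j = i then 1 else 0 := by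
    intro d
    induction d using Nat.strong_induction_on with
    | _ d ih =>
      intro i hi j hij
      have h1 := congrFun (congrFun h i) j
      rw [Matrix.mul_apply, Finset.sum_eq_single i, hP i i le_rfl, if_pos rfl, one_mul,
        Matrix.one_apply] at h1
      · rw [h1]
        simp only [eq_comm]
      · intro l _ hl
        rcases lt_or_gt_of_ne hl with hl | hl
        · rw [hP i l hl.le, if_neg hl.ne, zero_mul]
        · have hi2 := i.2
          rw [ih (n - l.val) (by rw [Fin.lt_def] at hl; omega) l rfl j
            (hij.trans (le_of_lt hl)), if_neg (lt_of_le_of_lt hij hl).ne, mul_zero]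
      · simp
  exact key _ i rfl j hij

/-- The coefficients of `z` of a matrix of power series. -/
noncomputable def linearTerm (M : Matrix (Fin n) (Fin n) ℂ⟦X⟧) : Matrix (Fin n) (Fin n) ℂ :=
  M.map (PowerSeries.coeff 1)

theorem linearTerm_mul (M M' : Matrix (Fin n) (Fin n) ℂ⟦X⟧) :
    linearTerm (M * M') = constTerm M * linearTerm M' + linearTerm M * constTerm M' := by
  ext1 i j
  simp only [linearTerm, Matrix.map_apply, Matrix.mul_apply, Matrix.add_apply, map_sum,
    RingHom.mapMatrix_apply, ← Finset.sum_add_distrib]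
  refine Finset.sum_congr rfl fun l _ => ?_
  rw [coeff_mul_range, Finset.sum_range_succ, Finset.sum_range_one]
  simp

theorem IsUnipotentGauge.constTerm_apply {Y : Matrix (Fin n) (Fin n) ℂ⟦X⟧}
    (hY : IsUnipotentGauge Y) (i j : Fin n) (h : j ≤ i) :
    constTerm Y i j = if j = i then 1 else 0 := by
  rw [RingHom.mapMatrix_apply, Matrix.map_apply, ← PowerSeries.coeff_zero_eq_constantCoeff_apply,
    hY i j h]

theorem constTerm_tailPart (M : Matrix (Fin n) (Fin n) ℂ⟦X⟧) : constTerm (tailPart r M) = 0 := by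
  ext1 i j
  rw [RingHom.mapMatrix_apply, Matrix.map_apply, ← PowerSeries.coeff_zero_eq_constantCoeff_apply,
    coeff_tailPart, if_pos rfl, Matrix.zero_apply]

variable [NeZero n]

theorem linearTerm_shiftW_pow_apply {i j : Fin n} (hi : i.val + 1 = n) (hj : j.val = 0) (k : ℕ) :
    linearTerm (shiftW n ℂ ^ k) i j = if k = 1 then 1 else 0 := by
  rw [linearTerm, Matrix.map_apply, ← coeff_rowSeries, rowSeries_shiftW_pow,
    PowerSeries.coeff_X_pow]
  refine if_congr ?_ rfl rfl
  omega

/-- The velocities are tangent to the admissible connections. -/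
theorem isAdmissible_velocity {Â Y Y' : Matrix (Fin n) (Fin n) ℂ⟦X⟧} {β₀ β₁ : ℂ} (hr : 2 ≤ r)
    (hA : IsAdmissible Â β₀ β₁) (hY : IsUnipotentGauge Y) (hYY : Y * Y' = 1) {J : ℕ}
    (hJ : J ≠ 0) :
    IsAdmissible (velocity r J Â (dressed n r Y Y' J)) (if r * n - J = 0 then 1 else 0)
      (if r * n - J = 1 then 1 else 0) := by
  have hJc : (J : ℂ) ≠ 0 := by exact_mod_cast hJ
  set k := r * n - J with hk
  set M := Y * shiftW n ℂ ^ k * Y' with hM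
  have hΘ : PowerSeries.C (J : ℂ) • dressed n r Y Y' J = M := by
    rw [dressed, smul_smul, ← map_mul, mul_inv_cancel₀ hJc, map_one, one_smul]
  have hP := hY.constTerm_apply
  have hPQ : constTerm Y * constTerm Y' = 1 := by rw [← map_mul, hYY, map_one]
  have hQ := unipotent_of_mul_eq_one hP hPQ
  set Ξ := tailPart r (dressed n r Y Y' J)
  have hc0 : constTerm (velocity r J Â (dressed n r Y Y' J)) =
      constTerm Y * jordanN n ^ k * constTerm Y' := by
    rw [velocity, hΘ, map_add, map_add, map_sub, map_mul constTerm Â, map_mul constTerm _ Â,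
      constTerm_tailPart, constTerm_smul, map_mul PowerSeries.constantCoeff, map_pow, PowerSeries.constantCoeff_X, zero_pow (by omega), mul_zero, mul_zero,
      zero_mul, zero_smul, sub_zero, add_zero, add_zero, hM, map_mul, map_mul, map_pow,
      constTerm_shiftW]
  have hcc : ∀ i j, PowerSeries.coeff 0 (velocity r J Â (dressed n r Y Y' J) i j) =
      (constTerm Y * jordanN n ^ k * constTerm Y') i j := by
    intro i j
    rw [← hc0, RingHom.mapMatrix_apply, Matrix.map_apply,
      PowerSeries.coeff_zero_eq_constantCoeff_apply]
  refine ⟨fun i j h => ?_, fun i => ?_, fun i j h => ?_, fun i j hi hj => ?_⟩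
  · rw [Fin.lt_def] at h
    rw [hcc, unipotent_mul_jordanN_pow_mul hP hQ (by omega), if_neg (by omega)]
  · rw [hcc, unipotent_mul_jordanN_pow_mul hP hQ (by omega)]
    exact if_congr (by omega) rfl rfl
  · rw [hcc]
    -- For `k = 0` the position lies above the superdiagonal controlled by the unipotent factors,
    -- and the relation that the factors are mutually inverse is needed instead.
    by_cases hk0 : k = 0
    · rw [hk0, pow_zero, mul_one, hPQ, Matrix.one_apply, if_neg (by rw [Fin.ext_iff]; omega),
        if_neg (by omega)]
    · rw [unipotent_mul_jordanN_pow_mul hP hQ (by omega)]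
      exact if_congr (by omega) rfl rfl
  · have hlin : PowerSeries.coeff 1 (velocity r J Â (dressed n r Y Y' J) i j) =
        linearTerm M i j + ((constTerm Â * linearTerm Ξ) i j - (linearTerm Ξ * constTerm Â) i j) := by
      have e1 : (constTerm Â * linearTerm Ξ) i j = PowerSeries.coeff 1 ((Â * Ξ) i j) := by
        have := congrFun (congrFun (linearTerm_mul Â Ξ) i) j
        rw [constTerm_tailPart, mul_zero, add_zero] at this
        exact this.symm
      have e2 : (linearTerm Ξ * constTerm Â) i j = PowerSeries.coeff 1 ((Ξ * Â) i j) := by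
        have := congrFun (congrFun (linearTerm_mul Ξ Â) i) j
        rw [constTerm_tailPart, zero_mul, zero_add] at this
        exact this.symm
      rw [velocity, hΘ, Matrix.add_apply, Matrix.add_apply, map_add, map_add, Matrix.sub_apply,
        map_sub, e1, e2, mul_comm (n : ℂ⟦X⟧), mul_smul, coeff_X_pow_smul_matrix,
        if_neg (by omega), add_zero]
      rfl
    have hl : ∀ l : Fin n, l ≠ i → l < i := fun l hl => by
      rw [Fin.lt_def]
      have := l.2
      have : l.val ≠ i.val := fun h => hl (Fin.ext h)
      omega
    have hg : ∀ l : Fin n, l ≠ j → j < l := fun l hl => by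
      rw [Fin.lt_def]
      have : l.val ≠ j.val := fun h => hl (Fin.ext h)
      omega
    have hA0 : ∀ i j, constTerm Â i j = PowerSeries.coeff 0 (Â i j) := fun i j => by
      rw [RingHom.mapMatrix_apply, Matrix.map_apply,
        PowerSeries.coeff_zero_eq_constantCoeff_apply]
    -- The last row and the first column of the triangular constant term contain only the diagonal
    -- value `β₀`. Hence the bracket with the tail does not contribute to the corner.
    have h1 : (constTerm Â * linearTerm Ξ) i j = β₀ * linearTerm Ξ i j := by
      rw [Matrix.mul_apply, Finset.sum_eq_single i, hA0, hA.diag]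
      · intro l _ h
        rw [hA0, hA.lower i l (hl l h), zero_mul]
      · simp
    have h2 : (linearTerm Ξ * constTerm Â) i j = β₀ * linearTerm Ξ i j := by
      rw [Matrix.mul_apply, Finset.sum_eq_single j, hA0, hA.diag, mul_comm]
      · intro l _ h
        rw [hA0, hA.lower l j (hg l h), mul_zero]
      · simp
    rw [hlin, h1, h2, sub_self, add_zero]
    have hrow : ∀ B : Matrix (Fin n) (Fin n) ℂ, (constTerm Y * B) i j = B i j := by
      intro B
      rw [Matrix.mul_apply, Finset.sum_eq_single i, hP i i le_rfl, if_pos rfl, one_mul]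
      · intro l _ h
        rw [hP i l (hl l h).le, if_neg h, zero_mul]
      · simp
    have hcol : ∀ B : Matrix (Fin n) (Fin n) ℂ, (B * constTerm Y') i j = B i j := by
      intro B
      rw [Matrix.mul_apply, Finset.sum_eq_single j, hQ j j le_rfl, if_pos rfl, mul_one]
      · intro l _ h
        rw [hQ l j (hg l h).le, if_neg h.symm, mul_zero]
      · simp
    by_cases hk0 : k = 0
    · rw [hM, hk0, pow_zero, mul_one, hYY, if_neg (by omega), linearTerm, Matrix.map_apply,
        Matrix.one_apply]
      split_ifs
      · rw [PowerSeries.coeff_one, if_neg one_ne_zero]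
      · rw [map_zero]
    · rw [hM, linearTerm_mul, Matrix.add_apply, linearTerm_mul, add_mul, Matrix.add_apply, map_mul,
        map_pow, constTerm_shiftW, mul_assoc, hrow, hcol, hrow,
        linearTerm_shiftW_pow_apply hi hj]
      have z1 : (jordanN n ^ k * linearTerm Y') i j = 0 := by
        rw [Matrix.mul_apply]
        refine Finset.sum_eq_zero fun l _ => ?_
        rw [jordanN_pow_apply, if_neg (by omega), zero_mul]
      have z2 : (linearTerm Y * jordanN n ^ k * constTerm Y') i j = 0 := by
        rw [hcol, Matrix.mul_apply]
        refine Finset.sum_eq_zero fun l _ => ?_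
        rw [jordanN_pow_apply, if_neg (by omega), mul_zero]
      rw [z1, z2, zero_add, add_zero]

end Tangency

/-! ### Coefficientwise derivatives and the motion of the gauge -/

section SeriesDerivative

open scoped PowerSeries
open Topology

variable {n r : ℕ}

/-- A one-parameter family of matrices of power series has the derivative `M'`, coefficientwise. -/
def HasDerivSeries (M : ℂ → Matrix (Fin n) (Fin n) ℂ⟦X⟧) (M' : Matrix (Fin n) (Fin n) ℂ⟦X⟧)
    (s₀ : ℂ) : Prop :=
  ∀ i j k, HasDerivAt (fun s => PowerSeries.coeff k (M s i j)) (PowerSeries.coeff k (M' i j)) s₀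

variable {M N : ℂ → Matrix (Fin n) (Fin n) ℂ⟦X⟧} {M' N' : Matrix (Fin n) (Fin n) ℂ⟦X⟧} {s₀ : ℂ}

theorem HasDerivSeries.unique (h : HasDerivSeries M M' s₀) (h' : HasDerivSeries M N' s₀) :
    M' = N' := by
  ext i j k
  exact (h i j k).unique (h' i j k)

theorem HasDerivSeries.congr_of_eventuallyEq (h : HasDerivSeries M M' s₀) (h' : N =ᶠ[𝓝 s₀] M) :
    HasDerivSeries N M' s₀ := fun i j k =>
  (h i j k).congr_of_eventuallyEq (h'.mono fun s hs => by simp only [hs])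

theorem hasDerivSeries_const (B : Matrix (Fin n) (Fin n) ℂ⟦X⟧) :
    HasDerivSeries (fun _ => B) 0 s₀ := fun i j k => by
  rw [Matrix.zero_apply, map_zero]
  exact hasDerivAt_const _ _

theorem HasDerivSeries.add (h : HasDerivSeries M M' s₀) (h' : HasDerivSeries N N' s₀) :
    HasDerivSeries (fun s => M s + N s) (M' + N') s₀ := fun i j k => by
  simp only [Matrix.add_apply, map_add]
  exact (h i j k).add (h' i j k)

theorem HasDerivSeries.sub (h : HasDerivSeries M M' s₀) (h' : HasDerivSeries N N' s₀) :
    HasDerivSeries (fun s => M s - N s) (M' - N') s₀ := fun i j k => by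
  simp only [Matrix.sub_apply, map_sub]
  exact (h i j k).sub (h' i j k)

theorem HasDerivSeries.mul (h : HasDerivSeries M M' s₀) (h' : HasDerivSeries N N' s₀) :
    HasDerivSeries (fun s => M s * N s) (M' * N s₀ + M s₀ * N') s₀ := fun i j k => by
  simp only [Matrix.add_apply, Matrix.mul_apply, map_add, map_sum, PowerSeries.coeff_mul,
    ← Finset.sum_add_distrib]
  exact HasDerivAt.fun_sum fun l _ => HasDerivAt.fun_sum fun x _ => (h i l x.1).mul (h' l j x.2)

theorem HasDerivSeries.smul (f : ℂ⟦X⟧) (h : HasDerivSeries M M' s₀) :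
    HasDerivSeries (fun s => f • M s) (f • M') s₀ := fun i j k => by
  simp only [Matrix.smul_apply, smul_eq_mul, PowerSeries.coeff_mul]
  exact HasDerivAt.fun_sum fun x _ => (h i j x.2).const_mul _

theorem HasDerivSeries.euler (h : HasDerivSeries M M' s₀) :
    HasDerivSeries (fun s => euler (M s)) (euler M') s₀ := fun i j k => by
  simp only [coeff_euler]
  exact (h i j k).const_mul _

theorem HasDerivSeries.gradDer (h : HasDerivSeries M M' s₀) :
    HasDerivSeries (fun s => gradDer (M s)) (gradDer M') s₀ := by
  have := (h.euler.smul (n : ℂ⟦X⟧)).add (h.mul (hasDerivSeries_const (gradG n ℂ)))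
  rwa [mul_zero, add_zero] at this

theorem HasDerivSeries.lowPart (r : ℕ) (h : HasDerivSeries M M' s₀) :
    HasDerivSeries (fun s => lowPart r (M s)) (lowPart r M') s₀ := fun i j k => by
  simp only [coeff_lowPart]
  split_ifs
  · exact h i j k
  · exact hasDerivAt_const _ _

theorem HasDerivSeries.tailPart (r : ℕ) (h : HasDerivSeries M M' s₀) :
    HasDerivSeries (fun s => tailPart r (M s)) (tailPart r M') s₀ := fun i j k => by
  simp only [coeff_tailPart]
  split_ifs
  · exact hasDerivAt_const _ _
  · exact h i j _

theorem hasDerivSeries_polyW (N : ℕ) {p : ℂ → ℂ⟦X⟧} {p' : ℂ⟦X⟧}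
    (h : ∀ k, HasDerivAt (fun s => PowerSeries.coeff k (p s)) (PowerSeries.coeff k p') s₀) :
    HasDerivSeries (fun s => polyW n N (p s)) (polyW n N p') s₀ := fun i j k => by
  simp only [polyW, Matrix.sum_apply, map_sum, coeff_C_smul_matrix]
  exact HasDerivAt.fun_sum fun m _ => (h m).mul_const _

theorem polyW_sub (N : ℕ) (p q : ℂ⟦X⟧) : polyW n N (p - q) = polyW n N p - polyW n N q := by
  simp only [polyW, map_sub, sub_smul, Finset.sum_sub_distrib]

theorem polyW_X_pow {N k : ℕ} (hk : k ≤ N) : polyW n N (PowerSeries.X ^ k : ℂ⟦X⟧) = shiftW n ℂ ^ k := by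
  rw [polyW, Finset.sum_eq_single k]
  · simp
  · intro m _ hm
    rw [PowerSeries.coeff_X_pow, if_neg hm, map_zero, zero_smul]
  · intro h
    exact absurd (Finset.mem_range.2 (by omega)) h

variable [NeZero n]

/-- The motion of the formal gauge and of the exponents when the connection moves along a flow. -/
theorem deriv_gauge_of_flow {B Y Y' : ℂ → Matrix (Fin n) (Fin n) ℂ⟦X⟧} {p : ℂ → ℂ⟦X⟧}
    {D D' : Matrix (Fin n) (Fin n) ℂ⟦X⟧} {d : ℂ⟦X⟧} {β₀ β₁ : ℂ} {J : ℕ} (hN : 2 ≤ r * n)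
    (hJ : J ≠ 0) (hJN : J ≤ r * n)
    (hev : ∀ᶠ s in 𝓝 s₀, IsUnipotentGauge (Y s) ∧ Y s * Y' s = 1 ∧
      (∀ k, r * n < k → PowerSeries.coeff k (p s) = 0) ∧ FormalEq r (B s) (Y s) (p s))
    (hadm : IsAdmissible (B s₀) β₀ β₁) (hβ : β₁ ≠ 0)
    (hB : HasDerivSeries B (velocity r J (B s₀) (dressed n r (Y s₀) (Y' s₀) J)) s₀)
    (hY : HasDerivSeries Y D s₀) (hY' : HasDerivSeries Y' D' s₀)
    (hp : ∀ k, HasDerivAt (fun s => PowerSeries.coeff k (p s)) (PowerSeries.coeff k d) s₀) :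
    D = -(tailPart r (dressed n r (Y s₀) (Y' s₀) J) * Y s₀) ∧
      D' = Y' s₀ * tailPart r (dressed n r (Y s₀) (Y' s₀) J) ∧
      d = PowerSeries.X ^ (r * n - J) := by
  obtain ⟨hU, hYY, hpt, hE⟩ := hev.self_of_nhds
  have hYY' : Y' s₀ * Y s₀ = 1 := mul_eq_one_comm.1 hYY
  set Θ := dressed n r (Y s₀) (Y' s₀) J with hΘ
  set Ξ := tailPart r Θ with hΞ
  -- The formal equation, differentiated along the curve.
  have h1 : velocity r J (B s₀) Θ * Y s₀ + B s₀ * D + (PowerSeries.X ^ r : ℂ⟦X⟧) • gradDer D =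
      D * polyW n (r * n) (p s₀) + Y s₀ * polyW n (r * n) d :=
    ((hB.mul hY).add (hY.gradDer.smul _)).unique
      ((hY.mul (hasDerivSeries_polyW (r * n) hp)).congr_of_eventuallyEq
        (hev.mono fun s hs => hs.2.2.2))
  have h2 : PowerSeries.C (J : ℂ) • Θ * Y s₀ = Y s₀ * shiftW n ℂ ^ (r * n - J) := by
    rw [smul_mul_assoc, hΘ, dressed_mul hYY', smul_smul, ← map_mul,
      mul_inv_cancel₀ (by exact_mod_cast hJ), map_one, one_smul]
  -- Adding `Ξ Y` to `D` absorbs the bracket and the Euler term of the velocity, while its term `J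
  -- Θ` turns into `Y W^{rn-J}`. The sum therefore solves the linearized equation with the source `d
  -- - s^{rn-J}`, and linearized uniqueness makes both vanish.
  have h3 : B s₀ * (D + Ξ * Y s₀) + (PowerSeries.X ^ r : ℂ⟦X⟧) • gradDer (D + Ξ * Y s₀) =
      (D + Ξ * Y s₀) * polyW n (r * n) (p s₀) +
        Y s₀ * polyW n (r * n) (d - PowerSeries.X ^ (r * n - J)) := by
    have hadd : gradDer (D + Ξ * Y s₀) = gradDer D + gradDer (Ξ * Y s₀) := by
      simp only [gradDer, euler_add, smul_add, add_mul]
      abel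
    have hE' : (PowerSeries.X ^ r : ℂ⟦X⟧) • gradDer (Y s₀) =
        Y s₀ * polyW n (r * n) (p s₀) - B s₀ * Y s₀ := eq_sub_of_add_eq' hE
    rw [polyW_sub, polyW_X_pow (Nat.sub_le _ _), mul_sub, ← h2, hadd, gradDer_mul, smul_add,
      smul_add, ← mul_smul_comm _ Ξ, hE', smul_smul, mul_comm _ (n : ℂ⟦X⟧)]
    have h4 := h1
    rw [velocity, ← hΞ] at h4
    simp only [add_mul, sub_mul, mul_add, mul_sub, smul_mul_assoc, mul_assoc] at h4 ⊢
    linear_combination (norm := abel) h4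
  have hZ : ∀ i j : Fin n, j ≤ i → PowerSeries.coeff 0 ((D + Ξ * Y s₀) i j) = 0 := by
    intro i j hij
    have e1 : PowerSeries.coeff 0 (D i j) = 0 := by
      refine (hY i j 0).unique ((hasDerivAt_const s₀ (if j = i then (1 : ℂ) else 0)).congr_of_eventuallyEq
        (hev.mono fun s hs => hs.1 i j hij))
    have e2 : PowerSeries.coeff 0 ((Ξ * Y s₀) i j) = 0 := by
      have : constTerm (Ξ * Y s₀) = 0 := by rw [map_mul, constTerm_tailPart, zero_mul]
      rw [PowerSeries.coeff_zero_eq_constantCoeff_apply]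
      exact congrFun (congrFun this i) j
    rw [Matrix.add_apply, map_add, e1, e2, add_zero]
  have hd : ∀ k, r * n < k → PowerSeries.coeff k (d - PowerSeries.X ^ (r * n - J)) = 0 := by
    intro k hk
    rw [map_sub, PowerSeries.coeff_X_pow, if_neg (by omega), sub_zero]
    exact (hp k).unique ((hasDerivAt_const s₀ (0 : ℂ)).congr_of_eventuallyEq
        (hev.mono fun s hs => hs.2.2.1 k hk))
  obtain ⟨hZ0, hq0⟩ := eq_zero_of_linearized hadm hβ hN hpt hd hU hE hZ h3
  have hD : D = -(Ξ * Y s₀) := eq_neg_of_add_eq_zero_left hZ0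
  refine ⟨hD, ?_, sub_eq_zero.1 hq0⟩
  have h5 : D * Y' s₀ + Y s₀ * D' = 0 :=
    (hY.mul hY').unique ((hasDerivSeries_const 1).congr_of_eventuallyEq
      (hev.mono fun s hs => hs.2.1))
  have h6 := congrArg (Y' s₀ * ·) h5
  simp only [mul_add, ← mul_assoc, hYY', one_mul, mul_zero, hD, mul_neg, neg_mul] at h6
  rw [mul_assoc _ (Y s₀), hYY, mul_one] at h6
  exact (neg_add_eq_zero.1 h6).symm

/-- Only the conjugating gauge moves, with the velocity `-Ξ Y`; so the conjugate of a fixed power of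
`W` moves by a commutator with `Ξ`. -/
theorem hasDerivSeries_dressed {Y Y' : ℂ → Matrix (Fin n) (Fin n) ℂ⟦X⟧}
    {D D' : Matrix (Fin n) (Fin n) ℂ⟦X⟧} (hY : HasDerivSeries Y D s₀)
    (hY' : HasDerivSeries Y' D' s₀) (K : ℕ) {Ξ : Matrix (Fin n) (Fin n) ℂ⟦X⟧}
    (hD : D = -(Ξ * Y s₀)) (hD' : D' = Y' s₀ * Ξ) :
    HasDerivSeries (fun s => dressed n r (Y s) (Y' s) K)
      (dressed n r (Y s₀) (Y' s₀) K * Ξ - Ξ * dressed n r (Y s₀) (Y' s₀) K) s₀ := by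
  have h := ((hY.mul (hasDerivSeries_const (shiftW n ℂ ^ (r * n - K)))).mul hY').smul
    (PowerSeries.C (K : ℂ)⁻¹)
  change HasDerivSeries (fun s => PowerSeries.C (K : ℂ)⁻¹ •
    (Y s * shiftW n ℂ ^ (r * n - K) * Y' s)) _ _
  convert h using 1
  rw [hD, hD', mul_zero, add_zero, dressed, smul_mul_assoc, mul_smul_comm, ← smul_sub]
  congr 1
  simp only [neg_mul, mul_assoc]
  abel

theorem HasDerivSeries.velocity {B Θ : ℂ → Matrix (Fin n) (Fin n) ℂ⟦X⟧}
    {B' Θ' : Matrix (Fin n) (Fin n) ℂ⟦X⟧} (hB : HasDerivSeries B B' s₀)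
    (hΘ : HasDerivSeries Θ Θ' s₀) (J : ℕ) :
    ∃ G, HasDerivSeries (fun s => velocity r J (B s) (Θ s)) G s₀ :=
  ⟨_, ((hΘ.smul _).add ((hB.mul (hΘ.tailPart r)).sub ((hΘ.tailPart r).mul hB))).add
    ((hΘ.tailPart r).euler.smul _)⟩

end SeriesDerivative

/-! ### Smooth families of series -/

section SmoothSeries

open scoped PowerSeries

variable {n r : ℕ} {E : Type*} [NormedAddCommGroup E] [NormedSpace ℂ E]

/-- All coefficients of a family of matrices of power series are of class `C^m` at `x`. -/
def ContDiffSeriesAt (m : WithTop ℕ∞) (M : E → Matrix (Fin n) (Fin n) ℂ⟦X⟧) (x : E) : Prop :=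
  ∀ i j k, ContDiffAt ℂ m (fun v => PowerSeries.coeff k (M v i j)) x

variable {m : WithTop ℕ∞} {M N : E → Matrix (Fin n) (Fin n) ℂ⟦X⟧} {x : E}

theorem contDiffSeriesAt_const (B : Matrix (Fin n) (Fin n) ℂ⟦X⟧) :
    ContDiffSeriesAt m (fun _ : E => B) x := fun _ _ _ => contDiffAt_const

theorem ContDiffSeriesAt.add (h : ContDiffSeriesAt m M x) (h' : ContDiffSeriesAt m N x) :
    ContDiffSeriesAt m (fun v => M v + N v) x := fun i j k => by
  simp only [Matrix.add_apply, map_add]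
  exact (h i j k).add (h' i j k)

theorem ContDiffSeriesAt.sub (h : ContDiffSeriesAt m M x) (h' : ContDiffSeriesAt m N x) :
    ContDiffSeriesAt m (fun v => M v - N v) x := fun i j k => by
  simp only [Matrix.sub_apply, map_sub]
  exact (h i j k).sub (h' i j k)

theorem ContDiffSeriesAt.mul (h : ContDiffSeriesAt m M x) (h' : ContDiffSeriesAt m N x) :
    ContDiffSeriesAt m (fun v => M v * N v) x := fun i j k => by
  simp only [Matrix.mul_apply, map_sum, PowerSeries.coeff_mul]
  exact ContDiffAt.sum fun l _ => ContDiffAt.sum fun y _ => (h i l y.1).mul (h' l j y.2)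

theorem ContDiffSeriesAt.smul (f : ℂ⟦X⟧) (h : ContDiffSeriesAt m M x) :
    ContDiffSeriesAt m (fun v => f • M v) x := fun i j k => by
  simp only [Matrix.smul_apply, smul_eq_mul, PowerSeries.coeff_mul]
  exact ContDiffAt.sum fun y _ => contDiffAt_const.mul (h i j y.2)

theorem ContDiffSeriesAt.euler (h : ContDiffSeriesAt m M x) :
    ContDiffSeriesAt m (fun v => euler (M v)) x := fun i j k => by
  simp only [coeff_euler]
  exact contDiffAt_const.mul (h i j k)

theorem ContDiffSeriesAt.tailPart (r : ℕ) (h : ContDiffSeriesAt m M x) :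
    ContDiffSeriesAt m (fun v => tailPart r (M v)) x := fun i j k => by
  simp only [coeff_tailPart]
  split_ifs
  · exact contDiffAt_const
  · exact h i j _

theorem ContDiffSeriesAt.dressed (h : ContDiffSeriesAt m M x) (h' : ContDiffSeriesAt m N x)
    (J : ℕ) : ContDiffSeriesAt m (fun v => dressed n r (M v) (N v) J) x :=
  ((h.mul (contDiffSeriesAt_const _)).mul h').smul _

theorem ContDiffSeriesAt.velocity (h : ContDiffSeriesAt m M x) (h' : ContDiffSeriesAt m N x)
    (J : ℕ) : ContDiffSeriesAt m (fun v => velocity r J (M v) (N v)) x :=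
  ((h'.smul _).add ((h.mul (h'.tailPart r)).sub ((h'.tailPart r).mul h))).add
    ((h'.tailPart r).euler.smul _)

theorem ContDiffSeriesAt.hasDerivSeries_comp (h : ContDiffSeriesAt m M x) (hm : m ≠ 0)
    {c : ℂ → E} {w : E} {s₀ : ℂ} (hc : HasDerivAt c w s₀) (hx : c s₀ = x) :
    HasDerivSeries (fun s => M (c s))
      (Matrix.of fun i j => PowerSeries.mk fun k =>
        fderiv ℂ (fun v => PowerSeries.coeff k (M v i j)) x w) s₀ := fun i j k => by
  rw [Matrix.of_apply, PowerSeries.coeff_mk]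
  subst hx
  exact ((h i j k).differentiableAt hm).hasFDerivAt.comp_hasDerivAt s₀ hc

end SmoothSeries

/-! ### The flows as commuting vector fields on the parameters -/

section Chart

open scoped PowerSeries
open Topology

variable {n r : ℕ} [NeZero n] (hr : 2 ≤ r)

/-- The formal gauge of the generic admissible connection. -/
noncomputable def genGauge : (Fin r × Fin n × Fin n → ℂ) → Matrix (Fin n) (Fin n) ℂ⟦X⟧ :=
  (exists_generic n hr).choose

/-- The inverse of the generic formal gauge. -/
noncomputable def genInv : (Fin r × Fin n × Fin n → ℂ) → Matrix (Fin n) (Fin n) ℂ⟦X⟧ :=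
  (exists_generic n hr).choose_spec.choose

/-- The normal form of the generic admissible connection. -/
noncomputable def genNormal : (Fin r × Fin n × Fin n → ℂ) → ℂ⟦X⟧ :=
  (exists_generic n hr).choose_spec.choose_spec.choose

theorem gen_spec : (∀ v : Fin r × Fin n × Fin n → ℂ, v (cornerIdx n hr) ≠ 0 →
      IsUnipotentGauge (genGauge hr v) ∧ genGauge hr v * genInv hr v = 1 ∧
        (∀ k, r * n < k → PowerSeries.coeff k (genNormal hr v) = 0) ∧
        FormalEq r (admSeries hr v) (genGauge hr v) (genNormal hr v)) ∧
      (∀ (i j : Fin n) k, IsCornerRational hr fun v => PowerSeries.coeff k (genGauge hr v i j)) ∧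
      (∀ (i j : Fin n) k, IsCornerRational hr fun v => PowerSeries.coeff k (genInv hr v i j)) ∧
      ∀ k, IsCornerRational (n := n) hr fun v => PowerSeries.coeff k (genNormal hr v) :=
  (exists_generic n hr).choose_spec.choose_spec.choose_spec

/-- The nonnegative flows, as vector fields in the parameters. -/
noncomputable def genField (J : ℕ) (v : Fin r × Fin n × Fin n → ℂ) : Fin r × Fin n × Fin n → ℂ :=
  paramsOf r (velocity r J (admSeries hr v) (dressed n r (genGauge hr v) (genInv hr v) J))

variable {hr} {v : Fin r × Fin n × Fin n → ℂ}

theorem genInv_mul (hv : v (cornerIdx n hr) ≠ 0) : genInv hr v * genGauge hr v = 1 :=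
  mul_eq_one_comm.1 ((gen_spec hr).1 v hv).2.1

theorem corner_ne_zero (hv : v (cornerIdx n hr) ≠ 0) : (n : ℂ) * v (cornerIdx n hr) ≠ 0 :=
  mul_ne_zero (by exact_mod_cast NeZero.ne n) hv

theorem coeff_admSeries_eq_zero (v : Fin r × Fin n × Fin n → ℂ) (i j : Fin n) (k : ℕ) (hk : r ≤ k) :
    PowerSeries.coeff k (admSeries hr v i j) = 0 := by
  rw [coeff_admSeries, if_neg (by omega)]

/-- A velocity is the series of a parameter vector because it has the admissible form
(`isAdmissible_velocity`) and stops before the order `r` (`coeff_velocity_eq_zero`). -/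
theorem admSeries_genField (hv : v (cornerIdx n hr) ≠ 0) {J : ℕ} (hJ : J ≠ 0) (hJN : J ≤ r * n) :
    admSeries hr (genField hr J v) =
      velocity r J (admSeries hr v) (dressed n r (genGauge hr v) (genInv hr v) J) := by
  obtain ⟨hU, hYY, hp, hE⟩ := (gen_spec hr).1 v hv
  exact admSeries_paramsOf hr (isAdmissible_velocity hr (isAdmissible_admSeries hr v) hU hYY hJ)
    (coeff_velocity_eq_zero (genInv_mul hv) hE (by omega) (coeff_admSeries_eq_zero v) hJN)

theorem contDiffSeriesAt_genGauge (hv : v (cornerIdx n hr) ≠ 0) (m : WithTop ℕ∞) :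
    ContDiffSeriesAt m (genGauge hr) v :=
  fun i j k => ((gen_spec hr).2.1 i j k).contDiffAt hv m

theorem contDiffSeriesAt_genInv (hv : v (cornerIdx n hr) ≠ 0) (m : WithTop ℕ∞) :
    ContDiffSeriesAt m (genInv hr) v :=
  fun i j k => ((gen_spec hr).2.2.1 i j k).contDiffAt hv m

theorem contDiffAt_genNormal (hv : v (cornerIdx n hr) ≠ 0) (m : WithTop ℕ∞) (k : ℕ) :
    ContDiffAt ℂ m (fun v => PowerSeries.coeff k (genNormal hr v)) v :=
  ((gen_spec hr).2.2.2 k).contDiffAt hv m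

theorem contDiffSeriesAt_admSeries (m : WithTop ℕ∞) : ContDiffSeriesAt m (admSeries hr) v := by
  intro i j k
  simp only [coeff_admSeries, admCoeff, Matrix.of_apply]
  split_ifs
  all_goals first
    | exact contDiffAt_const
    | exact contDiffAt_const.mul contDiffAt_const
    | exact contDiffAt_const.mul (contDiff_apply ℂ ℂ _).contDiffAt

theorem contDiffSeriesAt_dressed_gen (hv : v (cornerIdx n hr) ≠ 0) (m : WithTop ℕ∞) (J : ℕ) :
    ContDiffSeriesAt m (fun v => dressed n r (genGauge hr v) (genInv hr v) J) v :=
  (contDiffSeriesAt_genGauge hv m).dressed (contDiffSeriesAt_genInv hv m) J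

theorem contDiffAt_genField (hv : v (cornerIdx n hr) ≠ 0) (m : WithTop ℕ∞) (J : ℕ) :
    ContDiffAt ℂ m (genField hr J) v := by
  refine contDiffAt_pi.2 fun x => ?_
  exact contDiffAt_const.mul
    ((contDiffSeriesAt_admSeries m).velocity (contDiffSeriesAt_dressed_gen hv m J) J _ _ _)

theorem eventually_corner_ne_zero {E : Type*} [TopologicalSpace E]
    {c : E → Fin r × Fin n × Fin n → ℂ} {s₀ : E} (hc : ContinuousAt c s₀)
    (hv : c s₀ (cornerIdx n hr) ≠ 0) : ∀ᶠ s in 𝓝 s₀, c s (cornerIdx n hr) ≠ 0 :=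
  ((continuous_apply (cornerIdx n hr)).continuousAt.comp hc).eventually_ne hv

theorem hasDerivSeries_admSeries {c : ℂ → Fin r × Fin n × Fin n → ℂ}
    {w : Fin r × Fin n × Fin n → ℂ} {s₀ : ℂ} (hc : HasDerivAt c w s₀) :
    HasDerivSeries (fun s => admSeries hr (c s)) (admSeries hr w) s₀ := by
  intro i j k
  have hx : ∀ x, HasDerivAt (fun s => c s x) (w x) s₀ := hasDerivAt_pi.1 hc
  simp only [coeff_admSeries, admCoeff, Matrix.of_apply]
  split_ifs
  all_goals first
    | exact (hx _).const_mul _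
    | simpa using hasDerivAt_const s₀ (0 : ℂ)

variable {c : ℂ → Fin r × Fin n × Fin n → ℂ} {s₀ : ℂ} {J : ℕ}

/-- The formal gauge and the exponents along a curve tangent to a flow. -/
theorem hasDerivSeries_gen_of_flow (hv : c s₀ (cornerIdx n hr) ≠ 0) (hJ : J ≠ 0)
    (hJN : J ≤ r * n) (hc : HasDerivAt c (genField hr J (c s₀)) s₀) :
    HasDerivSeries (fun s => genGauge hr (c s)) (-(tailPart r (dressed n r (genGauge hr (c s₀))
      (genInv hr (c s₀)) J) * genGauge hr (c s₀))) s₀ ∧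
    HasDerivSeries (fun s => genInv hr (c s)) (genInv hr (c s₀) *
      tailPart r (dressed n r (genGauge hr (c s₀)) (genInv hr (c s₀)) J)) s₀ ∧
    ∀ k, HasDerivAt (fun s => PowerSeries.coeff k (genNormal hr (c s)))
      (PowerSeries.coeff k (PowerSeries.X ^ (r * n - J) : ℂ⟦X⟧)) s₀ := by
  have hY := (contDiffSeriesAt_genGauge hv 1).hasDerivSeries_comp one_ne_zero hc rfl
  have hY' := (contDiffSeriesAt_genInv hv 1).hasDerivSeries_comp one_ne_zero hc rfl
  have hp : ∀ k, HasDerivAt (fun s => PowerSeries.coeff k (genNormal hr (c s)))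
      (PowerSeries.coeff k (PowerSeries.mk fun k =>
        fderiv ℂ (fun v => PowerSeries.coeff k (genNormal hr v)) (c s₀) (genField hr J (c s₀)))) s₀ := by
    intro k
    rw [PowerSeries.coeff_mk]
    exact ((contDiffAt_genNormal hv 1 k).differentiableAt one_ne_zero).hasFDerivAt.comp_hasDerivAt
      s₀ hc
  have hB := hasDerivSeries_admSeries (hr := hr) hc
  rw [admSeries_genField hv hJ hJN] at hB
  obtain ⟨h1, h2, h3⟩ := deriv_gauge_of_flow (two_le_mul_card hr) hJ hJN
    ((eventually_corner_ne_zero hc.continuousAt hv).mono fun s hs => (gen_spec hr).1 (c s) hs)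
    (isAdmissible_admSeries hr (c s₀)) (corner_ne_zero hv) hB hY hY' hp
  rw [h1] at hY
  rw [h2] at hY'
  rw [h3] at hp
  exact ⟨hY, hY', hp⟩

theorem hasDerivSeries_dressed_gen (hv : c s₀ (cornerIdx n hr) ≠ 0) (hJ : J ≠ 0)
    (hJN : J ≤ r * n) (hc : HasDerivAt c (genField hr J (c s₀)) s₀) (K : ℕ) :
    HasDerivSeries (fun s => dressed n r (genGauge hr (c s)) (genInv hr (c s)) K)
      (dressed n r (genGauge hr (c s₀)) (genInv hr (c s₀)) K *
          tailPart r (dressed n r (genGauge hr (c s₀)) (genInv hr (c s₀)) J) -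
        tailPart r (dressed n r (genGauge hr (c s₀)) (genInv hr (c s₀)) J) *
          dressed n r (genGauge hr (c s₀)) (genInv hr (c s₀)) K) s₀ := by
  obtain ⟨h1, h2, -⟩ := hasDerivSeries_gen_of_flow hv hJ hJN hc
  exact hasDerivSeries_dressed h1 h2 K rfl rfl

theorem smul_deriv_velocity {B Θ G : ℂ → Matrix (Fin n) (Fin n) ℂ⟦X⟧}
    {B' Θ' DG : Matrix (Fin n) (Fin n) ℂ⟦X⟧} (hB : HasDerivSeries B B' s₀)
    (hΘ : HasDerivSeries Θ Θ' s₀) (hG : HasDerivSeries G DG s₀)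
    (hev : ∀ᶠ s in 𝓝 s₀, (PowerSeries.X ^ r : ℂ⟦X⟧) • G s =
      (PowerSeries.X ^ r : ℂ⟦X⟧) • (n : ℂ⟦X⟧) •
        ((r : ℂ⟦X⟧) • lowPart r (Θ s) - euler (lowPart r (Θ s))) +
          (lowPart r (Θ s) * B s - B s * lowPart r (Θ s))) :
    (PowerSeries.X ^ r : ℂ⟦X⟧) • DG = (PowerSeries.X ^ r : ℂ⟦X⟧) • (n : ℂ⟦X⟧) •
      ((r : ℂ⟦X⟧) • lowPart r Θ' - euler (lowPart r Θ')) +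
        (lowPart r Θ' * B s₀ + lowPart r (Θ s₀) * B' -
          (B' * lowPart r (Θ s₀) + B s₀ * lowPart r Θ')) := by
  have hT := hΘ.lowPart r
  have h1 := ((hT.smul (r : ℂ⟦X⟧)).sub hT.euler).smul (n : ℂ⟦X⟧)
  have h2 := (hT.mul hB).sub (hB.mul hT)
  have h3 := (h1.smul (PowerSeries.X ^ r)).add h2
  have h4 := hG.smul (PowerSeries.X ^ r)
  exact h4.unique (h3.congr_of_eventuallyEq hev)

theorem exists_deriv_velocity (hv : c s₀ (cornerIdx n hr) ≠ 0) (hJ : J ≠ 0)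
    (hJN : J ≤ r * n) (hc : HasDerivAt c (genField hr J (c s₀)) s₀) (K : ℕ) :
    ∃ DG, HasDerivSeries (fun s => velocity r K (admSeries hr (c s))
        (dressed n r (genGauge hr (c s)) (genInv hr (c s)) K)) DG s₀ :=
  HasDerivSeries.velocity (hasDerivSeries_admSeries hc) (hasDerivSeries_dressed_gen hv hJ hJN hc K) K

/-- The derivative of the velocity of the flow `K` along the flow `J`, with `∂_J Θ_K = [Θ_K, Ξ_J]`
inserted, in the shape that `mixed_velocity_eq` takes as input. -/
theorem smul_deriv_velocity_gen (hv : c s₀ (cornerIdx n hr) ≠ 0) (hJ : J ≠ 0)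
    (hJN : J ≤ r * n) (hc : HasDerivAt c (genField hr J (c s₀)) s₀) {K : ℕ} (hKN : K ≤ r * n)
    {DG Â Θ Θ' : Matrix (Fin n) (Fin n) ℂ⟦X⟧}
    (hDG : HasDerivSeries (fun s => velocity r K (admSeries hr (c s))
        (dressed n r (genGauge hr (c s)) (genInv hr (c s)) K)) DG s₀)
    (hÂ : admSeries hr (c s₀) = Â) (hΘ : dressed n r (genGauge hr (c s₀)) (genInv hr (c s₀)) K = Θ)
    (hΘ' : dressed n r (genGauge hr (c s₀)) (genInv hr (c s₀)) J = Θ') :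
    (PowerSeries.X ^ r : ℂ⟦X⟧) • DG = (PowerSeries.X ^ r : ℂ⟦X⟧) • (n : ℂ⟦X⟧) •
      ((r : ℂ⟦X⟧) • lowPart r (Θ * tailPart r Θ' - tailPart r Θ' * Θ) -
        euler (lowPart r (Θ * tailPart r Θ' - tailPart r Θ' * Θ))) +
      (lowPart r (Θ * tailPart r Θ' - tailPart r Θ' * Θ) * Â + lowPart r Θ * velocity r J Â Θ' -
        (velocity r J Â Θ' * lowPart r Θ +
          Â * lowPart r (Θ * tailPart r Θ' - tailPart r Θ' * Θ))) := by
  have hB := hasDerivSeries_admSeries (hr := hr) hc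
  rw [admSeries_genField hv hJ hJN, hÂ, hΘ'] at hB
  have hD := hasDerivSeries_dressed_gen hv hJ hJN hc K
  rw [hΘ, hΘ'] at hD
  have hev : ∀ᶠ s in 𝓝 s₀, _ :=
    (eventually_corner_ne_zero hc.continuousAt hv).mono fun s hs =>
      X_pow_smul_velocity (genInv_mul hs) ((gen_spec hr).1 _ hs).2.2.2 hKN
  have h := smul_deriv_velocity hB hD hDG hev
  rw [hÂ, hΘ] at h
  exact h

theorem hasDerivAt_line (v w : Fin r × Fin n × Fin n → ℂ) :
    HasDerivAt (fun s : ℂ => v + s • w) w 0 := by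
  simpa using ((hasDerivAt_id (0 : ℂ)).smul_const w).const_add v

/-- The flows commute. -/
theorem fderiv_genField_comm (hv : v (cornerIdx n hr) ≠ 0) (hJ : J ≠ 0) (hJN : J ≤ r * n)
    {K : ℕ} (hK : K ≠ 0) (hKN : K ≤ r * n) :
    fderiv ℂ (genField hr J) v (genField hr K v) = fderiv ℂ (genField hr K) v (genField hr J v) := by
  have h0 : ∀ w : Fin r × Fin n × Fin n → ℂ, v + (0 : ℂ) • w = v := fun w => by
    rw [zero_smul, add_zero]
  -- A directional derivative depends only on the velocity of the curve at the point, so a straight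
  -- line replaces the integral curve.
  have hline : ∀ L, HasDerivAt (fun s : ℂ => v + s • genField hr L v)
      (genField hr L (v + (0 : ℂ) • genField hr L v)) 0 := fun L => by
    rw [h0]
    exact hasDerivAt_line _ _
  have hfd : ∀ L L' DG, HasDerivSeries (fun s => velocity r L (admSeries hr (v + s • genField hr L' v))
      (dressed n r (genGauge hr (v + s • genField hr L' v)) (genInv hr (v + s • genField hr L' v)) L))
        DG 0 → fderiv ℂ (genField hr L) v (genField hr L' v) = paramsOf r DG := by
    intro L L' DG h
    have h1 : HasDerivAt (fun s : ℂ => genField hr L (v + s • genField hr L' v))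
        (fderiv ℂ (genField hr L) (v + (0 : ℂ) • genField hr L' v) (genField hr L' v)) 0 := by
      refine HasFDerivAt.comp_hasDerivAt (0 : ℂ) (l := genField hr L) ?_ (hasDerivAt_line _ _)
      rw [h0]
      exact ((contDiffAt_genField hv 1 L).differentiableAt one_ne_zero).hasFDerivAt
    rw [h0] at h1
    refine h1.unique (hasDerivAt_pi.2 fun x => ?_)
    exact (h x.2.1 x.2.2 _).const_mul _
  have hv0 : ∀ w : Fin r × Fin n × Fin n → ℂ, (v + (0 : ℂ) • w) (cornerIdx n hr) ≠ 0 := fun w => by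
    rw [h0]
    exact hv
  obtain ⟨DG, hDG⟩ := exists_deriv_velocity (hv0 _) hK hKN (hline K) J
  obtain ⟨DH, hDH⟩ := exists_deriv_velocity (hv0 _) hJ hJN (hline J) K
  rw [hfd J K DG hDG, hfd K J DH hDH]
  obtain ⟨-, -, -, hE⟩ := (gen_spec hr).1 v hv
  have e1 := smul_deriv_velocity_gen (hv0 _) hK hKN (hline K) hJN hDG
    (congrArg _ (h0 _)) (by rw [h0]) (by rw [h0])
  have e2 := smul_deriv_velocity_gen (hv0 _) hJ hJN (hline J) hKN hDH
    (congrArg _ (h0 _)) (by rw [h0]) (by rw [h0])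
  congr 1
  exact (mixed_velocity_eq (X_pow_smul_velocity (genInv_mul hv) hE hJN)
    (X_pow_smul_velocity (genInv_mul hv) hE hKN) e1 e2
    (lowPart_bracket (dressed_commute (genInv_mul hv) J K))).symm

/-- The vector fields of all flows, as a system of first order differential equations. -/
noncomputable def genSystem (hr : 2 ≤ r) (v : Fin r × Fin n × Fin n → ℂ) :
    (Fin (r * n) → ℂ) →L[ℂ] (Fin r × Fin n × Fin n → ℂ) :=
  ∑ J : Fin (r * n), (ContinuousLinearMap.proj J).smulRight (genField hr (J.val + 1) v)

theorem genSystem_apply (v : Fin r × Fin n × Fin n → ℂ) (h : Fin (r * n) → ℂ) :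
    genSystem hr v h = ∑ J : Fin (r * n), h J • genField hr (J.val + 1) v := by
  simp [genSystem]

theorem genSystem_single (v : Fin r × Fin n × Fin n → ℂ) (J : Fin (r * n)) :
    genSystem hr v (Pi.single J 1) = genField hr (J.val + 1) v := by
  rw [genSystem_apply, Finset.sum_eq_single J]
  · simp
  · intro K _ hK
    rw [Pi.single_eq_of_ne hK, zero_smul]
  · simp

theorem contDiffAt_genSystem (hv : v (cornerIdx n hr) ≠ 0) (m : WithTop ℕ∞) :
    ContDiffAt ℂ m (genSystem hr) v :=
  ContDiffAt.sum fun _ _ => contDiffAt_const.smulRight (contDiffAt_genField hv m _)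

/-- The flows have a common solution through every admissible connection. -/
theorem exists_genSystem_solution (hv : v (cornerIdx n hr) ≠ 0) (t₁ : Fin (r * n) → ℂ) :
    ∃ u : (Fin (r * n) → ℂ) → (Fin r × Fin n × Fin n → ℂ), u t₁ = v ∧
      ∀ᶠ t in 𝓝 t₁, HasFDerivAt u (genSystem hr (u t)) t := by
  have hF : ContDiffAt ℂ 2 (fun q : (Fin (r * n) → ℂ) × (Fin r × Fin n × Fin n → ℂ) =>
      genSystem hr q.2) (t₁, v) :=
    ContDiffAt.comp (g := genSystem hr) (t₁, v) (contDiffAt_genSystem hv 2) contDiffAt_snd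
  refine exists_local_solution_of_symm hF ?_
  filter_upwards [eventually_corner_ne_zero (c := fun q : (Fin (r * n) → ℂ) × _ => q.2)
    continuousAt_snd hv] with q hq h k
  have hd : ∀ w k, fderiv ℂ (fun q : (Fin (r * n) → ℂ) × (Fin r × Fin n × Fin n → ℂ) =>
      genSystem hr q.2) q w k = ∑ J : Fin (r * n), k J • fderiv ℂ (genField hr (J.val + 1)) q.2 w.2 := by
    intro w k
    have e1 : HasFDerivAt (genSystem hr) (∑ J : Fin (r * n),
        (ContinuousLinearMap.smulRightL ℂ (Fin (r * n) → ℂ) _ (ContinuousLinearMap.proj J)).comp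
          (fderiv ℂ (genField hr (J.val + 1)) q.2)) q.2 := by
      refine HasFDerivAt.fun_sum fun J _ => ?_
      exact (ContinuousLinearMap.smulRightL ℂ (Fin (r * n) → ℂ) _
        (ContinuousLinearMap.proj J)).hasFDerivAt.comp q.2
          ((contDiffAt_genField hq 1 _).differentiableAt one_ne_zero).hasFDerivAt
    have e2 : HasFDerivAt (fun q : (Fin (r * n) → ℂ) × (Fin r × Fin n × Fin n → ℂ) =>
        genSystem hr q.2) _ q := e1.comp q hasFDerivAt_snd
    rw [e2.fderiv]
    simp
  -- Both sides are double sums over pairs of flows; they match because the vector fields commute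
  -- pairwise.
  rw [hd, hd]
  simp only [genSystem_apply, map_sum, map_smul, Finset.smul_sum]
  rw [Finset.sum_comm]
  refine Finset.sum_congr rfl fun J _ => Finset.sum_congr rfl fun K _ => ?_
  rw [fderiv_genField_comm hq (by omega) (by have := K.2; omega) (by omega) (by have := J.2; omega),
    smul_comm]

end Chart

/-! ### Back from series in `z` to polynomials in `x` -/

section Reverse

open scoped PowerSeries
open Topology

variable {n r : ℕ}

/-- The polynomial matrix `x^D M(1/x)`, where `M` is truncated at the order `D`. -/
noncomputable def revPoly (D : ℕ) (M : Matrix (Fin n) (Fin n) ℂ⟦X⟧) :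
    Matrix (Fin n) (Fin n) ℂ[X] :=
  M.map fun f => ∑ k ∈ Finset.range (D + 1), Polynomial.monomial k (PowerSeries.coeff (D - k) f)

theorem coeff_revPoly (D : ℕ) (M : Matrix (Fin n) (Fin n) ℂ⟦X⟧) (i j : Fin n) (k : ℕ) :
    (revPoly D M i j).coeff k = if k ≤ D then PowerSeries.coeff (D - k) (M i j) else 0 := by
  rw [revPoly, Matrix.map_apply, Polynomial.finsetSum_coeff]
  simp only [Polynomial.coeff_monomial, Finset.sum_ite_eq', Finset.mem_range, Nat.lt_succ_iff]

theorem evalAt_revPoly (D : ℕ) (M : Matrix (Fin n) (Fin n) ℂ⟦X⟧) (x : ℂ) (i j : Fin n) :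
    evalAt (revPoly D M) x i j =
      ∑ k ∈ Finset.range (D + 1), PowerSeries.coeff (D - k) (M i j) * x ^ k := by
  rw [evalAt, Matrix.map_apply, revPoly, Matrix.map_apply, Polynomial.eval_finsetSum]
  simp only [Polynomial.eval_monomial]

theorem HasDerivSeries.evalAt_revPoly {M : ℂ → Matrix (Fin n) (Fin n) ℂ⟦X⟧}
    {M' : Matrix (Fin n) (Fin n) ℂ⟦X⟧} {s₀ : ℂ} (h : HasDerivSeries M M' s₀) (D : ℕ) (x : ℂ)
    (i j : Fin n) :
    HasDerivAt (fun s => evalAt (revPoly D (M s)) x i j) (evalAt (revPoly D M') x i j) s₀ := by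
  simp only [JordanConnection.evalAt_revPoly]
  exact HasDerivAt.fun_sum fun k _ => (h i j _).mul_const _

theorem natDegree_revPoly_le (D : ℕ) (M : Matrix (Fin n) (Fin n) ℂ⟦X⟧) (i j : Fin n) :
    (revPoly D M i j).natDegree ≤ D := by
  refine Polynomial.natDegree_le_iff_coeff_eq_zero.2 fun k hk => ?_
  rw [coeff_revPoly, if_neg (by omega)]

theorem coeff_substInvPow_one (f : ℂ[X]) (k : ℕ) :
    (substInvPow 1 f).coeff (-(k : ℤ)) = f.coeff k := by
  have hD : f.natDegree ≤ f.natDegree + k := Nat.le_add_right _ _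
  have h := single_mul_substInvPow one_ne_zero hD
  have h1 := congrArg (fun g : LaurentSeries ℂ => g.coeff (f.natDegree : ℤ)) h
  beta_reduce at h1
  rw [PowerSeries.expand_one_apply, coeff_toLaurent, PowerSeries.coeff_mk, if_pos hD,
    Nat.add_sub_cancel_left, show (f.natDegree : ℤ) = -(k : ℤ) + ((1 : ℕ) : ℤ) *
      ((f.natDegree + k : ℕ) : ℤ) by push_cast; ring, HahnSeries.coeff_single_mul_add, one_mul] at h1
  exact h1

theorem polyAtInfty_injective {F F' : Matrix (Fin n) (Fin n) ℂ[X]}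
    (h : polyAtInfty F = polyAtInfty F') : F = F' := by
  ext i j k
  have := congrFun (congrFun h i) j
  rw [← coeff_substInvPow_one, ← coeff_substInvPow_one]
  exact congrArg (fun g : LaurentSeries ℂ => g.coeff (-(k : ℤ))) this

theorem single_smul_polyAtInfty_revPoly (D : ℕ) (M : Matrix (Fin n) (Fin n) ℂ⟦X⟧) :
    (HahnSeries.single (D : ℤ) (1 : ℂ) : LaurentSeries ℂ) • polyAtInfty (revPoly D M) =
      seriesAtInfty (lowPart D M) := by
  ext1 i j
  have h := single_mul_substInvPow one_ne_zero (natDegree_revPoly_le D M i j)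
  rw [Nat.cast_one, one_mul, PowerSeries.expand_one_apply] at h
  refine h.trans ?_
  rw [seriesAtInfty, Matrix.map_apply]
  congr 1
  ext k
  rw [PowerSeries.coeff_mk, coeff_lowPart, coeff_revPoly]
  split_ifs with h1 h2
  · congr 1; congr 1; omega
  · omega
  · rfl

/-- The coefficient of `z^k` in the truncation belongs to `x^{r-k}`, so `d/dx` multiplies it by `r -
k`. -/
theorem single_smul_polyAtInfty_dxPoly (hr : 1 ≤ r) (M : Matrix (Fin n) (Fin n) ℂ⟦X⟧) :
    (HahnSeries.single ((r : ℤ) - 1) (1 : ℂ) : LaurentSeries ℂ) • polyAtInfty (dxPoly (revPoly r M)) =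
      seriesAtInfty ((r : ℂ⟦X⟧) • lowPart r M - euler (lowPart r M)) := by
  ext1 i j
  have hd : (Polynomial.derivative (revPoly r M i j)).natDegree ≤ r - 1 :=
    (Polynomial.natDegree_derivative_le _).trans (Nat.sub_le_sub_right (natDegree_revPoly_le r M i j) 1)
  have h := single_mul_substInvPow one_ne_zero hd
  rw [Nat.cast_one, one_mul, PowerSeries.expand_one_apply, Nat.cast_sub hr, Nat.cast_one] at h
  refine h.trans ?_
  rw [seriesAtInfty, Matrix.map_apply]
  congr 1
  ext k
  rw [PowerSeries.coeff_mk, Matrix.sub_apply, map_sub, coeff_natCast_smul_matrix, coeff_euler,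
    coeff_lowPart, Polynomial.coeff_derivative, coeff_revPoly]
  rcases Nat.lt_trichotomy k r with hk | hk | hk
  · rw [if_pos (by omega), if_pos (by omega), if_pos (by omega),
      show r - (r - 1 - k + 1) = k by omega,
      show ((r - 1 - k : ℕ) : ℂ) + 1 = (r : ℂ) - k by
        rw [Nat.sub_sub, Nat.cast_sub (by omega)]; push_cast; ring]
    ring
  · subst hk
    rw [if_neg (by omega), sub_self]
  · rw [if_neg (by omega), if_neg (by omega), mul_zero, mul_zero, sub_zero]

theorem seriesAtInfty_mul (M M' : Matrix (Fin n) (Fin n) ℂ⟦X⟧) :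
    seriesAtInfty (M * M') = seriesAtInfty M * seriesAtInfty M' :=
  map_mul toLaurent.mapMatrix M M'

theorem polyAtInfty_mul (F F' : Matrix (Fin n) (Fin n) ℂ[X]) :
    polyAtInfty (F * F') = polyAtInfty F * polyAtInfty F' :=
  map_mul (substInvPow 1).toRingHom.mapMatrix F F'

theorem polyAtInfty_add (F F' : Matrix (Fin n) (Fin n) ℂ[X]) :
    polyAtInfty (F + F') = polyAtInfty F + polyAtInfty F' :=
  map_add (substInvPow 1).toRingHom.mapMatrix F F'

theorem polyAtInfty_sub (F F' : Matrix (Fin n) (Fin n) ℂ[X]) :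
    polyAtInfty (F - F') = polyAtInfty F - polyAtInfty F' :=
  map_sub (substInvPow 1).toRingHom.mapMatrix F F'

theorem seriesAtInfty_add (M M' : Matrix (Fin n) (Fin n) ℂ⟦X⟧) :
    seriesAtInfty (M + M') = seriesAtInfty M + seriesAtInfty M' :=
  map_add toLaurent.mapMatrix M M'

theorem seriesAtInfty_sub (M M' : Matrix (Fin n) (Fin n) ℂ⟦X⟧) :
    seriesAtInfty (M - M') = seriesAtInfty M - seriesAtInfty M' :=
  map_sub toLaurent.mapMatrix M M'

theorem seriesAtInfty_smul (f : ℂ⟦X⟧) (M : Matrix (Fin n) (Fin n) ℂ⟦X⟧) :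
    seriesAtInfty (f • M) = toLaurent f • seriesAtInfty M := by
  ext1 i j
  exact map_mul toLaurent f (M i j)

theorem laurent_smul_sub (c : LaurentSeries ℂ)
    (M N : Matrix (Fin n) (Fin n) (LaurentSeries ℂ)) : c • (M - N) = c • M - c • N :=
  smul_sub c M N

theorem laurent_smul_cancel {c : LaurentSeries ℂ} (hc : c ≠ 0)
    {M N : Matrix (Fin n) (Fin n) (LaurentSeries ℂ)} (h : c • M = c • N) : M = N := by
  ext1 i j
  exact mul_left_cancel₀ hc (congrFun (congrFun h i) j)

variable [NeZero n]

/-- Since `z^r ℋ^J = W^{rn-J}`, the nonnegative powers of `x` in `Y ℋ^J Y⁻¹ / J` are the terms of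
order at most `r` of the dressed matrix. -/
theorem defMatrix_eq {Y Y' : Matrix (Fin n) (Fin n) ℂ⟦X⟧} (hYY : Y * Y' = 1) {J : ℕ}
    (hJ : J ≤ r * n) : defMatrix Y J = revPoly r (dressed n r Y Y' J) := by
  have hinv : (seriesAtInfty Y)⁻¹ = seriesAtInfty Y' := by
    refine Matrix.inv_eq_right_inv ?_
    rw [← seriesAtInfty_mul, hYY]
    exact map_one toLaurent.mapMatrix
  have h1 : (HahnSeries.single (r : ℤ) (1 : ℂ) : LaurentSeries ℂ) •
      (seriesAtInfty Y * polyAtInfty (matH n) ^ J * seriesAtInfty Y') =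
      seriesAtInfty (Y * shiftW n ℂ ^ (r * n - J) * Y') := by
    rw [seriesAtInfty_mul, seriesAtInfty_mul, ← single_smul_matH_pow hJ, laurent_mul_smul,
      laurent_smul_mul]
  ext i j k
  rw [defMatrix, hinv, Matrix.smul_apply, Matrix.map_apply, Polynomial.coeff_smul, coeff_posPart,
    coeff_revPoly, dressed, coeff_C_smul_matrix, smul_eq_mul, one_div, ← mul_ite_zero]
  congr 1
  have h2 := congrArg (fun g : LaurentSeries ℂ => g.coeff (-(k : ℤ) + r))
    (congrFun (congrFun h1 i) j)
  beta_reduce at h2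
  rw [Matrix.smul_apply, smul_eq_mul, HahnSeries.coeff_single_mul_add, one_mul] at h2
  rw [h2, seriesAtInfty, Matrix.map_apply, PowerSeries.coeff_coe]
  split_ifs with h3 h4 h4
  · omega
  · rfl
  · rw [show (-(k : ℤ) + r).natAbs = r - k by omega]
  · omega

/-- If no pole is left after multiplication by `n z^{r-1}`, the polynomial has degree less than `r`,
and then `connSeries` loses nothing. -/
theorem connSeries_eq_of_polyAtInfty (hr : 1 ≤ r) {F : Matrix (Fin n) (Fin n) ℂ[X]}
    {M : Matrix (Fin n) (Fin n) ℂ⟦X⟧}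
    (h : (HahnSeries.single ((r : ℤ) - 1) (n : ℂ) : LaurentSeries ℂ) • polyAtInfty F =
      seriesAtInfty M) :
    (∀ i j, (F i j).degree < r) ∧ connSeries r F = M := by
  have hnc : (n : ℂ) ≠ 0 := by exact_mod_cast NeZero.ne n
  have hc : ∀ i j (k : ℕ), (n : ℂ) * (F i j).coeff k =
      (toLaurent (M i j)).coeff (-(k : ℤ) + (r - 1)) := by
    intro i j k
    have h2 := congrArg (fun g : LaurentSeries ℂ => g.coeff (-(k : ℤ) + (r - 1)))
      (congrFun (congrFun h i) j)
    beta_reduce at h2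
    rw [Matrix.smul_apply, smul_eq_mul, HahnSeries.coeff_single_mul_add, polyAtInfty,
      Matrix.map_apply, coeff_substInvPow_one] at h2
    exact h2
  have hd : ∀ i j, (F i j).degree < r := by
    intro i j
    rw [Polynomial.degree_lt_iff_coeff_zero]
    intro k hk
    have := hc i j k
    rw [PowerSeries.coeff_coe, if_pos (by omega)] at this
    exact (mul_eq_zero.1 this).resolve_left hnc
  refine ⟨hd, ?_⟩
  have h2 := (single_smul_polyAtInfty hr hd).symm.trans h
  exact toLaurent_mapMatrix_injective h2

/-- The polynomial `∂ₓ 𝒯_J + [𝒯_J, A]`, in terms of the velocity. -/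
theorem flow_connSeries (hr : 1 ≤ r) {A : Matrix (Fin n) (Fin n) ℂ[X]}
    (hA : ∀ i j, (A i j).degree < r) {Y Y' : Matrix (Fin n) (Fin n) ℂ⟦X⟧} {p : ℂ⟦X⟧}
    (hYY : Y * Y' = 1) (hE : FormalEq r (connSeries r A) Y p) {J : ℕ} (hJ : J ≤ r * n) :
    (∀ i j, ((dxPoly (defMatrix Y J) + (defMatrix Y J * A - A * defMatrix Y J)) i j).degree < r) ∧
    connSeries r (dxPoly (defMatrix Y J) + (defMatrix Y J * A - A * defMatrix Y J)) =
      velocity r J (connSeries r A) (dressed n r Y Y' J) := by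
  refine connSeries_eq_of_polyAtInfty hr ?_
  rw [defMatrix_eq hYY hJ]
  set Θ := dressed n r Y Y' J with hΘ
  have hv := congrArg seriesAtInfty (X_pow_smul_velocity (mul_eq_one_comm.1 hYY) hE hJ)
  rw [← hΘ] at hv
  have hs : (HahnSeries.single (r : ℤ) (1 : ℂ) : LaurentSeries ℂ) ≠ 0 := by simp
  refine laurent_smul_cancel hs ?_
  have e1 : ∀ c : ℂ, (HahnSeries.single ((r : ℤ) - 1) c : LaurentSeries ℂ) =
      HahnSeries.C c * HahnSeries.single ((r : ℤ) - 1) (1 : ℂ) := fun c => by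
    rw [HahnSeries.C_apply, HahnSeries.single_mul_single, zero_add, mul_one]
  have e2 : toLaurent (PowerSeries.X ^ r) = HahnSeries.single (r : ℤ) (1 : ℂ) := toLaurent_X_pow r
  have e3 : toLaurent ((n : ℕ) : ℂ⟦X⟧) = HahnSeries.C (n : ℂ) := by
    rw [← map_natCast (PowerSeries.C (R := ℂ)), HahnSeries.ofPowerSeries_C]
  rw [seriesAtInfty_smul, seriesAtInfty_add, seriesAtInfty_smul, seriesAtInfty_smul,
    seriesAtInfty_sub (_ * _), seriesAtInfty_mul, seriesAtInfty_mul, e2, e3,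
    ← single_smul_polyAtInfty_dxPoly hr, ← single_smul_polyAtInfty hr hA,
    ← single_smul_polyAtInfty_revPoly] at hv
  rw [hv, polyAtInfty_add, polyAtInfty_sub, polyAtInfty_mul, polyAtInfty_mul]
  ext1 i j
  simp only [laurent_smul_mul, laurent_mul_smul, laurent_smul_smul, Matrix.smul_apply,
    Matrix.add_apply, Matrix.sub_apply, smul_eq_mul]
  rw [e1]
  ring

theorem evalAt_mul (F F' : Matrix (Fin n) (Fin n) ℂ[X]) (x : ℂ) :
    evalAt (F * F') x = evalAt F x * evalAt F' x :=
  map_mul (Polynomial.evalRingHom x).mapMatrix F F'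

theorem evalAt_add (F F' : Matrix (Fin n) (Fin n) ℂ[X]) (x : ℂ) :
    evalAt (F + F') x = evalAt F x + evalAt F' x :=
  map_add (Polynomial.evalRingHom x).mapMatrix F F'

theorem evalAt_sub (F F' : Matrix (Fin n) (Fin n) ℂ[X]) (x : ℂ) :
    evalAt (F - F') x = evalAt F x - evalAt F' x :=
  map_sub (Polynomial.evalRingHom x).mapMatrix F F'

theorem eq_smul_revPoly (hr : 1 ≤ r) {A : Matrix (Fin n) (Fin n) ℂ[X]}
    (hA : ∀ i j, (A i j).degree < r) : A = (n : ℂ)⁻¹ • revPoly (r - 1) (connSeries r A) := by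
  have hnc : (n : ℂ) ≠ 0 := by exact_mod_cast NeZero.ne n
  ext i j k
  rw [Matrix.smul_apply, Polynomial.coeff_smul, coeff_revPoly, coeff_connSeries, smul_eq_mul]
  split_ifs with h1 h2
  · rw [inv_mul_cancel_left₀ hnc, show r - 1 - (r - 1 - k) = k by omega]
  · omega
  · rw [mul_zero]
    exact Polynomial.coeff_eq_zero_of_degree_lt ((hA i j).trans_le (by exact_mod_cast (by omega)))

/-- The time derivative of a polynomial connection, coefficientwise. -/
theorem hasDerivAt_evalAt_of_connSeries (hr : 1 ≤ r) {B : ℂ → Matrix (Fin n) (Fin n) ℂ[X]}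
    {F : Matrix (Fin n) (Fin n) ℂ[X]} {s₀ : ℂ} (hB : ∀ᶠ s in 𝓝 s₀, ∀ i j, (B s i j).degree < r)
    (hF : ∀ i j, (F i j).degree < r)
    (h : HasDerivSeries (fun s => connSeries r (B s)) (connSeries r F) s₀) (x : ℂ) (i j : Fin n) :
    HasDerivAt (fun s => evalAt (B s) x i j) (evalAt F x i j) s₀ := by
  have hs : ∀ G : Matrix (Fin n) (Fin n) ℂ[X], (∀ i j, (G i j).degree < r) →
      evalAt G x i j = (n : ℂ)⁻¹ * evalAt (revPoly (r - 1) (connSeries r G)) x i j := by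
    intro G hG
    conv_lhs => rw [eq_smul_revPoly hr hG]
    simp only [evalAt, Matrix.map_apply, Matrix.smul_apply, Polynomial.eval_smul, smul_eq_mul]
  rw [hs F hF]
  exact ((h.evalAt_revPoly (r - 1) x i j).const_mul _).congr_of_eventuallyEq
    (hB.mono fun s hs' => hs (B s) hs')

/-- The degree bound passes to the derivative `D`, which thus comes from a polynomial matrix. That
matrix agrees with `F` at every `x`, hence coefficientwise. -/
theorem hasDerivSeries_connSeries_of_evalAt {B : ℂ → Matrix (Fin n) (Fin n) ℂ[X]}
    {F : Matrix (Fin n) (Fin n) ℂ[X]} {s₀ : ℂ}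
    {D : Matrix (Fin n) (Fin n) ℂ⟦X⟧} (hr : 1 ≤ r) (hB : ∀ᶠ s in 𝓝 s₀, ∀ i j, (B s i j).degree < r)
    (hD : HasDerivSeries (fun s => connSeries r (B s)) D s₀)
    (h : ∀ x i j, HasDerivAt (fun s => evalAt (B s) x i j) (evalAt F x i j) s₀) :
    D = connSeries r F := by
  have hnc : (n : ℂ) ≠ 0 := by exact_mod_cast NeZero.ne n
  have hDt : ∀ i j k, r ≤ k → PowerSeries.coeff k (D i j) = 0 := by
    intro i j k hk
    refine (hD i j k).unique ?_
    simp only [coeff_connSeries, if_neg (show ¬ k < r by omega)]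
    exact hasDerivAt_const _ _
  have hG : connSeries r ((n : ℂ)⁻¹ • revPoly (r - 1) D) = D := by
    ext i j k
    rw [coeff_connSeries, Matrix.smul_apply, Polynomial.coeff_smul, coeff_revPoly, smul_eq_mul]
    split_ifs with h1 h2
    · rw [mul_inv_cancel_left₀ hnc, show r - 1 - (r - 1 - k) = k by omega]
    · omega
    · exact (hDt i j k (by omega)).symm
  have hGd : ∀ i j, (((n : ℂ)⁻¹ • revPoly (r - 1) D) i j).degree < r := by
    intro i j
    rw [Polynomial.degree_lt_iff_coeff_zero]
    intro k hk
    rw [Matrix.smul_apply, Polynomial.coeff_smul, coeff_revPoly, if_neg (by omega), smul_zero]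
  rw [← hG]
  congr 1
  ext1 i j
  refine Polynomial.funext fun x => ?_
  exact (hasDerivAt_evalAt_of_connSeries hr hB hGd (hG.symm ▸ hD) x i j).unique (h x i j)

/-- The zero curvature of two flows. -/
theorem revPoly_zeroCurvature {Θ Θ' : Matrix (Fin n) (Fin n) ℂ⟦X⟧} (h : Θ * Θ' = Θ' * Θ) :
    revPoly r (Θ' * tailPart r Θ - tailPart r Θ * Θ') -
        revPoly r (Θ * tailPart r Θ' - tailPart r Θ' * Θ) +
      (revPoly r Θ' * revPoly r Θ - revPoly r Θ * revPoly r Θ') = 0 := by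
  rw [← neg_sub (revPoly r Θ * _), ← sub_eq_add_neg, sub_eq_zero]
  have hs : (HahnSeries.single (r : ℤ) (1 : ℂ) : LaurentSeries ℂ) ≠ 0 := by simp
  refine polyAtInfty_injective (laurent_smul_cancel hs (laurent_smul_cancel hs ?_))
  have h1 := congrArg seriesAtInfty (lowPart_bracket (r := r) h)
  rw [seriesAtInfty_smul, toLaurent_X_pow, seriesAtInfty_sub, seriesAtInfty_sub (_ * _),
    seriesAtInfty_mul, seriesAtInfty_mul] at h1
  simp only [← single_smul_polyAtInfty_revPoly] at h1
  rw [polyAtInfty_sub, polyAtInfty_sub, polyAtInfty_mul, polyAtInfty_mul, laurent_smul_sub, h1]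
  simp only [laurent_smul_mul, laurent_mul_smul, laurent_smul_sub]

end Reverse

/-! ### Formal solutions and existence of deformations -/

section Existence

open scoped PowerSeries
open Topology

variable {n r : ℕ} [NeZero n]

theorem coeff_connSeries_eq_zero (A : Matrix (Fin n) (Fin n) ℂ[X]) (i j : Fin n) (k : ℕ)
    (hk : r ≤ k) : PowerSeries.coeff k (connSeries r A i j) = 0 := by
  rw [coeff_connSeries, if_neg (by omega)]

theorem paramsOf_connSeries (A : Matrix (Fin n) (Fin n) ℂ[X]) (x : Fin r × Fin n × Fin n) :
    paramsOf r (connSeries r A) x = (A x.2.1 x.2.2).coeff x.1.val := by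
  have hnc : (n : ℂ) ≠ 0 := by exact_mod_cast NeZero.ne n
  have := x.1.2
  rw [paramsOf, coeff_connSeries, if_pos (by omega), inv_mul_cancel_left₀ hnc,
    show r - 1 - (r - 1 - x.1.val) = x.1.val by omega]

theorem IsGaugeFixed.admSeries_paramsOf (hr : 2 ≤ r) {τ : ℕ → ℂ} {A : Matrix (Fin n) (Fin n) ℂ[X]}
    (hA : IsGaugeFixed n r τ A) : admSeries hr (paramsOf r (connSeries r A)) = connSeries r A :=
  JordanConnection.admSeries_paramsOf hr (hA.isAdmissible hr) (coeff_connSeries_eq_zero A)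

theorem IsGaugeFixed.paramsOf_corner (hr : 2 ≤ r) {τ : ℕ → ℂ} {A : Matrix (Fin n) (Fin n) ℂ[X]}
    (hA : IsGaugeFixed n r τ A) : paramsOf r (connSeries r A) (cornerIdx n hr) = τ 1 / n := by
  rw [paramsOf_connSeries]
  exact hA.corner _ _ (Nat.sub_add_cancel (NeZero.pos n)) rfl

theorem IsGaugeFixed.corner_ne_zero (hr : 2 ≤ r) {τ : ℕ → ℂ} {A : Matrix (Fin n) (Fin n) ℂ[X]}
    (hA : IsGaugeFixed n r τ A) : paramsOf r (connSeries r A) (cornerIdx n hr) ≠ 0 := by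
  rw [hA.paramsOf_corner hr]
  exact div_ne_zero hA.lidskii_ne_zero (by exact_mod_cast NeZero.ne n)

/-- By uniqueness every formal solution is a specialization of the generic one, and so inherits its
rational dependence on the coefficients. -/
theorem IsGaugeFixed.eq_gen (hr : 2 ≤ r) {τ : ℕ → ℂ} {A : Matrix (Fin n) (Fin n) ℂ[X]}
    (hA : IsGaugeFixed n r τ A) {t0 : ℂ} {t : Fin (r * n) → ℂ} {Y : Matrix (Fin n) (Fin n) ℂ⟦X⟧}
    (hY : IsFormalSolution n r A t0 t Y) :
    Y = genGauge hr (paramsOf r (connSeries r A)) ∧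
      normalForm n r t0 t = genNormal hr (paramsOf r (connSeries r A)) := by
  obtain ⟨hU, hE⟩ := (isFormalSolution_iff (by omega) hA.degree_lt t0 t Y).1 hY
  obtain ⟨hU', -, hp', hE'⟩ := (gen_spec hr).1 _ (hA.corner_ne_zero hr)
  rw [hA.admSeries_paramsOf hr] at hE'
  exact FormalEq.unique (hA.isAdmissible hr) hA.lidskii_ne_zero (two_le_mul_card hr)
    (fun k hk => coeff_normalForm_of_lt t0 t hk) hp' hU hE hU' hE'

theorem IsGaugeFixed.existsUnique_formalSolution (hr : 2 ≤ r) {τ : ℕ → ℂ}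
    {A : Matrix (Fin n) (Fin n) ℂ[X]} (hA : IsGaugeFixed n r τ A) :
    ∃! s : ℂ × (Fin (r * n) → ℂ) × Matrix (Fin n) (Fin n) ℂ⟦X⟧,
      IsFormalSolution n r A s.1 s.2.1 s.2.2 := by
  obtain ⟨hU, -, hp, hE⟩ := (gen_spec hr).1 _ (hA.corner_ne_zero hr)
  rw [hA.admSeries_paramsOf hr] at hE
  obtain ⟨t0, t, ht⟩ := exists_normalForm_eq (NeZero.ne n) hp
  have hsol : IsFormalSolution n r A t0 t (genGauge hr (paramsOf r (connSeries r A))) :=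
    (isFormalSolution_iff (by omega) hA.degree_lt t0 t _).2 ⟨hU, ht.symm ▸ hE⟩
  refine ⟨(t0, t, genGauge hr (paramsOf r (connSeries r A))), hsol, ?_⟩
  rintro ⟨t0', t', Y'⟩ h
  obtain ⟨h1, h2⟩ := hA.eq_gen hr h
  obtain ⟨h3, h4⟩ := normalForm_injective (NeZero.ne n) (h2.trans ht.symm)
  exact Prod.ext h3 (Prod.ext h4 h1)

/-- The entries of `U` are polynomials divided by a power of `t_{rn-1}`. -/
theorem exists_casimirU_eq_eval_div (n : ℕ) [NeZero n] {r : ℕ} (hr : 2 ≤ r) :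
    ∃ (k : ℕ) (P : Fin n → Fin n → MvPolynomial (Fin r × Fin n × Fin n) ℂ),
      ∀ (τ : ℕ → ℂ) (A : Matrix (Fin n) (Fin n) ℂ[X]) (t0 : ℂ) (t : Fin (r * n) → ℂ)
        (Y : Matrix (Fin n) (Fin n) ℂ⟦X⟧),
        IsGaugeFixed n r τ A → IsFormalSolution n r A t0 t Y →
          ∀ i j, casimirU Y i j =
            MvPolynomial.eval (fun v => (A v.2.1 v.2.2).coeff v.1.val) (P i j) /
              time t (r * n - 1) ^ k := by
  have hnc : (n : ℂ) ≠ 0 := by exact_mod_cast NeZero.ne n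
  choose k P hP using fun i j : Fin n => (gen_spec (n := n) hr).2.1 i j 0
  -- One exponent for all entries; the missing powers of the corner are multiplied into the
  -- numerators. The factor `n^K` there compensates for `t_{rn-1}` being `n` times the corner.
  set K := ∑ i, ∑ j, k i j with hK
  have hkK : ∀ i j, k i j ≤ K := fun i j =>
    (Finset.single_le_sum (f := fun j => k i j) (fun _ _ => Nat.zero_le _)
      (Finset.mem_univ j)).trans
      (Finset.single_le_sum (f := fun i => ∑ j, k i j) (fun _ _ => Nat.zero_le _)
        (Finset.mem_univ i))
  refine ⟨K, fun i j => MvPolynomial.C ((n : ℂ) ^ K) *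
    (MvPolynomial.X (cornerIdx n hr) ^ (K - k i j) * P i j -
      MvPolynomial.C ((1 : Matrix (Fin n) (Fin n) ℂ) i j) * MvPolynomial.X (cornerIdx n hr) ^ K),
    fun τ A t0 t Y hA hY i j => ?_⟩
  have hv := hA.corner_ne_zero hr
  have hparam : (fun v : Fin r × Fin n × Fin n => (A v.2.1 v.2.2).coeff v.1.val) =
      paramsOf r (connSeries r A) := funext fun v => (paramsOf_connSeries A v).symm
  have hc : time t (r * n - 1) = n * paramsOf r (connSeries r A) (cornerIdx n hr) := by
    rw [hA.paramsOf_corner hr, mul_div_cancel₀ _ hnc, (hA.time_eq hr hY).2]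
  rw [hparam, hc]
  set v := paramsOf r (connSeries r A)
  have hU : casimirU Y i j = MvPolynomial.eval v (P i j) / v (cornerIdx n hr) ^ k i j -
      (1 : Matrix (Fin n) (Fin n) ℂ) i j := by
    have e := hP i j v hv
    have e' : Y = genGauge hr v := (hA.eq_gen hr hY).1
    beta_reduce at e
    rw [← e, ← e', casimirU, Matrix.sub_apply, valueAtInfty, Matrix.map_apply,
      PowerSeries.coeff_zero_eq_constantCoeff_apply]
  have hpow : v (cornerIdx n hr) ^ K = v (cornerIdx n hr) ^ (K - k i j) * v (cornerIdx n hr) ^ k i j := by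
    rw [← pow_add, Nat.sub_add_cancel (hkK i j)]
  simp only [map_mul, map_sub, map_pow, MvPolynomial.eval_C, MvPolynomial.eval_X]
  rw [hU, mul_pow, mul_div_mul_left _ _ (pow_ne_zero _ hnc),
    sub_div, mul_div_cancel_right₀ _ (pow_ne_zero _ hv), hpow,
    mul_div_mul_left _ _ (pow_ne_zero _ hv)]

/-- A connection with a formal gauge whose constant term commutes with `𝒩` is gauge-fixed. -/
theorem isGaugeFixed_of_formalEq (hr : 2 ≤ r) {A : Matrix (Fin n) (Fin n) ℂ[X]}
    (hd : ∀ i j, (A i j).degree < r) {β₀ β₁ : ℂ} (hA : IsAdmissible (connSeries r A) β₀ β₁)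
    (hβ : β₁ ≠ 0) {p : ℂ⟦X⟧} (hp : ∀ k, r * n < k → PowerSeries.coeff k p = 0)
    {Y Y' : Matrix (Fin n) (Fin n) ℂ⟦X⟧} (hU : IsUnipotentGauge Y) (hYY : Y * Y' = 1)
    (hE : FormalEq r (connSeries r A) Y p) (hcomm : Commute (constTerm Y) (jordanN n))
    {τ : ℕ → ℂ} (hτ : ∀ j < r * n, PowerSeries.coeff j p = τ j) : IsGaugeFixed n r τ A := by
  have hnc : (n : ℂ) ≠ 0 := by exact_mod_cast NeZero.ne n
  have hN := two_le_mul_card (n := n) hr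
  have hnN : n < r * n := by
    have := Nat.mul_le_mul_right n hr
    have := NeZero.pos n
    omega
  obtain ⟨hp1, y, hy, hy0, hyj⟩ := exists_eigenvalue_of_formalEq hr hd hA hβ hp hU hE
  have hβτ : τ 1 = β₁ := by rw [← hτ 1 (by omega), hp1]
  refine ⟨hd, ?_, fun i j hi hj => ?_, by rw [hβτ]; exact hβ, y, hy, hy0, fun j hj => ?_⟩
  · have h1 := hE.constTerm_eq (by omega)
    have h2 : ∑ m ∈ Finset.range n, PowerSeries.coeff m p • jordanN n ^ m =
        ∑ m ∈ Finset.range n, τ m • jordanN n ^ m :=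
      Finset.sum_congr rfl fun m hm => by
        rw [hτ m (by have := Finset.mem_range.1 hm; omega)]
    have h3 : Commute (constTerm Y) (∑ m ∈ Finset.range n, τ m • jordanN n ^ m) :=
      Commute.sum_right _ _ _ fun m _ => (hcomm.pow_right m).smul_right _
    rw [h2, h3.eq, constTerm_connSeries (by omega)] at h1
    have h4 := congrArg (· * constTerm Y') h1
    beta_reduce at h4
    rw [mul_assoc, mul_assoc, ← map_mul, hYY, map_one, mul_one, mul_one] at h4
    rw [← h4, smul_smul, one_div, inv_mul_cancel₀ hnc, one_smul]
  · have h1 := hA.corner i j hi hj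
    rw [coeff_connSeries, if_pos (by omega), show r - 1 - 1 = r - 2 by omega] at h1
    rw [hβτ, eq_div_iff hnc, mul_comm, h1]
  · rw [hyj j hj, hτ j (by omega)]

theorem eq_of_hasDerivAt_zero {m : ℕ} {f : (Fin m → ℂ) → ℂ} {c : Fin m → ℂ} {ε : ℝ}
    (hf : ∀ t ∈ Metric.ball c ε, DifferentiableAt ℂ f t)
    (h : ∀ t ∈ Metric.ball c ε, ∀ J, HasDerivAt (fun s => f (Function.update t J s)) 0 (t J))
    {t : Fin m → ℂ} (ht : t ∈ Metric.ball c ε) (hε : 0 < ε) : f t = f c := by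
  refine (convex_ball c ε).is_const_of_fderivWithin_eq_zero (𝕜 := ℂ)
    (fun t ht => (hf t ht).differentiableWithinAt) (fun t ht => ?_) ht (Metric.mem_ball_self hε)
  rw [fderivWithin_of_isOpen Metric.isOpen_ball ht]
  refine ContinuousLinearMap.coe_injective (LinearMap.pi_ext' fun J => LinearMap.ext_ring ?_)
  have h1 : HasDerivAt (fun s => f (Function.update t J s)) (fderiv ℂ f t (Pi.single J 1)) (t J) := by
    refine HasFDerivAt.comp_hasDerivAt (t J) (l := f) ?_ (hasDerivAt_update t J (t J))
    rw [Function.update_eq_self]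
    exact (hf t ht).hasFDerivAt
  simpa using h1.unique (h t ht J)

/-- The connection with given parameters. -/
noncomputable def admPoly (hr : 2 ≤ r) (v : Fin r × Fin n × Fin n → ℂ) :
    Matrix (Fin n) (Fin n) ℂ[X] :=
  (n : ℂ)⁻¹ • revPoly (r - 1) (admSeries hr v)

theorem degree_admPoly_lt (hr : 2 ≤ r) (v : Fin r × Fin n × Fin n → ℂ) (i j : Fin n) :
    (admPoly hr v i j).degree < r := by
  rw [Polynomial.degree_lt_iff_coeff_zero]
  intro k hk
  rw [admPoly, Matrix.smul_apply, Polynomial.coeff_smul, coeff_revPoly, if_neg (by omega), smul_zero]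

theorem connSeries_admPoly (hr : 2 ≤ r) (v : Fin r × Fin n × Fin n → ℂ) :
    connSeries r (admPoly hr v) = admSeries hr v := by
  have hnc : (n : ℂ) ≠ 0 := by exact_mod_cast NeZero.ne n
  ext i j k
  rw [coeff_connSeries, admPoly, Matrix.smul_apply, Polynomial.coeff_smul, coeff_revPoly, smul_eq_mul]
  split_ifs with h1 h2
  · rw [mul_inv_cancel_left₀ hnc, show r - 1 - (r - 1 - k) = k by omega]
  · omega
  · exact (coeff_admSeries_eq_zero v i j k (by omega)).symm

theorem hasDerivAt_update_of_genSystem {hr : 2 ≤ r}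
    {u : (Fin (r * n) → ℂ) → (Fin r × Fin n × Fin n → ℂ)} {t : Fin (r * n) → ℂ}
    (h : HasFDerivAt u (genSystem hr (u t)) t) (J : Fin (r * n)) :
    HasDerivAt (fun s => u (Function.update t J s))
      (genField hr (J.val + 1) (u (Function.update t J (t J)))) (t J) := by
  rw [Function.update_eq_self, ← genSystem_single]
  refine HasFDerivAt.comp_hasDerivAt (t J) (l := u) ?_ (hasDerivAt_update t J (t J))
  rwa [Function.update_eq_self]

theorem time_of_lt (t : Fin (r * n) → ℂ) {m : ℕ} (hm : m < r * n) :
    time t (r * n - m) = t ⟨r * n - m - 1, by omega⟩ := by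
  rw [time, dif_pos (by omega)]

/-- The coefficient of order `rn` of the normal form is not prescribed by the times; it defines
`t₀`. -/
theorem IsFormalSolution.of_genNormal {hr : 2 ≤ r} {v : Fin r × Fin n × Fin n → ℂ}
    (hv : v (cornerIdx n hr) ≠ 0) {t : Fin (r * n) → ℂ}
    (ht : ∀ m < r * n, PowerSeries.coeff m (genNormal hr v) = time t (r * n - m))
    {A : Matrix (Fin n) (Fin n) ℂ[X]} (hd : ∀ i j, (A i j).degree < r)
    (hA : connSeries r A = admSeries hr v) :
    ∃ t0, IsFormalSolution n r A t0 t (genGauge hr v) := by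
  have hnc : (n : ℂ) ≠ 0 := by exact_mod_cast NeZero.ne n
  obtain ⟨hU, -, hp, hE⟩ := (gen_spec hr).1 v hv
  refine ⟨(n : ℂ)⁻¹ * PowerSeries.coeff (r * n) (genNormal hr v),
    (isFormalSolution_iff (by omega) hd _ t _).2 ⟨hU, ?_⟩⟩
  rw [hA]
  convert hE
  ext m
  rw [normalForm, PowerSeries.coeff_mk]
  split_ifs with h
  · rw [mul_inv_cancel_left₀ hnc, h]
  · rcases Nat.lt_or_ge m (r * n) with h' | h'
    · exact (ht m h').symm
    · rw [hp m (by omega), Nat.sub_eq_zero_of_le h', time_zero]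

/-- Every gauge-fixed connection belongs to a deformation. -/
theorem exists_isDeformation (hr : 2 ≤ r) {τ : ℕ → ℂ} {A₁ : Matrix (Fin n) (Fin n) ℂ[X]} {t0 : ℂ}
    {t₁ : Fin (r * n) → ℂ} {Y₁ : Matrix (Fin n) (Fin n) ℂ⟦X⟧} (hA : IsGaugeFixed n r τ A₁)
    (hY : IsFormalSolution n r A₁ t0 t₁ Y₁) :
    ∃ W A Y, IsDeformation n r W A Y ∧ t₁ ∈ W ∧ A t₁ = A₁ ∧ Y t₁ = Y₁ := by
  have hnc : (n : ℂ) ≠ 0 := by exact_mod_cast NeZero.ne n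
  have hv₁ := hA.corner_ne_zero hr
  obtain ⟨hYg, hpg⟩ := hA.eq_gen hr hY
  obtain ⟨u, hu₁, hu⟩ := exists_genSystem_solution hv₁ t₁
  have hc₁ : u t₁ (cornerIdx n hr) ≠ 0 := by rw [hu₁]; exact hv₁
  obtain ⟨ε, hε, hball⟩ := Metric.eventually_nhds_iff_ball.1
    (hu.and (eventually_corner_ne_zero hu.self_of_nhds.continuousAt hc₁))
  have hflow : ∀ t ∈ Metric.ball t₁ ε, ∀ J : Fin (r * n), _ := fun t ht J =>
    hasDerivSeries_gen_of_flow (c := fun s => u (Function.update t J s)) (s₀ := t J)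
      (by rw [Function.update_eq_self]; exact (hball t ht).2) (by omega : J.val + 1 ≠ 0)
      (by have := J.2; omega) (hasDerivAt_update_of_genSystem (hball t ht).1 J)
  have hcomp : ∀ {f : (Fin r × Fin n × Fin n → ℂ) → ℂ},
      (∀ v, v (cornerIdx n hr) ≠ 0 → ContDiffAt ℂ 1 f v) →
      ∀ t ∈ Metric.ball t₁ ε, DifferentiableAt ℂ (fun t => f (u t)) t := fun hf t ht =>
    ((hf _ (hball t ht).2).differentiableAt one_ne_zero).comp t (hball t ht).1.differentiableAt
  -- Along the flow of `t_J` the coefficient of `s^{rn-J}` grows with unit speed and the others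
  -- stand still, exactly like the coordinates. The agreement at the centre therefore spreads over
  -- the ball.
  have htimes : ∀ t ∈ Metric.ball t₁ ε, ∀ m < r * n,
      PowerSeries.coeff m (genNormal hr (u t)) = time t (r * n - m) := by
    intro t ht m hm
    have hd : ∀ t : Fin (r * n) → ℂ, DifferentiableAt ℂ
        (fun t : Fin (r * n) → ℂ => time t (r * n - m)) t := fun t => by
      simp only [time_of_lt _ hm]
      exact differentiableAt_apply _ _
    have h1 := eq_of_hasDerivAt_zero
      (f := fun t => PowerSeries.coeff m (genNormal hr (u t)) - time t (r * n - m))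
      (fun t ht => (hcomp (fun v hv => contDiffAt_genNormal hv 1 m) t ht).sub (hd t))
      (fun t ht J => by
        have h2 := (hflow t ht J).2.2 m
        have h3 : HasDerivAt (fun s => time (Function.update t J s) (r * n - m))
            (if m = r * n - (J.val + 1) then (1 : ℂ) else 0) (t J) := by
          simp only [time_of_lt _ hm]
          have := hasDerivAt_pi.1 (hasDerivAt_update t J (t J)) ⟨r * n - m - 1, by omega⟩
          rw [Pi.single_apply] at this
          have hJ := J.2
          have e : m = r * n - (J.val + 1) ↔ (⟨r * n - m - 1, by omega⟩ : Fin (r * n)) = J := by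
            rw [Fin.ext_iff]
            exact ⟨fun h => by change r * n - m - 1 = J.val; omega,
              fun h => by change r * n - m - 1 = J.val at h; omega⟩
          simpa only [e] using this
        have h4 := h2.sub h3
        rwa [PowerSeries.coeff_X_pow, sub_self] at h4) ht hε
    beta_reduce at h1
    rw [hu₁, ← hpg, ← time_eq_coeff_normalForm _ _ (by omega), sub_self, sub_eq_zero] at h1
    exact h1
  -- The gauge moves with the velocity `-Ξ Y`, which has no constant term.
  have hconst : ∀ t ∈ Metric.ball t₁ ε, constTerm (genGauge hr (u t)) = constTerm Y₁ := by
    intro t ht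
    rw [hYg, ← hu₁]
    ext1 i j
    simp only [RingHom.mapMatrix_apply, Matrix.map_apply,
      ← PowerSeries.coeff_zero_eq_constantCoeff_apply]
    refine eq_of_hasDerivAt_zero (f := fun t => PowerSeries.coeff 0 (genGauge hr (u t) i j))
      (hcomp fun v hv => contDiffSeriesAt_genGauge hv 1 i j 0) (fun t ht J => ?_) ht hε
    have h2 := (hflow t ht J).1 i j 0
    convert h2
    rw [Matrix.neg_apply, map_neg, PowerSeries.coeff_zero_eq_constantCoeff_apply]
    have h3 := congrFun (congrFun (map_mul constTerm (tailPart r (dressed n r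
      (genGauge hr (u (Function.update t J (t J)))) (genInv hr (u (Function.update t J (t J))))
        (J.val + 1))) (genGauge hr (u (Function.update t J (t J))))) i) j
    rw [constTerm_tailPart, zero_mul] at h3
    rw [eq_comm, neg_eq_zero]
    exact h3
  -- Together with `hconst` this makes the constant term commute with `𝒩` on the whole ball, which
  -- keeps the leading coefficient a polynomial in `𝒩`.
  have hcomm : Commute (constTerm Y₁) (jordanN n) := by
    have := (hA.commute_casimirU hr hY).add_left (Commute.one_left _)
    rwa [casimirU, sub_add_cancel] at this
  refine ⟨Metric.ball t₁ ε, fun t => admPoly hr (u t), fun t => genGauge hr (u t),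
    ⟨Metric.isOpen_ball, fun t ht => ?_, fun t ht => ?_, ?_, ?_⟩, Metric.mem_ball_self hε, ?_, ?_⟩
  · obtain ⟨hU, hYY, hp, hE⟩ := (gen_spec hr).1 _ (hball t ht).2
    rw [← connSeries_admPoly] at hE
    refine isGaugeFixed_of_formalEq hr (degree_admPoly_lt hr (u t)) (β₀ := _) (β₁ := _)
      (by rw [connSeries_admPoly]; exact isAdmissible_admSeries hr (u t))
      (JordanConnection.corner_ne_zero (hball t ht).2) hp hU hYY hE ?_ (htimes t ht)
    rw [hconst t ht]
    exact hcomm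
  · exact IsFormalSolution.of_genNormal (hball t ht).2 (htimes t ht) (degree_admPoly_lt hr (u t))
      (connSeries_admPoly hr (u t))
  · intro x i j t ht
    have h1 : (fun t => evalAt (admPoly hr (u t)) x i j) = fun t => (n : ℂ)⁻¹ *
        ∑ k ∈ Finset.range (r - 1 + 1), PowerSeries.coeff (r - 1 - k) (admSeries hr (u t) i j) *
          x ^ k := by
      funext t
      rw [← evalAt_revPoly]
      simp only [admPoly, evalAt, Matrix.map_apply, Matrix.smul_apply, Polynomial.eval_smul,
        smul_eq_mul]
    rw [h1]
    refine DifferentiableAt.differentiableWithinAt ?_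
    refine (DifferentiableAt.fun_sum fun k _ => ?_).const_mul _
    exact (hcomp (fun v _ => contDiffSeriesAt_admSeries (hr := hr) 1 i j (r - 1 - k)) t ht).mul_const _
  · intro J t ht x
    have hJ := J.2
    obtain ⟨hU, hYY, hp, hE⟩ := (gen_spec hr).1 _ (hball t ht).2
    rw [← connSeries_admPoly] at hE
    obtain ⟨hFd, hF⟩ := flow_connSeries (by omega) (degree_admPoly_lt hr (u t)) hYY hE
      (J := J.val + 1) (by omega)
    have hc := hasDerivAt_update_of_genSystem (hball t ht).1 J
    have h1 := hasDerivSeries_admSeries (hr := hr) hc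
    rw [Function.update_eq_self, admSeries_genField (hball t ht).2 (by omega) (by omega),
      ← connSeries_admPoly, ← hF] at h1
    simp only [← connSeries_admPoly] at h1
    have h2 := hasDerivAt_evalAt_of_connSeries (by omega)
      (Filter.Eventually.of_forall fun s => degree_admPoly_lt hr _) hFd h1 x
    ext1 i j
    have h3 : dTime J (fun t => admPoly hr (u t)) t x i j = _ := (h2 i j).deriv
    rw [Matrix.add_apply, Matrix.sub_apply, h3, evalAt_add, evalAt_sub, evalAt_mul, evalAt_mul,
      Matrix.add_apply, Matrix.sub_apply, Matrix.sub_apply, Matrix.zero_apply]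
    ring
  · beta_reduce
    rw [hu₁, admPoly, hA.admSeries_paramsOf hr]
    exact (eq_smul_revPoly (by omega) hA.degree_lt).symm
  · beta_reduce
    rw [hu₁, ← hYg]

end Existence

/-! ### Properties of arbitrary deformations -/

section Deformation

open scoped PowerSeries
open Topology

variable {n r : ℕ} [NeZero n]

/-- By Lagrange interpolation at the nodes `0, …, r - 1` the coefficients are fixed linear
combinations of values, so they inherit holomorphy. -/
theorem HolomorphicOn.differentiableAt_coeff {m : ℕ} {W : Set (Fin m → ℂ)}
    {F : (Fin m → ℂ) → Matrix (Fin n) (Fin n) ℂ[X]} (hF : HolomorphicOn W F) (hW : IsOpen W)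
    (hd : ∀ t ∈ W, ∀ i j, (F t i j).degree < r) {t : Fin m → ℂ} (ht : t ∈ W) (i j : Fin n) (k : ℕ) :
    DifferentiableAt ℂ (fun t => (F t i j).coeff k) t := by
  have hinj : Set.InjOn (fun a : ℕ => (a : ℂ)) (Finset.range r : Finset ℕ) :=
    fun a _ b _ hab => Nat.cast_injective hab
  have h : ∀ t ∈ W, (F t i j).coeff k = ∑ a ∈ Finset.range r, evalAt (F t) (a : ℂ) i j *
      (Lagrange.basis (Finset.range r) (fun a : ℕ => (a : ℂ)) a).coeff k := by
    intro t ht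
    conv_lhs => rw [Lagrange.eq_interpolate (f := F t i j) hinj (by rw [Finset.card_range]; exact hd t ht i j),
      Lagrange.interpolate_apply, Polynomial.finsetSum_coeff]
    simp only [Polynomial.coeff_C_mul]
    rfl
  refine DifferentiableAt.congr_of_eventuallyEq ?_
    (Filter.eventuallyEq_of_mem (hW.mem_nhds ht) h)
  exact DifferentiableAt.fun_sum fun a _ =>
    (((hF a i j) t ht).differentiableAt (hW.mem_nhds ht)).mul_const _

theorem HasDerivSeries.paramsOf {M : ℂ → Matrix (Fin n) (Fin n) ℂ⟦X⟧}
    {M' : Matrix (Fin n) (Fin n) ℂ⟦X⟧} {s₀ : ℂ} (h : HasDerivSeries M M' s₀) :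
    HasDerivAt (fun s => paramsOf r (M s)) (paramsOf r M') s₀ :=
  hasDerivAt_pi.2 fun _ => (h _ _ _).const_mul _

theorem hasDerivAt_comp_update {E : Type*} [NormedAddCommGroup E] [NormedSpace ℂ E] {m : ℕ}
    {f : (Fin m → ℂ) → E} {f' : (Fin m → ℂ) →L[ℂ] E} {t : Fin m → ℂ} (hf : HasFDerivAt f f' t)
    (J : Fin m) : HasDerivAt (fun s => f (Function.update t J s)) (f' (Pi.single J 1)) (t J) := by
  refine HasFDerivAt.comp_hasDerivAt (t J) (l := f) ?_ (hasDerivAt_update t J (t J))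
  rwa [Function.update_eq_self]

theorem eventually_update_mem {m : ℕ} {W : Set (Fin m → ℂ)} (hW : IsOpen W) {t : Fin m → ℂ}
    (ht : t ∈ W) (J : Fin m) : ∀ᶠ s in 𝓝 (t J), Function.update t J s ∈ W := by
  have hc : ContinuousAt (fun s => Function.update t J s) (t J) :=
    (hasDerivAt_update t J (t J)).continuousAt
  refine hc.eventually_mem ?_
  rw [Function.update_eq_self]
  exact hW.mem_nhds ht

variable {W : Set (Fin (r * n) → ℂ)} {A : (Fin (r * n) → ℂ) → Matrix (Fin n) (Fin n) ℂ[X]}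
  {Y : (Fin (r * n) → ℂ) → Matrix (Fin n) (Fin n) ℂ⟦X⟧}

theorem IsDeformation.corner_ne_zero (hr : 2 ≤ r) (h : IsDeformation n r W A Y)
    {t : Fin (r * n) → ℂ} (ht : t ∈ W) : paramsOf r (connSeries r (A t)) (cornerIdx n hr) ≠ 0 :=
  (h.gaugeFixed t ht).corner_ne_zero hr

theorem IsDeformation.eq_genGauge (hr : 2 ≤ r) (h : IsDeformation n r W A Y)
    {t : Fin (r * n) → ℂ} (ht : t ∈ W) : Y t = genGauge hr (paramsOf r (connSeries r (A t))) := by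
  obtain ⟨t0, ht0⟩ := h.formalSolution t ht
  exact ((h.gaugeFixed t ht).eq_gen hr ht0).1

theorem IsDeformation.defMatrix_eq (hr : 2 ≤ r) (h : IsDeformation n r W A Y)
    {t : Fin (r * n) → ℂ} (ht : t ∈ W) (J : Fin (r * n)) : defMatrix (Y t) (J.val + 1) =
      revPoly r (dressed n r (genGauge hr (paramsOf r (connSeries r (A t))))
        (genInv hr (paramsOf r (connSeries r (A t)))) (J.val + 1)) := by
  rw [h.eq_genGauge hr ht]
  exact JordanConnection.defMatrix_eq ((gen_spec hr).1 _ (h.corner_ne_zero hr ht)).2.1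
    (by have := J.2; omega)

theorem IsDeformation.hasDerivAt_evalAt (h : IsDeformation n r W A Y)
    {t : Fin (r * n) → ℂ} (ht : t ∈ W) (J : Fin (r * n)) (x : ℂ) (i j : Fin n) :
    HasDerivAt (fun s => evalAt (A (Function.update t J s)) x i j)
      (evalAt (dxPoly (defMatrix (Y t) (J.val + 1)) + (defMatrix (Y t) (J.val + 1) * A t -
        A t * defMatrix (Y t) (J.val + 1))) x i j) (t J) := by
  have h1 := (hasDerivAt_comp_update
    (((h.holomorphic x i j) t ht).differentiableAt (h.isOpen.mem_nhds ht)).hasFDerivAt J)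
  have h2 := congrFun (congrFun (h.flow J t ht x) i) j
  have h3 : dTime J A t x i j = _ := h1.deriv
  rw [Matrix.add_apply, Matrix.sub_apply, Matrix.sub_apply, h3, Matrix.zero_apply] at h2
  rw [evalAt_add, evalAt_sub, evalAt_mul, evalAt_mul, Matrix.add_apply, Matrix.sub_apply]
  refine (congrArg (HasDerivAt _ · _) ?_).mp h1
  linear_combination h2

theorem IsDeformation.differentiableAt_params (h : IsDeformation n r W A Y)
    {t : Fin (r * n) → ℂ} (ht : t ∈ W) :
    DifferentiableAt ℂ (fun t => paramsOf r (connSeries r (A t))) t := by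
  refine differentiableAt_pi.2 fun x => ?_
  simp only [paramsOf_connSeries]
  exact h.holomorphic.differentiableAt_coeff h.isOpen (fun t ht => (h.gaugeFixed t ht).degree_lt) ht
    _ _ _

/-- Any deformation, however it was obtained, moves along the generic vector fields; this makes the
formulas for the generic gauge available to it. -/
theorem IsDeformation.hasDerivAt_params (hr : 2 ≤ r) (h : IsDeformation n r W A Y)
    {t : Fin (r * n) → ℂ} (ht : t ∈ W) (J : Fin (r * n)) :
    HasDerivAt (fun s => paramsOf r (connSeries r (A (Function.update t J s))))
      (genField hr (J.val + 1) (paramsOf r (connSeries r (A t)))) (t J) := by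
  have hW := eventually_update_mem h.isOpen ht J
  have hgf := h.gaugeFixed t ht
  obtain ⟨t0, ht0⟩ := h.formalSolution t ht
  obtain ⟨hU, hYY, hp, hE⟩ := (gen_spec hr).1 _ (h.corner_ne_zero hr ht)
  rw [hgf.admSeries_paramsOf hr] at hE
  have hd : ∀ t ∈ W, ∀ i j, (A t i j).degree < r := fun t ht => (h.gaugeFixed t ht).degree_lt
  have hD : HasDerivSeries (fun s => connSeries r (A (Function.update t J s)))
      (Matrix.of fun i j => PowerSeries.mk fun k =>
        fderiv ℂ (fun t => PowerSeries.coeff k (connSeries r (A t) i j)) t (Pi.single J 1)) (t J) := by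
    intro i j k
    rw [Matrix.of_apply, PowerSeries.coeff_mk]
    refine hasDerivAt_comp_update (f := fun t => PowerSeries.coeff k (connSeries r (A t) i j))
      (DifferentiableAt.hasFDerivAt ?_) J
    simp only [coeff_connSeries]
    split_ifs
    · exact (h.holomorphic.differentiableAt_coeff h.isOpen hd ht _ _ _).const_mul _
    · exact differentiableAt_const _
  have h1 := hasDerivSeries_connSeries_of_evalAt (by omega) (hW.mono fun s hs => hd _ hs) hD
    (h.hasDerivAt_evalAt ht J)
  rw [h.eq_genGauge hr ht, (flow_connSeries (by omega) hgf.degree_lt hYY hE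
    (by have := J.2; omega)).2] at h1
  rw [h1] at hD
  rw [genField, hgf.admSeries_paramsOf hr]
  exact hD.paramsOf

theorem IsDeformation.hasFDerivAt_params (hr : 2 ≤ r) (h : IsDeformation n r W A Y)
    {t : Fin (r * n) → ℂ} (ht : t ∈ W) :
    HasFDerivAt (fun t => paramsOf r (connSeries r (A t)))
      (genSystem hr (paramsOf r (connSeries r (A t)))) t := by
  have h1 := (h.differentiableAt_params ht).hasFDerivAt
  convert h1 using 1
  refine ContinuousLinearMap.coe_injective (LinearMap.pi_ext' fun J => LinearMap.ext_ring ?_)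
  have h2 := (hasDerivAt_comp_update h1 J).unique (h.hasDerivAt_params hr ht J)
  simpa [genSystem_single] using h2.symm

/-- Bootstrap: the derivative of the parameters is a smooth function of the parameters themselves.
The Frobenius theorem for the Pfaffian system requires the class `C²`. -/
theorem IsDeformation.contDiffAt_params (hr : 2 ≤ r) (h : IsDeformation n r W A Y) (m : ℕ) :
    ∀ t ∈ W, ContDiffAt ℂ m (fun t => paramsOf r (connSeries r (A t))) t := by
  induction m with
  | zero =>
    intro t ht
    have hc : ContinuousOn (fun t => paramsOf r (connSeries r (A t))) W := fun t ht =>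
      (h.differentiableAt_params ht).continuousAt.continuousWithinAt
    exact (contDiffOn_zero.2 hc).contDiffAt (h.isOpen.mem_nhds ht)
  | succ m ih =>
    intro t ht
    exact contDiffAt_succ_iff_hasFDerivAt.2 ⟨fun t => genSystem hr (paramsOf r (connSeries r (A t))),
      ⟨W, h.isOpen.mem_nhds ht, fun t ht => h.hasFDerivAt_params hr ht⟩,
      ContDiffAt.comp (g := genSystem hr) t (contDiffAt_genSystem (h.corner_ne_zero hr ht) m)
        (ih t ht)⟩

/-- `∂_J 𝒯_K` is the truncation of `[Θ_K, Ξ_J]`, because dressed matrices move by commutators with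
the tails. -/
theorem IsDeformation.hasDerivAt_evalAt_defMatrix (hr : 2 ≤ r) (h : IsDeformation n r W A Y)
    {t : Fin (r * n) → ℂ} (ht : t ∈ W) {v : Fin r × Fin n × Fin n → ℂ}
    (hv : v = paramsOf r (connSeries r (A t))) (J K : Fin (r * n)) (x : ℂ) (i j : Fin n) :
    HasDerivAt (fun s => evalAt (defMatrix (Y (Function.update t J s)) (K.val + 1)) x i j)
      (evalAt (revPoly r (dressed n r (genGauge hr v) (genInv hr v) (K.val + 1) *
          tailPart r (dressed n r (genGauge hr v) (genInv hr v) (J.val + 1)) -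
        tailPart r (dressed n r (genGauge hr v) (genInv hr v) (J.val + 1)) *
          dressed n r (genGauge hr v) (genInv hr v) (K.val + 1))) x i j) (t J) := by
  have h0 : paramsOf r (connSeries r (A (Function.update t J (t J)))) = v := by
    rw [Function.update_eq_self, hv]
  have hc := h.hasDerivAt_params hr ht J
  rw [← hv, ← h0] at hc
  have h1 := hasDerivSeries_dressed_gen (hr := hr)
    (c := fun s => paramsOf r (connSeries r (A (Function.update t J s)))) (s₀ := t J)
    (by rw [Function.update_eq_self]; exact h.corner_ne_zero hr ht) (by omega)
    (by have := J.2; omega) hc (K.val + 1)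
  rw [h0] at h1
  refine (h1.evalAt_revPoly r x i j).congr_of_eventuallyEq ?_
  exact (eventually_update_mem h.isOpen ht J).mono fun s hs => by
    beta_reduce
    rw [h.defMatrix_eq hr hs]

theorem IsDeformation.zeroCurvature (hr : 2 ≤ r) (h : IsDeformation n r W A Y)
    (J K : Fin (r * n)) : ZeroCurvatureT W J K
      (fun t => defMatrix (Y t) (J.val + 1)) (fun t => defMatrix (Y t) (K.val + 1)) := by
  intro t ht x
  set v := paramsOf r (connSeries r (A t)) with hv
  have h1 : dTime J (fun t => defMatrix (Y t) (K.val + 1)) t x = _ :=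
    Matrix.ext fun i j => (h.hasDerivAt_evalAt_defMatrix hr ht hv J K x i j).deriv
  have h2 : dTime K (fun t => defMatrix (Y t) (J.val + 1)) t x = _ :=
    Matrix.ext fun i j => (h.hasDerivAt_evalAt_defMatrix hr ht hv K J x i j).deriv
  rw [h1, h2]
  beta_reduce
  rw [h.defMatrix_eq hr ht, h.defMatrix_eq hr ht, ← evalAt_mul, ← evalAt_mul, ← evalAt_sub,
    ← evalAt_sub, ← evalAt_add, revPoly_zeroCurvature (dressed_commute
      (genInv_mul (h.corner_ne_zero hr ht)) _ _)]
  ext i j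
  simp [evalAt]

/-- The entries of `𝒯_J` as functions of `x` and of the times. -/
theorem IsDeformation.contDiffAt_evalAt_defMatrix (hr : 2 ≤ r) (h : IsDeformation n r W A Y) (m : ℕ)
    (J : Fin (r * n)) {E : Type*} [NormedAddCommGroup E] [NormedSpace ℂ E] {f : E → ℂ}
    {g : E → Fin (r * n) → ℂ} {p : E} (hf : ContDiffAt ℂ m f p) (hg : ContDiffAt ℂ m g p)
    (hp : g p ∈ W) (i j : Fin n) :
    ContDiffAt ℂ m (fun q => evalAt (defMatrix (Y (g q)) (J.val + 1)) (f q) i j) p := by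
  have hev : (fun q => evalAt (defMatrix (Y (g q)) (J.val + 1)) (f q) i j) =ᶠ[𝓝 p] fun q =>
      ∑ k ∈ Finset.range (r + 1), PowerSeries.coeff (r - k)
        (dressed n r (genGauge hr (paramsOf r (connSeries r (A (g q)))))
          (genInv hr (paramsOf r (connSeries r (A (g q))))) (J.val + 1) i j) * f q ^ k :=
    (hg.continuousAt.eventually_mem (h.isOpen.mem_nhds hp)).mono fun q hq => by
      beta_reduce
      rw [h.defMatrix_eq hr hq, evalAt_revPoly]
  refine ContDiffAt.congr_of_eventuallyEq ?_ hev
  refine ContDiffAt.sum fun k _ => ContDiffAt.mul ?_ (hf.pow k)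
  exact ContDiffAt.comp (g := fun v => PowerSeries.coeff (r - k)
      (dressed n r (genGauge hr v) (genInv hr v) (J.val + 1) i j)) p
    (contDiffSeriesAt_dressed_gen (h.corner_ne_zero hr hp) m (J.val + 1) i j (r - k))
    ((h.contDiffAt_params hr m _ hp).comp p hg)

theorem IsDeformation.contDiffAt_evalAt (hr : 2 ≤ r) (h : IsDeformation n r W A Y) (m : ℕ)
    {E : Type*} [NormedAddCommGroup E] [NormedSpace ℂ E] {f : E → ℂ}
    {g : E → Fin (r * n) → ℂ} {p : E} (hf : ContDiffAt ℂ m f p) (hg : ContDiffAt ℂ m g p)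
    (hp : g p ∈ W) (i j : Fin n) :
    ContDiffAt ℂ m (fun q => evalAt (A (g q)) (f q) i j) p := by
  have hev : (fun q => evalAt (A (g q)) (f q) i j) =ᶠ[𝓝 p] fun q =>
      ∑ k : Fin r, paramsOf r (connSeries r (A (g q))) (k, i, j) * f q ^ k.val :=
    (hg.continuousAt.eventually_mem (h.isOpen.mem_nhds hp)).mono fun q hq => by
      beta_reduce
      have hd := (h.gaugeFixed _ hq).degree_lt i j
      rw [evalAt, Matrix.map_apply, Polynomial.eval_eq_sum_degreeLTEquiv (mem_degreeLT.2 hd)]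
      simp only [paramsOf_connSeries]
      rfl
  refine ContDiffAt.congr_of_eventuallyEq ?_ hev
  refine ContDiffAt.sum fun k _ => ContDiffAt.mul ?_ (hf.pow _)
  exact contDiffAt_pi.1 ((h.contDiffAt_params hr m _ hp).comp p hg) (k, i, j)

theorem IsDeformation.holomorphicOn_defMatrix (hr : 2 ≤ r) (h : IsDeformation n r W A Y)
    (J : Fin (r * n)) : HolomorphicOn W (fun t => defMatrix (Y t) (J.val + 1)) :=
  fun x i j t ht => ((h.contDiffAt_evalAt_defMatrix hr 1 J (f := fun _ => x) (g := id)
    contDiffAt_const contDiffAt_id ht i j).differentiableAt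
      (by norm_num)).differentiableWithinAt

/-- Each partial derivative is the constant term of `-Ξ Y`, and the tail `Ξ` begins at the order
one. -/
theorem IsDeformation.hasFDerivAt_constTerm (hr : 2 ≤ r) (h : IsDeformation n r W A Y)
    {t : Fin (r * n) → ℂ} (ht : t ∈ W) (i j : Fin n) :
    HasFDerivAt (fun t => valueAtInfty (Y t) i j) (0 : (Fin (r * n) → ℂ) →L[ℂ] ℂ) t := by
  have hev : (fun t => valueAtInfty (Y t) i j) =ᶠ[𝓝 t] fun t =>
      PowerSeries.coeff 0 (genGauge hr (paramsOf r (connSeries r (A t))) i j) :=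
    Filter.eventuallyEq_of_mem (h.isOpen.mem_nhds ht) fun t ht => by
      rw [h.eq_genGauge hr ht, valueAtInfty, Matrix.map_apply,
        PowerSeries.coeff_zero_eq_constantCoeff_apply]
  refine HasFDerivAt.congr_of_eventuallyEq ?_ hev
  have hd : DifferentiableAt ℂ (fun t =>
      PowerSeries.coeff 0 (genGauge hr (paramsOf r (connSeries r (A t))) i j)) t :=
    DifferentiableAt.comp (g := fun v => PowerSeries.coeff 0 (genGauge hr v i j)) t
      ((contDiffSeriesAt_genGauge (h.corner_ne_zero hr ht) 1 i j 0).differentiableAt one_ne_zero)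
      (h.differentiableAt_params ht)
  refine (congrArg (HasFDerivAt _ · _) ?_).mp hd.hasFDerivAt
  refine ContinuousLinearMap.coe_injective (LinearMap.pi_ext' fun J => LinearMap.ext_ring ?_)
  have h0 : paramsOf r (connSeries r (A (Function.update t J (t J)))) =
      paramsOf r (connSeries r (A t)) := by rw [Function.update_eq_self]
  have hc := h.hasDerivAt_params hr ht J
  rw [← h0] at hc
  have h1 := (hasDerivSeries_gen_of_flow (hr := hr)
    (c := fun s => paramsOf r (connSeries r (A (Function.update t J s)))) (s₀ := t J)
    (by rw [Function.update_eq_self]; exact h.corner_ne_zero hr ht) (by omega : J.val + 1 ≠ 0)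
    (by have := J.2; omega) hc).1 i j 0
  have h2 := (hasDerivAt_comp_update hd.hasFDerivAt J).unique h1
  have h3 := congrFun (congrFun (map_mul constTerm (tailPart r (dressed n r
    (genGauge hr (paramsOf r (connSeries r (A (Function.update t J (t J))))))
      (genInv hr (paramsOf r (connSeries r (A (Function.update t J (t J))))))
        (J.val + 1))) (genGauge hr (paramsOf r (connSeries r (A (Function.update t J (t J)))))))
          i) j
  rw [constTerm_tailPart, zero_mul] at h3
  rw [Matrix.neg_apply, map_neg, PowerSeries.coeff_zero_eq_constantCoeff_apply] at h2
  have h4 := h2.trans (neg_eq_zero.2 h3)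
  simpa using h4

end Deformation

/-! ### Integrability of the Pfaffian system -/

section Pfaffian

open scoped PowerSeries
open Topology

/-- The Frobenius theorem for a linear Pfaffian system `∂_a Ψ = B_a Ψ`. -/
theorem exists_local_linear_solution {m n : ℕ} {B : Fin m → (Fin m → ℂ) → Matrix (Fin n) (Fin n) ℂ}
    {D : Fin m → Fin m → (Fin m → ℂ) → Matrix (Fin n) (Fin n) ℂ} {p₀ : Fin m → ℂ}
    (hB : ∀ᶠ p in 𝓝 p₀, ∀ a i j, ContDiffAt ℂ 2 (fun p => B a p i j) p)
    (hD : ∀ᶠ p in 𝓝 p₀, ∀ a b i j,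
      HasDerivAt (fun s => B a (Function.update p b s) i j) (D b a p i j) (p b))
    (hc : ∀ᶠ p in 𝓝 p₀, ∀ a b, D b a p + B a p * B b p = D a b p + B b p * B a p)
    (C : Matrix (Fin n) (Fin n) ℂ) :
    ∃ Ψ : (Fin m → ℂ) → Matrix (Fin n) (Fin n) ℂ, Ψ p₀ = C ∧
      ∀ᶠ p in 𝓝 p₀, ∀ i j, HasFDerivAt (fun p => Ψ p i j)
        (∑ a, (ContinuousLinearMap.proj a : (Fin m → ℂ) →L[ℂ] ℂ).smulRight ((B a p * Ψ p) i j)) p := by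
  set f : Fin m → (Fin m → ℂ) × (Fin n → Fin n → ℂ) → (Fin n → Fin n → ℂ) :=
    fun a q i j => ∑ l, B a q.1 i l * q.2 l j with hf
  set F : (Fin m → ℂ) × (Fin n → Fin n → ℂ) → ((Fin m → ℂ) →L[ℂ] (Fin n → Fin n → ℂ)) :=
    fun q => ∑ a, (ContinuousLinearMap.proj a).smulRight (f a q) with hF
  have hFapply : ∀ q h, F q h = ∑ a, h a • f a q := fun q h => by simp [hF]
  have hfd : ∀ q : (Fin m → ℂ) × (Fin n → Fin n → ℂ),
      (∀ a i j, ContDiffAt ℂ 2 (fun p => B a p i j) q.1) → ∀ a, ContDiffAt ℂ 2 (f a) q := by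
    intro q hq a
    refine contDiffAt_pi.2 fun i => contDiffAt_pi.2 fun j => ContDiffAt.sum fun l _ => ?_
    refine ContDiffAt.mul (ContDiffAt.comp (g := fun p => B a p i l) q (hq a i l) contDiffAt_fst) ?_
    exact contDiffAt_pi.1 (contDiffAt_pi.1 contDiffAt_snd l) j
  have hFd : ContDiffAt ℂ 2 F (p₀, C) :=
    ContDiffAt.sum fun a _ => contDiffAt_const.smulRight (hfd (p₀, C) hB.self_of_nhds a)
  have hfst : Filter.Tendsto Prod.fst (𝓝 (p₀, (C : Fin n → Fin n → ℂ))) (𝓝 p₀) :=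
    continuousAt_fst
  obtain ⟨u, hu₀, hu⟩ := exists_local_solution_of_symm hFd (by
    filter_upwards [hfst.eventually hB, hfst.eventually hD, hfst.eventually hc] with q hq hDq hcq h k
    have hd : ∀ w k, fderiv ℂ F q w k = ∑ a, k a • fderiv ℂ (f a) q w := by
      intro w k
      have e1 : HasFDerivAt F (∑ a : Fin m,
          (ContinuousLinearMap.smulRightL ℂ (Fin m → ℂ) _ (ContinuousLinearMap.proj a)).comp
            (fderiv ℂ (f a) q)) q := by
        refine HasFDerivAt.fun_sum fun a _ => ?_
        exact (ContinuousLinearMap.smulRightL ℂ (Fin m → ℂ) _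
          (ContinuousLinearMap.proj a)).hasFDerivAt.comp q
            ((hfd q hq a).differentiableAt two_ne_zero).hasFDerivAt
      rw [e1.fderiv]
      simp
    -- The derivative is computed along a curve that moves the base point in the direction `b` and
    -- the value with the velocity `f b`. It produces `D b a + B a * B b`, whose symmetry in `a` and
    -- `b` is the compatibility hypothesis.
    have hdf : ∀ a b, fderiv ℂ (f a) q (Pi.single b 1, f b q) =
        fun i j => ((D b a q.1 + B a q.1 * B b q.1) * Matrix.of q.2) i j := by
      intro a b
      have hc : HasDerivAt (fun s => (Function.update q.1 b s, q.2 + (s - q.1 b) • f b q))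
          ((Pi.single b 1 : Fin m → ℂ), f b q) (q.1 b) := by
        refine (hasDerivAt_update q.1 b (q.1 b)).prodMk ?_
        simpa using (((hasDerivAt_id (q.1 b)).sub_const (q.1 b)).smul_const (f b q)).const_add q.2
      have h0 : (Function.update q.1 b (q.1 b), q.2 + (q.1 b - q.1 b) • f b q) = q := by simp
      have h1 : HasDerivAt (fun s => f a (Function.update q.1 b s, q.2 + (s - q.1 b) • f b q))
          (fderiv ℂ (f a) q (Pi.single b 1, f b q)) (q.1 b) := by
        refine HasFDerivAt.comp_hasDerivAt (q.1 b) (l := f a) ?_ hc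
        rw [h0]
        exact ((hfd q hq a).differentiableAt two_ne_zero).hasFDerivAt
      refine h1.unique (hasDerivAt_pi.2 fun i => hasDerivAt_pi.2 fun j => ?_)
      have h2 : ∀ l, HasDerivAt (fun s => q.2 l j + (s - q.1 b) * f b q l j) (f b q l j) (q.1 b) :=
        fun l => by
          simpa using (((hasDerivAt_id (q.1 b)).sub_const (q.1 b)).mul_const (f b q l j)).const_add
            (q.2 l j)
      have h3 := HasDerivAt.fun_sum fun l (_ : l ∈ Finset.univ) => (hDq a b i l).mul (h2 l)
      simp only [Function.update_eq_self, sub_self, zero_mul, add_zero] at h3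
      refine (congrArg (HasDerivAt _ · _) ?_).mp h3
      rw [add_mul, Matrix.add_apply, Matrix.mul_assoc, Matrix.mul_apply, Matrix.mul_apply,
        Finset.sum_add_distrib]
      rfl
    have hpair : ∀ h, (h, F q h) = ∑ b, h b • ((Pi.single b 1 : Fin m → ℂ), f b q) := by
      intro h
      refine Prod.ext ?_ ?_
      · rw [Prod.fst_sum]
        ext b
        simp [Finset.sum_apply, Pi.single_apply]
      · rw [Prod.snd_sum, hFapply]
        rfl
    rw [hd, hd, hpair h, hpair k]
    simp only [map_sum, map_smul, Finset.smul_sum]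
    rw [Finset.sum_comm]
    refine Finset.sum_congr rfl fun a _ => Finset.sum_congr rfl fun b _ => ?_
    rw [hdf, hdf, hcq, smul_comm])
  refine ⟨u, hu₀, hu.mono fun p hp i j => ?_⟩
  have h1 := hasFDerivAt_pi'.1 (hasFDerivAt_pi'.1 hp i) j
  refine (congrArg (HasFDerivAt _ · _) ?_).mp h1
  ext h
  simp only [ContinuousLinearMap.comp_apply, ContinuousLinearMap.proj_apply, hFapply]
  simp only [hf, Finset.sum_apply, Pi.smul_apply, sum_apply,
    ContinuousLinearMap.smulRight_apply, ContinuousLinearMap.proj_apply]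
  rfl

variable {n r : ℕ} [NeZero n]

variable {W : Set (Fin (r * n) → ℂ)} {A : (Fin (r * n) → ℂ) → Matrix (Fin n) (Fin n) ℂ[X]}
  {Y : (Fin (r * n) → ℂ) → Matrix (Fin n) (Fin n) ℂ⟦X⟧}

theorem hasDerivAt_evalAt_dxPoly (F : Matrix (Fin n) (Fin n) ℂ[X]) (x : ℂ) (i j : Fin n) :
    HasDerivAt (fun w => evalAt F w i j) (evalAt (dxPoly F) x i j) x :=
  (F i j).hasDerivAt x

theorem contDiff_tail {m : ℕ} {k : WithTop ℕ∞} :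
    ContDiff ℂ k (fun p : Fin (m + 1) → ℂ => Fin.tail p) :=
  contDiff_pi.2 fun J => contDiff_apply ℂ ℂ J.succ

theorem IsDeformation.pfaffianIntegrable (hr : 2 ≤ r) (h : IsDeformation n r W A Y) :
    PfaffianIntegrable W A (fun J t => defMatrix (Y t) (J.val + 1)) := by
  intro x₁ t₁ ht₁ C
  set T : Fin (r * n) → (Fin (r * n) → ℂ) → Matrix (Fin n) (Fin n) ℂ[X] :=
    fun J t => defMatrix (Y t) (J.val + 1) with hT
  -- The variable `x` becomes the coordinate `0` in front of the times, so that one linear system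
  -- contains both kinds of equations.
  set p₀ : Fin (r * n + 1) → ℂ := Fin.cons x₁ t₁ with hp₀
  have hWev : ∀ᶠ p in 𝓝 p₀, (Fin.tail p : Fin (r * n) → ℂ) ∈ W := by
    refine (contDiff_tail (k := 0)).continuous.continuousAt.eventually_mem ?_
    rw [hp₀, Fin.tail_cons]
    exact h.isOpen.mem_nhds ht₁
  set B : Fin (r * n + 1) → (Fin (r * n + 1) → ℂ) → Matrix (Fin n) (Fin n) ℂ :=
    fun a p => (Fin.cons (A (Fin.tail p)) (fun J => T J (Fin.tail p)) :
      Fin (r * n + 1) → Matrix (Fin n) (Fin n) ℂ[X]) a |> fun F => evalAt F (p 0) with hBdef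
  have hB0 : ∀ p, B 0 p = evalAt (A (Fin.tail p)) (p 0) := fun p => by simp only [hBdef, Fin.cons_zero]
  have hBs : ∀ J p, B (Fin.succ J) p = evalAt (T J (Fin.tail p)) (p 0) := fun J p => by
    simp only [hBdef, Fin.cons_succ]
  have hBd : ∀ p, (Fin.tail p : Fin (r * n) → ℂ) ∈ W → ∀ a i j, ContDiffAt ℂ 2 (fun p => B a p i j) p := by
    intro p hp a i j
    have h1 : ContDiffAt ℂ 2 (fun p : Fin (r * n + 1) → ℂ => p 0) p :=
      (contDiff_apply ℂ ℂ 0).contDiffAt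
    induction a using Fin.cases with
    | zero =>
      simp only [hB0]
      exact h.contDiffAt_evalAt hr 2 h1 contDiff_tail.contDiffAt hp i j
    | succ J =>
      simp only [hBs]
      exact h.contDiffAt_evalAt_defMatrix hr 2 J h1 contDiff_tail.contDiffAt hp i j
  set D : Fin (r * n + 1) → Fin (r * n + 1) → (Fin (r * n + 1) → ℂ) → Matrix (Fin n) (Fin n) ℂ :=
    fun b a p => Matrix.of fun i j => deriv (fun s => B a (Function.update p b s) i j) (p b) with hDdef
  have hD : ∀ p, (Fin.tail p : Fin (r * n) → ℂ) ∈ W → ∀ a b i j,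
      HasDerivAt (fun s => B a (Function.update p b s) i j) (D b a p i j) (p b) := by
    intro p hp a b i j
    have h1 := hasDerivAt_comp_update
      ((hBd p hp a i j).differentiableAt two_ne_zero).hasFDerivAt b
    exact h1.differentiableAt.hasDerivAt
  have hD0 : ∀ J p, D 0 (Fin.succ J) p = evalAt (dxPoly (T J (Fin.tail p))) (p 0) := by
    intro J p
    ext1 i j
    change deriv (fun s => B _ (Function.update p _ s) i j) (p _) = _
    simp only [hBs, Fin.tail_update_zero, Function.update_self]
    exact (hasDerivAt_evalAt_dxPoly _ _ _ _).deriv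
  have hDs0 : ∀ J p, D (Fin.succ J) 0 p = dTime J A (Fin.tail p) (p 0) := by
    intro J p
    ext1 i j
    change deriv (fun s => B _ (Function.update p _ s) i j) (p _) = _
    simp only [hB0, Fin.tail_update_succ, Function.update_of_ne (Fin.succ_ne_zero J).symm]
    rfl
  have hDss : ∀ J K p, D (Fin.succ J) (Fin.succ K) p = dTime J (T K) (Fin.tail p) (p 0) := by
    intro J K p
    ext1 i j
    change deriv (fun s => B _ (Function.update p _ s) i j) (p _) = _
    simp only [hBs, Fin.tail_update_succ, Function.update_of_ne (Fin.succ_ne_zero J).symm]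
    rfl
  have hX : ∀ J p, (Fin.tail p : Fin (r * n) → ℂ) ∈ W →
      D (Fin.succ J) 0 p + B 0 p * B (Fin.succ J) p = D 0 (Fin.succ J) p + B (Fin.succ J) p * B 0 p := by
    intro J p hp
    rw [hD0, hDs0, hB0, hBs, ← sub_eq_zero, ← h.flow J _ hp (p 0)]
    abel
  -- Compatibility of `x` with a time is the flow equation of the deformation, and that of two times
  -- is their zero curvature.
  have hcomm : ∀ p, (Fin.tail p : Fin (r * n) → ℂ) ∈ W → ∀ a b, D b a p + B a p * B b p = D a b p + B b p * B a p := by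
    intro p hp a b
    induction a using Fin.cases with
    | zero =>
      induction b using Fin.cases with
      | zero => rfl
      | succ J => exact hX J p hp
    | succ K =>
      induction b using Fin.cases with
      | zero => exact (hX K p hp).symm
      | succ J =>
        rw [hDss, hDss, hBs, hBs, ← sub_eq_zero, ← h.zeroCurvature hr J K _ hp (p 0)]
        abel
  obtain ⟨Ψ, hΨ₀, hΨ⟩ := exists_local_linear_solution (hWev.mono hBd) (hWev.mono hD)
    (hWev.mono hcomm) C
  obtain ⟨O, hO, hOo, hOp⟩ := eventually_nhds_iff.1 (hΨ.and hWev)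
  have hcons : Differentiable ℂ fun q : ℂ × (Fin (r * n) → ℂ) =>
      (Fin.cons q.1 q.2 : Fin (r * n + 1) → ℂ) := by
    refine differentiable_pi.2 fun a => ?_
    induction a using Fin.cases with
    | zero => exact differentiable_fst
    | succ J =>
      simp only [Fin.cons_succ]
      fun_prop
  refine ⟨(fun q : ℂ × (Fin (r * n) → ℂ) => (Fin.cons q.1 q.2 : Fin (r * n + 1) → ℂ)) ⁻¹' O,
    fun q => Ψ (Fin.cons q.1 q.2), hOo.preimage hcons.continuous, hOp, ?_, hΨ₀, ?_, ?_⟩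
  · rintro ⟨x, t⟩ hq
    have := (hO _ hq).2
    rw [Fin.tail_cons] at this
    exact ⟨trivial, this⟩
  · intro i j q hq
    exact (DifferentiableAt.comp (g := fun p => Ψ p i j) q ((hO _ hq).1 i j).differentiableAt
      (hcons q)).differentiableWithinAt
  · intro x t hq
    have hder := (hO _ hq).1
    have hpart : ∀ a i j, HasDerivAt (fun s => Ψ (Function.update (Fin.cons x t) a s) i j)
        ((B a (Fin.cons x t) * Ψ (Fin.cons x t)) i j) ((Fin.cons x t : Fin (r * n + 1) → ℂ) a) := by
      intro a i j
      have h1 := hasDerivAt_comp_update (hder i j) a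
      refine (congrArg (HasDerivAt _ · _) ?_).mp h1
      simp [Pi.single_apply]
    refine ⟨fun i j => ?_, fun J i j => ?_⟩
    · have h1 := hpart 0 i j
      simp only [Fin.update_cons_zero] at h1
      rw [hB0] at h1
      exact h1
    · have h1 := hpart J.succ i j
      simp only [← Fin.cons_update] at h1
      rw [hBs] at h1
      exact h1

end Pfaffian

/-! ### Conjugation by the constant matrix `1 + U` -/

section Conjugation

open scoped PowerSeries
open Topology

variable {n r : ℕ}

theorem coeff_conj_poly (P Q : Matrix (Fin n) (Fin n) ℂ) (F : Matrix (Fin n) (Fin n) ℂ[X])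
    (i j : Fin n) (k : ℕ) :
    ((P.map Polynomial.C * F * Q.map Polynomial.C) i j).coeff k =
      (P * F.map (fun p => p.coeff k) * Q) i j := by
  simp only [Matrix.mul_apply, Matrix.map_apply, Polynomial.finsetSum_coeff,
    Polynomial.coeff_mul_C, Polynomial.coeff_C_mul]

theorem coeff_conj_series (P Q : Matrix (Fin n) (Fin n) ℂ) (M : Matrix (Fin n) (Fin n) ℂ⟦X⟧)
    (i j : Fin n) (k : ℕ) :
    PowerSeries.coeff k ((P.map PowerSeries.C * M * Q.map PowerSeries.C) i j) =
      (P * M.map (fun f => PowerSeries.coeff k f) * Q) i j := by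
  simp only [Matrix.mul_apply, Matrix.map_apply, map_sum, PowerSeries.coeff_mul_C,
    PowerSeries.coeff_C_mul]

theorem revPoly_conj (P Q : Matrix (Fin n) (Fin n) ℂ) (M : Matrix (Fin n) (Fin n) ℂ⟦X⟧) (D : ℕ) :
    revPoly D (P.map PowerSeries.C * M * Q.map PowerSeries.C) =
      P.map Polynomial.C * revPoly D M * Q.map Polynomial.C := by
  ext i j k
  rw [coeff_revPoly, coeff_conj_series, coeff_conj_poly]
  have h : (revPoly D M).map (fun p => p.coeff k) =
      if k ≤ D then M.map (fun f => PowerSeries.coeff (D - k) f) else 0 := by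
    ext a b
    rw [Matrix.map_apply, coeff_revPoly]
    split_ifs <;> rfl
  rw [h]
  split_ifs
  · rfl
  · rw [Matrix.mul_zero, Matrix.zero_mul]; rfl

theorem connSeries_conj (P Q : Matrix (Fin n) (Fin n) ℂ) (A : Matrix (Fin n) (Fin n) ℂ[X]) :
    connSeries r (P.map Polynomial.C * A * Q.map Polynomial.C) =
      P.map PowerSeries.C * connSeries r A * Q.map PowerSeries.C := by
  ext i j k
  rw [coeff_connSeries, coeff_conj_series, coeff_conj_poly]
  have h : (connSeries r A).map (fun f => PowerSeries.coeff k f) =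
      if k < r then (n : ℂ) • A.map (fun p => p.coeff (r - 1 - k)) else 0 := by
    ext a b
    rw [Matrix.map_apply, coeff_connSeries]
    split_ifs <;> rfl
  rw [h]
  split_ifs
  · rw [Matrix.mul_smul, Matrix.smul_mul]; rfl
  · rw [Matrix.mul_zero, Matrix.zero_mul]; rfl

theorem dxPoly_conj (P Q : Matrix (Fin n) (Fin n) ℂ) (F : Matrix (Fin n) (Fin n) ℂ[X]) :
    dxPoly (P.map Polynomial.C * F * Q.map Polynomial.C) =
      P.map Polynomial.C * dxPoly F * Q.map Polynomial.C := by
  ext1 i j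
  simp only [dxPoly, Matrix.mul_apply, Matrix.map_apply, map_sum, Polynomial.derivative_mul,
    Polynomial.derivative_C, zero_mul, zero_add, mul_zero, add_zero]

theorem evalAt_conj (P Q : Matrix (Fin n) (Fin n) ℂ) (F : Matrix (Fin n) (Fin n) ℂ[X]) (x : ℂ) :
    evalAt (P.map Polynomial.C * F * Q.map Polynomial.C) x = P * evalAt F x * Q := by
  ext1 i j
  simp only [evalAt, Matrix.mul_apply, Matrix.map_apply, Polynomial.eval_finsetSum,
    Polynomial.eval_mul, Polynomial.eval_C]

theorem gradDer_map_C_mul (P : Matrix (Fin n) (Fin n) ℂ) (Y : Matrix (Fin n) (Fin n) ℂ⟦X⟧) :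
    gradDer (P.map PowerSeries.C * Y) = P.map PowerSeries.C * gradDer Y := by
  have h : euler (P.map PowerSeries.C * Y) = P.map PowerSeries.C * euler Y := by
    ext i j k
    simp only [coeff_euler, Matrix.mul_apply, Matrix.map_apply, map_sum, PowerSeries.coeff_C_mul,
      Finset.mul_sum]
    exact Finset.sum_congr rfl fun l _ => by ring
  rw [gradDer, gradDer, h, mul_add, mul_assoc, Matrix.mul_smul]

theorem constTerm_map_C (P : Matrix (Fin n) (Fin n) ℂ) : constTerm (P.map PowerSeries.C) = P := by
  ext1 i j
  rw [RingHom.mapMatrix_apply, Matrix.map_apply, Matrix.map_apply, PowerSeries.constantCoeff_C]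

theorem map_C_mul_map_C {P Q : Matrix (Fin n) (Fin n) ℂ} (h : P * Q = 1) :
    P.map (PowerSeries.C (R := ℂ)) * Q.map PowerSeries.C = 1 := by
  have := map_mul (PowerSeries.C (R := ℂ)).mapMatrix P Q
  rw [h, map_one] at this
  exact this.symm

/-- A constant matrix on the left commutes with `gradDer`, whose grading acts on the right; hence
the normal form `p` is unchanged. -/
theorem FormalEq.conj {Â Y : Matrix (Fin n) (Fin n) ℂ⟦X⟧} {p : ℂ⟦X⟧} (h : FormalEq r Â Y p)
    {P Q : Matrix (Fin n) (Fin n) ℂ} (hPQ : P * Q = 1) :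
    FormalEq r (Q.map PowerSeries.C * Â * P.map PowerSeries.C) (Q.map PowerSeries.C * Y) p := by
  have e : Q.map PowerSeries.C * Â * P.map PowerSeries.C * (Q.map PowerSeries.C * Y) =
      Q.map PowerSeries.C * (Â * Y) := by
    simp only [mul_assoc]
    rw [← mul_assoc (P.map _) (Q.map _), map_C_mul_map_C hPQ, one_mul]
  rw [FormalEq, gradDer_map_C_mul, e, ← Matrix.mul_smul, ← mul_add, h, mul_assoc]

/-- The constant term does not change, as it commutes with `P`. In the corner only the last row of
`Q` and the first column of `P` act, and these have the diagonal entry one and zeros elsewhere. -/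
theorem IsAdmissible.conj {Â : Matrix (Fin n) (Fin n) ℂ⟦X⟧} {β₀ β₁ : ℂ} (h : IsAdmissible Â β₀ β₁)
    {P Q : Matrix (Fin n) (Fin n) ℂ} (hP : ∀ i j : Fin n, j ≤ i → P i j = if j = i then 1 else 0)
    (hPQ : P * Q = 1) (hc : Commute P (constTerm Â)) :
    IsAdmissible (Q.map PowerSeries.C * Â * P.map PowerSeries.C) β₀ β₁ := by
  have hQ := unipotent_of_mul_eq_one hP hPQ
  have h0 : ∀ i j, PowerSeries.coeff 0 ((Q.map PowerSeries.C * Â * P.map PowerSeries.C) i j) =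
      PowerSeries.coeff 0 (Â i j) := by
    intro i j
    have h1 : constTerm (Q.map PowerSeries.C * Â * P.map PowerSeries.C) = constTerm Â := by
      rw [map_mul, map_mul, constTerm_map_C, constTerm_map_C, mul_assoc, ← hc.eq, ← mul_assoc,
        mul_eq_one_comm.1 hPQ, one_mul]
    rw [PowerSeries.coeff_zero_eq_constantCoeff_apply, PowerSeries.coeff_zero_eq_constantCoeff_apply]
    exact congrFun (congrFun h1 i) j
  refine ⟨fun i j hij => (h0 i j).trans (h.lower i j hij), fun i => (h0 i i).trans (h.diag i),
    fun i j hij => (h0 i j).trans (h.super i j hij), fun i j hi hj => ?_⟩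
  rw [coeff_conj_series, Matrix.mul_apply, Finset.sum_eq_single j, hP j j le_rfl, if_pos rfl,
    mul_one, Matrix.mul_apply, Finset.sum_eq_single i, hQ i i le_rfl, if_pos rfl, one_mul,
    Matrix.map_apply, h.corner i j hi hj]
  · intro b _ hb
    rw [hQ i b (Fin.le_def.2 (by omega)), if_neg hb, zero_mul]
  · simp
  · intro b _ hb
    rw [hP b j (Fin.le_def.2 (by omega)), if_neg (Ne.symm hb), mul_zero]
  · simp

variable [NeZero n]

theorem dressed_conj (P Q : Matrix (Fin n) (Fin n) ℂ) (Y Y' : Matrix (Fin n) (Fin n) ℂ⟦X⟧) (J : ℕ) :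
    dressed n r (Q.map PowerSeries.C * Y) (Y' * P.map PowerSeries.C) J =
      Q.map PowerSeries.C * dressed n r Y Y' J * P.map PowerSeries.C := by
  simp only [dressed, Matrix.mul_smul, Matrix.smul_mul, mul_assoc]

theorem defMatrix_conj {P Q : Matrix (Fin n) (Fin n) ℂ} {Y Y' : Matrix (Fin n) (Fin n) ℂ⟦X⟧}
    (hPQ : P * Q = 1) (hYY : Y * Y' = 1) {J : ℕ} (hJ : J ≤ r * n) :
    defMatrix (Q.map PowerSeries.C * Y) J =
      Q.map Polynomial.C * defMatrix Y J * P.map Polynomial.C := by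
  have h : Q.map PowerSeries.C * Y * (Y' * P.map PowerSeries.C) = 1 := by
    rw [mul_assoc, ← mul_assoc Y, hYY, one_mul, map_C_mul_map_C (mul_eq_one_comm.1 hPQ)]
  rw [defMatrix_eq h hJ, defMatrix_eq hYY hJ, dressed_conj, revPoly_conj]

variable {W : Set (Fin (r * n) → ℂ)} {A : (Fin (r * n) → ℂ) → Matrix (Fin n) (Fin n) ℂ[X]}
  {Y : (Fin (r * n) → ℂ) → Matrix (Fin n) (Fin n) ℂ⟦X⟧}

theorem IsDeformation.exists_gauge_inv (hr : 2 ≤ r) (h : IsDeformation n r W A Y)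
    {t : Fin (r * n) → ℂ} (ht : t ∈ W) : ∃ Y', Y t * Y' = 1 := by
  rw [h.eq_genGauge hr ht]
  exact ⟨_, ((gen_spec hr).1 _ (h.corner_ne_zero hr ht)).2.1⟩

theorem IsDeformation.valueAtInfty_mul_inv (hr : 2 ≤ r) (h : IsDeformation n r W A Y)
    {t : Fin (r * n) → ℂ} (ht : t ∈ W) : valueAtInfty (Y t) * (valueAtInfty (Y t))⁻¹ = 1 := by
  obtain ⟨Y', hYY⟩ := h.exists_gauge_inv hr ht
  have h1 : valueAtInfty (Y t) * constTerm Y' = 1 := by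
    have := map_mul constTerm (Y t) Y'
    rw [hYY, map_one] at this
    exact this.symm
  rwa [Matrix.inv_eq_right_inv h1]

theorem IsDeformation.constTerm_conj (hr : 2 ≤ r) (h : IsDeformation n r W A Y)
    {t : Fin (r * n) → ℂ} (ht : t ∈ W) :
    constTerm (((valueAtInfty (Y t))⁻¹).map PowerSeries.C * Y t) = 1 := by
  rw [map_mul, constTerm_map_C]
  exact mul_eq_one_comm.1 (h.valueAtInfty_mul_inv hr ht)

/-- Only local constancy can be expected, since `W` need not be connected; it suffices for
derivatives. -/
theorem IsDeformation.eventually_valueAtInfty_eq (hr : 2 ≤ r) (h : IsDeformation n r W A Y)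
    {t : Fin (r * n) → ℂ} (ht : t ∈ W) : ∀ᶠ t' in 𝓝 t, valueAtInfty (Y t') = valueAtInfty (Y t) := by
  obtain ⟨ε, hε, hball⟩ := Metric.isOpen_iff.1 h.isOpen t ht
  refine Filter.mem_of_superset (Metric.ball_mem_nhds t hε) fun t' ht' => Matrix.ext fun i j => ?_
  refine (convex_ball t ε).is_const_of_fderivWithin_eq_zero (𝕜 := ℂ)
    (f := fun t => valueAtInfty (Y t) i j)
    (fun s hs => (h.hasFDerivAt_constTerm hr (hball hs) i j).differentiableAt.differentiableWithinAt)
    (fun s hs => ?_) ht' (Metric.mem_ball_self hε)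
  rw [fderivWithin_of_isOpen Metric.isOpen_ball hs]
  exact (h.hasFDerivAt_constTerm hr (hball hs) i j).fderiv

/-- Conjugation by `1 + U` gives a deformation. -/
theorem IsDeformation.conj (hr : 2 ≤ r) (h : IsDeformation n r W A Y) :
    IsDeformation n r W
      (fun t => ((valueAtInfty (Y t))⁻¹).map Polynomial.C * A t *
        (valueAtInfty (Y t)).map Polynomial.C)
      (fun t => ((valueAtInfty (Y t))⁻¹).map PowerSeries.C * Y t) := by
  have key : ∀ t ∈ W, ∃ t0, IsGaugeFixed n r (fun j => time t (r * n - j))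
      (((valueAtInfty (Y t))⁻¹).map Polynomial.C * A t * (valueAtInfty (Y t)).map Polynomial.C) ∧
      IsFormalSolution n r
        (((valueAtInfty (Y t))⁻¹).map Polynomial.C * A t * (valueAtInfty (Y t)).map Polynomial.C)
        t0 t (((valueAtInfty (Y t))⁻¹).map PowerSeries.C * Y t) := by
    intro t ht
    obtain ⟨t0, ht0⟩ := h.formalSolution t ht
    have hA := h.gaugeFixed t ht
    have hPQ := h.valueAtInfty_mul_inv hr ht
    have hc1 := h.constTerm_conj hr ht
    obtain ⟨Y', hYY⟩ := h.exists_gauge_inv hr ht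
    obtain ⟨hU, hE⟩ := (isFormalSolution_iff (by omega) hA.degree_lt t0 t _).1 ht0
    set P := valueAtInfty (Y t) with hP
    have hd : ∀ i j, ((P⁻¹.map Polynomial.C * A t * P.map Polynomial.C) i j).degree < r := by
      intro i j
      rw [Polynomial.degree_lt_iff_coeff_zero]
      intro k hk
      have h0 : (A t).map (fun p => p.coeff k) = 0 := by
        ext1 a b
        exact (Polynomial.degree_lt_iff_coeff_zero _ _).1 (hA.degree_lt a b) k hk
      rw [coeff_conj_poly, h0, Matrix.mul_zero, Matrix.zero_mul, Matrix.zero_apply]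
    have hcomm : Commute P (jordanN n) := by
      have := (hA.commute_casimirU hr ht0).add_left (Commute.one_left _)
      rwa [casimirU, sub_add_cancel] at this
    have hcA : Commute P (constTerm (connSeries r (A t))) := by
      rw [constTerm_connSeries (by omega), hA.leading]
      exact ((Commute.sum_right _ _ _ fun m _ => (hcomm.pow_right m).smul_right _).smul_right
        _).smul_right _
    have hU' : IsUnipotentGauge (P⁻¹.map PowerSeries.C * Y t) := by
      intro i j _
      have := congrFun (congrFun hc1 i) j
      rw [RingHom.mapMatrix_apply, Matrix.map_apply,
        ← PowerSeries.coeff_zero_eq_constantCoeff_apply, Matrix.one_apply] at this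
      rw [this]
      exact if_congr eq_comm rfl rfl
    have hE' := hE.conj hPQ
    rw [← connSeries_conj] at hE'
    have hadm := (hA.isAdmissible hr).conj hU.constTerm_apply hPQ hcA
    rw [← connSeries_conj] at hadm
    refine ⟨t0, isGaugeFixed_of_formalEq hr hd hadm hA.lidskii_ne_zero
      (fun k hk => coeff_normalForm_of_lt t0 t hk) hU' (Y' := Y' * P.map PowerSeries.C) ?_ hE' ?_ ?_,
      (isFormalSolution_iff (by omega) hd t0 t _).2 ⟨hU', hE'⟩⟩
    · rw [mul_assoc, ← mul_assoc (Y t), hYY, one_mul, map_C_mul_map_C (mul_eq_one_comm.1 hPQ)]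
    · rw [hc1]
      exact Commute.one_left _
    · intro j hj
      exact (time_eq_coeff_normalForm t0 t (by omega)).symm
  refine ⟨h.isOpen, fun t ht => (key t ht).choose_spec.1,
    fun t ht => ⟨_, (key t ht).choose_spec.2⟩, ?_, ?_⟩
  · intro x i j t ht
    refine DifferentiableAt.differentiableWithinAt ?_
    -- Near `t` the conjugating matrix is constant, so it may be frozen at its value there.
    have hev : (fun t' => evalAt (((valueAtInfty (Y t'))⁻¹).map Polynomial.C * A t' *
        (valueAtInfty (Y t')).map Polynomial.C) x i j) =ᶠ[𝓝 t] fun t' =>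
        ((valueAtInfty (Y t))⁻¹ * evalAt (A t') x * valueAtInfty (Y t)) i j :=
      (h.eventually_valueAtInfty_eq hr ht).mono fun t' ht' => by
        simp only [ht', evalAt_conj]
    refine DifferentiableAt.congr_of_eventuallyEq ?_ hev
    simp only [Matrix.mul_apply]
    refine DifferentiableAt.fun_sum fun l _ => DifferentiableAt.mul_const
      (DifferentiableAt.fun_sum fun m _ => DifferentiableAt.const_mul ?_ _) _
    exact ((h.holomorphic x m l) t ht).differentiableAt (h.isOpen.mem_nhds ht)
  · intro J t ht x
    have hPQ := h.valueAtInfty_mul_inv hr ht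
    obtain ⟨Y', hYY⟩ := h.exists_gauge_inv hr ht
    have hcu : ContinuousAt (fun s => Function.update t J s) (t J) :=
      (hasDerivAt_update t J (t J)).continuousAt
    have hev := hcu.eventually (p := fun t' => valueAtInfty (Y t') = valueAtInfty (Y t)) (by
      beta_reduce
      rw [Function.update_eq_self]
      exact h.eventually_valueAtInfty_eq hr ht)
    set P := valueAtInfty (Y t) with hP
    have hdT : dTime J (fun t => ((valueAtInfty (Y t))⁻¹).map Polynomial.C * A t *
        (valueAtInfty (Y t)).map Polynomial.C) t x = P⁻¹ * dTime J A t x * P := by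
      ext1 i j
      refine HasDerivAt.deriv (HasDerivAt.congr_of_eventuallyEq
        (f := fun s => (P⁻¹ * evalAt (A (Function.update t J s)) x * P) i j) ?_
          (hev.mono fun s hs => by simp only [hs, evalAt_conj]))
      simp only [Matrix.mul_apply]
      exact HasDerivAt.fun_sum fun l _ => HasDerivAt.mul_const
        (HasDerivAt.fun_sum fun m _ => HasDerivAt.const_mul _
          (h.hasDerivAt_evalAt ht J x m l).differentiableAt.hasDerivAt) _
    have hfl := h.flow J t ht x
    beta_reduce at hfl ⊢
    rw [hdT, ← hP, defMatrix_conj (r := r) hPQ hYY (by have := J.2; omega), dxPoly_conj, evalAt_conj,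
      evalAt_conj, evalAt_conj]
    have hm : ∀ X Z : Matrix (Fin n) (Fin n) ℂ, P⁻¹ * X * P * (P⁻¹ * Z * P) = P⁻¹ * (X * Z) * P := by
      intro X Z
      simp only [mul_assoc]
      rw [← mul_assoc P P⁻¹, hPQ, one_mul]
    rw [hm, hm, ← sub_mul, ← mul_sub, ← sub_mul, ← mul_sub, ← add_mul, ← mul_add, hfl, mul_zero,
      zero_mul]

theorem IsDeformation.casimirU_conj (hr : 2 ≤ r) (h : IsDeformation n r W A Y)
    {t : Fin (r * n) → ℂ} (ht : t ∈ W) :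
    casimirU (((valueAtInfty (Y t))⁻¹).map PowerSeries.C * Y t) = 0 :=
  sub_eq_zero.2 (h.constTerm_conj hr ht)

end Conjugation

end JordanConnection

open JordanConnection in
theorem mainTheorem4 (n r : ℕ) (hn : 1 ≤ n) (hr : 2 ≤ r) :
    -- existence and uniqueness of the formal solution (of the exponents and of the gauge)
    (∀ (τ : ℕ → ℂ) (A : Matrix (Fin n) (Fin n) (Polynomial ℂ)), IsGaugeFixed n r τ A →
      ∃! s : ℂ × (Fin (r * n) → ℂ) × Matrix (Fin n) (Fin n) (PowerSeries ℂ),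
        IsFormalSolution n r A s.1 s.2.1 s.2.2) ∧
    -- the parameters of the gauge-fixed form are the first times, and `U` commutes with `𝒩`
    (∀ (τ : ℕ → ℂ) (A : Matrix (Fin n) (Fin n) (Polynomial ℂ)) (t0 : ℂ) (t : Fin (r * n) → ℂ)
      (Y : Matrix (Fin n) (Fin n) (PowerSeries ℂ)),
      IsGaugeFixed n r τ A → IsFormalSolution n r A t0 t Y →
        (∀ j < n, time t (r * n - j) = τ j) ∧ time t (r * n - 1) ≠ 0 ∧
        Commute (casimirU Y) (jordanN n)) ∧
    -- `U` is rational in `t_{rn-1}` (with poles at `0` only), polynomial in the other coefficients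
    (∃ (k : ℕ) (P : Fin n → Fin n → MvPolynomial (Fin r × Fin n × Fin n) ℂ),
      ∀ (τ : ℕ → ℂ) (A : Matrix (Fin n) (Fin n) (Polynomial ℂ)) (t0 : ℂ) (t : Fin (r * n) → ℂ)
        (Y : Matrix (Fin n) (Fin n) (PowerSeries ℂ)),
        IsGaugeFixed n r τ A → IsFormalSolution n r A t0 t Y →
          ∀ i j, casimirU Y i j =
            MvPolynomial.eval (fun v => (A v.2.1 v.2.2).coeff v.1.val) (P i j) /
              time t (r * n - 1) ^ k) ∧
    -- every gauge-fixed connection belongs to a deformation depending on all its times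
    (∀ (τ : ℕ → ℂ) (A₁ : Matrix (Fin n) (Fin n) (Polynomial ℂ)) (t0 : ℂ) (t₁ : Fin (r * n) → ℂ)
      (Y₁ : Matrix (Fin n) (Fin n) (PowerSeries ℂ)),
      IsGaugeFixed n r τ A₁ → IsFormalSolution n r A₁ t0 t₁ Y₁ →
        ∃ W A Y, IsDeformation n r W A Y ∧ t₁ ∈ W ∧ A t₁ = A₁ ∧ Y t₁ = Y₁) ∧
    -- properties of all deformations
    (∀ (W : Set (Fin (r * n) → ℂ))
      (A : (Fin (r * n) → ℂ) → Matrix (Fin n) (Fin n) (Polynomial ℂ))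
      (Y : (Fin (r * n) → ℂ) → Matrix (Fin n) (Fin n) (PowerSeries ℂ)),
      IsDeformation n r W A Y →
        -- pairwise zero-curvature conditions
        (∀ J : Fin (r * n), HolomorphicOn W (fun t => defMatrix (Y t) (J.val + 1)) ∧
          ZeroCurvatureX W J (fun t => defMatrix (Y t) (J.val + 1)) A) ∧
        (∀ J K : Fin (r * n), ZeroCurvatureT W J K
          (fun t => defMatrix (Y t) (J.val + 1)) (fun t => defMatrix (Y t) (K.val + 1))) ∧
        -- Frobenius integrability of the Pfaffian system
        PfaffianIntegrable W A (fun J t => defMatrix (Y t) (J.val + 1)) ∧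
        -- `U` is a constant of all the motions
        (∀ t ∈ W, ∀ i j, HasFDerivAt (fun t' => casimirU (Y t') i j)
          (0 : (Fin (r * n) → ℂ) →L[ℂ] ℂ) t) ∧
        -- conjugation by `1 + U` gives a deformation with `U = 0`
        IsDeformation n r W
          (fun t => ((valueAtInfty (Y t))⁻¹).map Polynomial.C * A t *
            (valueAtInfty (Y t)).map Polynomial.C)
          (fun t => ((valueAtInfty (Y t))⁻¹).map PowerSeries.C * Y t) ∧
        ∀ t ∈ W, casimirU (((valueAtInfty (Y t))⁻¹).map PowerSeries.C * Y t) = 0) := by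
  have : NeZero n := ⟨by omega⟩
  refine ⟨fun τ A hA => hA.existsUnique_formalSolution hr, fun τ A t0 t Y hA hY => ?_,
    exists_casimirU_eq_eval_div n hr,
    fun τ A₁ t0 t₁ Y₁ hA hY => exists_isDeformation hr hA hY,
    fun W A Y h => ⟨fun J => ⟨h.holomorphicOn_defMatrix hr J, h.flow J⟩,
      fun J K => h.zeroCurvature hr J K, h.pfaffianIntegrable hr, fun t ht i j => ?_, h.conj hr,
      fun t ht => h.casimirU_conj hr ht⟩⟩
  · obtain ⟨h1, h2⟩ := hA.time_eq hr hY
    exact ⟨h1, h2 ▸ hA.lidskii_ne_zero, hA.commute_casimirU hr hY⟩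
  · exact (h.hasFDerivAt_constTerm hr ht i j).sub_const _
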